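/- Let $n\ge 1$ and let $\mathfrak{sp}_{2n}=\mathfrak{sp}_{2n}(\mathbb C)=\mathfrak n^+\oplus\mathfrak h\oplus\mathfrak n^-$ be a Cartan decomposition, with simple roots $\alpha_1,\dots,\alpha_n$ (Bourbaki numbering) and fundamental weights $\omega_1,\dots,\omega_n$. Let $J=\{1<\dots<n<\overline{n-1}<\dots<\overline 1\}$ and, for $x\in J\setminus\{\overline 1\}$, let $x+1$ be its successor; put $\overline n=n$. The positive roots are $$\alpha_{i,j}=\alpha_i+\dots+\alpha_j\ (1\le i\le j\le n),\qquad \alpha_{i,\overline j}=\alpha_i+\dots+\alpha_n+\alpha_{n-1}+\dots+\alpha_j\ (1\le i\le j\le n),$$ where $\alpha_{i,\overline n}=\alpha_{i,n}$; for every positive root $\beta$ fix a nonzero root vector $f_\beta\in\mathfrak n^-_{-\beta}$. For a dominant integral weight $\lambda=m_1\omega_1+\dots+m_n\omega_n$ let $V(\lambda)$ be the irreducible $\mathfrak{sp}_{2n}$-module of highest weight $\lambda$ with highest weight vector $v_\lambda$, let $$V(\lambda)_s=\mathrm{span}\{x_1\cdots x_l v_\lambda : x_i\in\mathfrak n^-,\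 l\le s\}$$ be its PBW filtration, and let $gr\,V(\lambda)=\bigoplus_{s\ge 0}V(\lambda)_s/V(\lambda)_{s-1}$ (with $V(\lambda)_{-1}=0$) be the associated graded space, viewed as a module over the symmetric algebra $S(\mathfrak n^-)$; the image of $v_\lambda$ in it is again denoted $v_\lambda$. A symplectic Dyck path is a sequence $\mathbf p=(p(0),\dots,p(k))$, $k\ge 0$, of positive roots such that $p(0)=\alpha_{i,i}$ for some $i$, $p(k)=\alpha_{j,j}$ or $p(k)=\alpha_{j,\overline j}$ for some $j\ge i$, and, if $p(s)=\alpha_{r,q}$ with $r,q\in J$, then $p(s+1)=\alpha_{r,q+1}$ or $p(s+1)=\alpha_{r+1,q}$. Let $P(\lambda)\subset\mathbb R_{\ge 0}^{n^2}$ be the set of all $(s_\beta)_{\beta>0}$, $s_\beta\ge0$, such that for every Dyck path with $p(0)=\alpha_{i,i}$ $$s_{p(0)}+\dots+s_{p(k)}\le m_i+\dots+m_j\ \text{ if } p(k)=\alpha_{j,j},\qquad s_{p(0)}+\dots+s_{p(k)}\le m_i+\dots+m_n\ \text{ if } p(k)=\alpha_{j,\overline j},$$ and let $S(\lambda)$ be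 the set of integral points of $P(\lambda)$. For $\mathbf s=(s_\beta)_{\beta>0}$ with $s_\beta\in\mathbb Z_{\ge0}$ put $f^{\mathbf s}=\prod_{\beta>0}f_\beta^{s_\beta}\in S(\mathfrak n^-)$. Finally let $U(\mathfrak n^+)$ act on $S(\mathfrak n^-)=S(\mathfrak{sp}_{2n})/S(\mathfrak{sp}_{2n})(\mathfrak h\oplus\mathfrak n^+)$ by the action induced by the adjoint action. Then, for all dominant integral weights $\lambda=\sum_i m_i\omega_i$ and $\mu$: i) The vectors $f^{\mathbf s}v_\lambda$, $\mathbf s\in S(\lambda)$, form a basis of $gr\,V(\lambda)$. ii) The annihilator $I(\lambda)\subset S(\mathfrak n^-)$ of $v_\lambda\in gr\,V(\lambda)$ is the ideal $S(\mathfrak n^-)\,(U(\mathfrak n^+)\circ R)$, where $$R=\mathrm{span}\{f_{\alpha_{i,j}}^{m_i+\dots+m_j+1}\ (1\le i\le j\le n-1),\quad f_{\alpha_{i,\overline i}}^{m_i+\dots+m_n+1}\ (1\le i\le n)\}.$$ iii) The $S(\mathfrak n^-)$-submodule of $gr\,V(\lambda)\otimes gr\,V(\mu)$ generated by $v_\lambda\otimes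 v_\mu$, where $x\in\mathfrak n^-$ acts by $x\otimes1+1\otimes x$, is isomorphic to $gr\,V(\lambda+\mu)$ as an $S(\mathfrak n^-)$-module. -/

import Mathlib

open scoped DirectSum TensorProduct

noncomputable section

namespace PBW

/-! ### Modules over a symmetric algebra given by commuting operators -/

section CommutingOperators

variable {R L E : Type*} [CommRing R] [AddCommGroup L] [Module R L] [AddCommGroup E] [Module R E]

/-- The algebra of operators generated by a commuting family is a commutative ring. -/
abbrev adjoinCommRing (T : L →ₗ[R] Module.End R E) (hT : ∀ x y, T x * T y = T y * T x) :
    CommRing (Algebra.adjoin R (Set.range T)) :=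
  { (Algebra.adjoin R (Set.range T)).toRing with
    mul_comm := fun a b =>
      (Algebra.isMulCommutative_adjoin R (s := Set.range T) (by
        rintro _ ⟨x, rfl⟩ _ ⟨y, rfl⟩
        exact hT x y)).is_comm.comm a b }

/-- A linear family of pairwise commuting operators `T x`, `x ∈ L`, on `E` extends to an algebra
homomorphism `S(L) → End E`. -/
def symRep (T : L →ₗ[R] Module.End R E) (hT : ∀ x y, T x * T y = T y * T x) :
    SymmetricAlgebra R L →ₐ[R] Module.End R E :=
  letI : CommRing (Algebra.adjoin R (Set.range T)) := adjoinCommRing T hT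
  (Algebra.adjoin R (Set.range T)).val.comp
    (SymmetricAlgebra.lift
      (T.codRestrict (Subalgebra.toSubmodule (Algebra.adjoin R (Set.range T)))
        fun x => Algebra.subset_adjoin ⟨x, rfl⟩))

theorem symRep_ι (T : L →ₗ[R] Module.End R E) (hT : ∀ x y, T x * T y = T y * T x) (x : L) :
    symRep T hT (SymmetricAlgebra.ι R L x) = T x := by
  let : CommRing (Algebra.adjoin R (Set.range T)) := adjoinCommRing T hT
  simp only [symRep]
  change (Algebra.adjoin R (Set.range T)).val (SymmetricAlgebra.lift _ _) = _
  erw [SymmetricAlgebra.lift_ι_apply]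
  rfl

end CommutingOperators

/-! ### Derivations of a symmetric algebra -/

section SymDerivation

attribute [local instance 100] LieRing.ofAssociativeRing

variable {R L : Type*} [CommRing R] [AddCommGroup L] [Module R L]

/-- The algebra homomorphism `a ↦ a + ε D(a)` into the dual numbers over `S(L)` determined by
`D (ι x) = ι (d x)`. -/
def symDerivationAux (d : L →ₗ[R] L) :
    SymmetricAlgebra R L →ₐ[R] TrivSqZeroExt (SymmetricAlgebra R L) (SymmetricAlgebra R L) :=
  SymmetricAlgebra.lift
    (((TrivSqZeroExt.inlAlgHom R (SymmetricAlgebra R L) (SymmetricAlgebra R L)).toLinearMap ∘ₗ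
        SymmetricAlgebra.ι R L) +
      ((TrivSqZeroExt.inrHom (SymmetricAlgebra R L) (SymmetricAlgebra R L)).restrictScalars R ∘ₗ
        SymmetricAlgebra.ι R L ∘ₗ d))

theorem symDerivationAux_fst (d : L →ₗ[R] L) (p : SymmetricAlgebra R L) :
    (symDerivationAux d p).fst = p := by
  have h : (TrivSqZeroExt.fstHom R (SymmetricAlgebra R L) (SymmetricAlgebra R L)).comp
      (symDerivationAux d) = AlgHom.id R _ := by
    apply SymmetricAlgebra.algHom_ext
    ext x
    simp [symDerivationAux]
  exact congrArg (fun F => F p) h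

/-- The unique derivation `D` of `S(L)` with `D (ι x) = ι (d x)` for a linear map `d : L → L`. -/
def symDerivation (d : L →ₗ[R] L) :
    Derivation R (SymmetricAlgebra R L) (SymmetricAlgebra R L) :=
  Derivation.mk'
    ((TrivSqZeroExt.sndHom (SymmetricAlgebra R L) (SymmetricAlgebra R L)).restrictScalars R ∘ₗ
      (symDerivationAux d).toLinearMap) (by
    intro a b
    simp [TrivSqZeroExt.snd_mul, symDerivationAux_fst, mul_comm])

theorem symDerivation_ι (d : L →ₗ[R] L) (x : L) :
    symDerivation d (SymmetricAlgebra.ι R L x) = SymmetricAlgebra.ι R L (d x) := by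
  simp [symDerivation, symDerivationAux]

theorem symDerivation_ext {D₁ D₂ : Derivation R (SymmetricAlgebra R L) (SymmetricAlgebra R L)}
    (h : ∀ x, D₁ (SymmetricAlgebra.ι R L x) = D₂ (SymmetricAlgebra.ι R L x)) : D₁ = D₂ := by
  ext p
  induction p using SymmetricAlgebra.induction with
  | algebraMap r => simp
  | ι x => exact h x
  | mul a b ha hb => simp [ha, hb]
  | add a b ha hb => simp [ha, hb]

theorem symDerivation_add (d d' : L →ₗ[R] L) :
    symDerivation (d + d') = symDerivation d + symDerivation d' :=
  symDerivation_ext fun x => by simp [symDerivation_ι]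

theorem symDerivation_smul (c : R) (d : L →ₗ[R] L) :
    symDerivation (c • d) = c • symDerivation d :=
  symDerivation_ext fun x => by simp [symDerivation_ι]

theorem symDerivation_comm (d₁ d₂ d₃ : L →ₗ[R] L) (h : ∀ x, d₃ x = d₁ (d₂ x) - d₂ (d₁ x))
    (p : SymmetricAlgebra R L) :
    symDerivation d₃ p =
      symDerivation d₁ (symDerivation d₂ p) - symDerivation d₂ (symDerivation d₁ p) := by
  have h' : symDerivation d₃ = ⁅symDerivation d₁, symDerivation d₂⁆ :=
    symDerivation_ext fun x => by
      rw [Derivation.commutator_apply]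
      simp [symDerivation_ι, h]
  rw [h', Derivation.commutator_apply]

/-- A representation of a Lie algebra `G` on `L` extends to a representation on `S(L)` by
derivations. -/
def symDerivationHom {G : Type*} [LieRing G] [LieAlgebra R G] (d : G → L →ₗ[R] L)
    (h_add : ∀ e e', d (e + e') = d e + d e') (h_smul : ∀ (c : R) e, d (c • e) = c • d e)
    (h_lie : ∀ e e' x, d ⁅e, e'⁆ x = d e (d e' x) - d e' (d e x)) :
    G →ₗ⁅R⁆ Module.End R (SymmetricAlgebra R L) where
  toFun e := (symDerivation (d e) : SymmetricAlgebra R L →ₗ[R] SymmetricAlgebra R L)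
  map_add' e e' := by
    rw [h_add, symDerivation_add]
    rfl
  map_smul' c e := by
    rw [h_smul, symDerivation_smul]
    rfl
  map_lie' {e e'} := LinearMap.ext fun p => symDerivation_comm _ _ _ (h_lie e e') p

end SymDerivation

/-! ### The PBW filtration and the associated graded module -/

section Filtration

variable (R L : Type*) [CommRing R] [LieRing L] [LieAlgebra R L]

/-- The degree filtration of the enveloping algebra:
`U(L)_s = span {x₁ ⋯ x_l : x_i ∈ L, l ≤ s}`. -/
def envFiltration (s : ℕ) : Submodule R (UniversalEnvelopingAlgebra R L) :=
  Submodule.span R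
    {u | ∃ l : List L, l.length ≤ s ∧ u = (l.map (UniversalEnvelopingAlgebra.ι R)).prod}

variable {M : Type*} [AddCommGroup M] [Module R M] [LieRingModule L M] [LieModule R L M]

/-- The linear map `U(L) → M`, `u ↦ u v`. -/
def orbitMap (v : M) : UniversalEnvelopingAlgebra R L →ₗ[R] M :=
  LinearMap.applyₗ v ∘ₗ
    (UniversalEnvelopingAlgebra.lift R (LieModule.toEnd R L M)).toLinearMap

/-- The PBW filtration `M_s = U(L)_s v`. -/
def filtration (v : M) (s : ℕ) : Submodule R M :=
  (envFiltration R L s).map (orbitMap R L v)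

/-- `M_{s-1}`, with `M_{-1} = 0`. -/
def filtrationPred (v : M) : ℕ → Submodule R M
  | 0 => ⊥
  | s + 1 => filtration R L v s

theorem lie_mem_filtration (v : M) (s : ℕ) (x : L) {m : M} (hm : m ∈ filtration R L v s) :
    ⁅x, m⁆ ∈ filtration R L v (s + 1) := by
  obtain ⟨u, hu, rfl⟩ := hm
  refine ⟨UniversalEnvelopingAlgebra.ι R x * u, ?_, by simp [orbitMap]⟩
  refine Submodule.span_induction (p := fun u _ =>
    UniversalEnvelopingAlgebra.ι R x * u ∈ envFiltration R L (s + 1)) ?_ ?_ ?_ ?_ hu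
  · rintro _ ⟨l, hl, rfl⟩
    exact Submodule.subset_span ⟨x :: l, by simpa using hl, by simp⟩
  · simp
  · intro a b _ _ ha hb
    rw [mul_add]
    exact add_mem ha hb
  · intro c a _ ha
    rw [mul_smul_comm]
    exact Submodule.smul_mem _ _ ha

theorem lie_mem_filtrationPred (v : M) (s : ℕ) (x : L) {m : M}
    (hm : m ∈ filtrationPred R L v s) : ⁅x, m⁆ ∈ filtrationPred R L v (s + 1) := by
  cases s with
  | zero =>
    have : m = 0 := hm
    simp [this]
  | succ s => exact lie_mem_filtration R L v s x hm

/-- The graded piece `gr_s M = M_s / M_{s-1}`. -/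
abbrev GrPiece (v : M) (s : ℕ) : Type _ :=
  filtration R L v s ⧸ (filtrationPred R L v s).submoduleOf (filtration R L v s)

/-- The class in `gr_s M` of an element of `M_s`. -/
def grClass (v : M) (s : ℕ) : filtration R L v s →ₗ[R] GrPiece R L v s :=
  Submodule.mkQ _

/-- The action of `x ∈ L` as a map `M_s → M_{s+1}`. -/
def actFil (v : M) (s : ℕ) (x : L) : filtration R L v s →ₗ[R] filtration R L v (s + 1) :=
  (LieModule.toEnd R L M x).restrict fun _ hm => lie_mem_filtration R L v s x hm

/-- The action of `x ∈ L` as a map `gr_s M → gr_{s+1} M`. -/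
def actPiece (v : M) (s : ℕ) (x : L) : GrPiece R L v s →ₗ[R] GrPiece R L v (s + 1) :=
  Submodule.mapQ _ _ (actFil R L v s x) fun _ hm => lie_mem_filtrationPred R L v s x hm

/-- The associated graded space `gr M = ⨁ M_s / M_{s-1}` of the PBW filtration of the `L`-module
`M` with respect to the vector `v`. -/
def Gr (v : M) : Type _ := ⨁ s, GrPiece R L v s

instance (v : M) : AddCommGroup (Gr R L v) :=
  inferInstanceAs (AddCommGroup (⨁ s, GrPiece R L v s))

instance (v : M) : Module R (Gr R L v) :=
  inferInstanceAs (Module R (⨁ s, GrPiece R L v s))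

/-- The inclusion of the graded piece of degree `s`. -/
def grOf (v : M) (s : ℕ) : GrPiece R L v s →ₗ[R] Gr R L v :=
  DirectSum.lof R ℕ (fun s => GrPiece R L v s) s

theorem gr_hom_ext (v : M) {N : Type*} [AddCommGroup N] [Module R N] {F G : Gr R L v →ₗ[R] N}
    (h : ∀ (s : ℕ) (m : filtration R L v s),
      F (grOf R L v s (grClass R L v s m)) = G (grOf R L v s (grClass R L v s m))) : F = G := by
  refine DirectSum.linearMap_ext R fun s => ?_
  refine Submodule.linearMap_qext _ ?_
  ext m
  exact h s m

/-- The operator on `gr M` induced by `x ∈ L`. -/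
def grAct (v : M) (x : L) : Module.End R (Gr R L v) :=
  DirectSum.toModule R ℕ (Gr R L v) fun s => grOf R L v (s + 1) ∘ₗ actPiece R L v s x

theorem grAct_apply (v : M) (x : L) (s : ℕ) (m : filtration R L v s) :
    grAct R L v x (grOf R L v s (grClass R L v s m)) =
      grOf R L v (s + 1) (grClass R L v (s + 1) (actFil R L v s x m)) := by
  erw [DirectSum.toModule_lof]
  rfl

/-- The operators on `gr M` induced by the elements of `L`, as a linear map. -/
def grActHom (v : M) : L →ₗ[R] Module.End R (Gr R L v) where
  toFun := grAct R L v
  map_add' x y := by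
    refine gr_hom_ext R L v fun s m => ?_
    rw [LinearMap.add_apply, grAct_apply, grAct_apply, grAct_apply, ← map_add, ← map_add]
    congr 2
    ext
    exact add_lie x y (m : M)
  map_smul' c x := by
    refine gr_hom_ext R L v fun s m => ?_
    rw [RingHom.id_apply, LinearMap.smul_apply, grAct_apply, grAct_apply, ← map_smul, ← map_smul]
    congr 2
    ext
    exact smul_lie c x (m : M)

theorem grActHom_comm (v : M) (x y : L) :
    grActHom R L v x * grActHom R L v y = grActHom R L v y * grActHom R L v x := by
  refine gr_hom_ext R L v fun s m => ?_
  change grAct R L v x (grAct R L v y (grOf R L v s (grClass R L v s m))) =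
    grAct R L v y (grAct R L v x (grOf R L v s (grClass R L v s m)))
  rw [grAct_apply, grAct_apply, grAct_apply, grAct_apply]
  congr 1
  rw [← sub_eq_zero, ← map_sub]
  refine (Submodule.Quotient.mk_eq_zero _).2 (Submodule.mem_comap.2 ?_)
  have h : ⁅⁅x, y⁆, (m : M)⁆ ∈ filtration R L v (s + 1) := lie_mem_filtration R L v s _ m.2
  rw [lie_lie] at h
  exact h

/-- `gr M` as a module over the symmetric algebra `S(L)`: the element `x ∈ L` sends the class in
`gr_s M` of `m ∈ M_s` to the class in `gr_{s+1} M` of `x m ∈ M_{s+1}`. -/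
instance (v : M) : Module (SymmetricAlgebra R L) (Gr R L v) :=
  Module.compHom (Gr R L v) (symRep (grActHom R L v) (grActHom_comm R L v)).toRingHom

instance (v : M) : IsScalarTower R (SymmetricAlgebra R L) (Gr R L v) where
  smul_assoc c p a := by
    change symRep (grActHom R L v) (grActHom_comm R L v) (c • p) a =
      c • symRep (grActHom R L v) (grActHom_comm R L v) p a
    rw [map_smul, LinearMap.smul_apply]

theorem ι_smul_gr (v : M) (x : L) (s : ℕ) (m : filtration R L v s) :
    SymmetricAlgebra.ι R L x • grOf R L v s (grClass R L v s m) =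
      grOf R L v (s + 1) (grClass R L v (s + 1) (actFil R L v s x m)) := by
  rw [← grAct_apply]
  exact congrArg (fun F : Module.End R (Gr R L v) => F _) (symRep_ι _ (grActHom_comm R L v) x)

theorem mem_filtration_zero (v : M) : v ∈ filtration R L v 0 :=
  ⟨1, Submodule.subset_span ⟨[], by simp⟩, by simp [orbitMap]⟩

/-- The class of the cyclic vector `v` in `gr_0 M`, as an element of `gr M`. -/
def grVec (v : M) : Gr R L v :=
  grOf R L v 0 (grClass R L v 0 ⟨v, mem_filtration_zero R L v⟩)

end Filtration

/-! ### Tensor products of associated graded modules -/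

section Tensor

variable (R L : Type*) [CommRing R] [LieRing L] [LieAlgebra R L]
variable {M : Type*} [AddCommGroup M] [Module R M] [LieRingModule L M] [LieModule R L M]
variable {N : Type*} [AddCommGroup N] [Module R N] [LieRingModule L N] [LieModule R L N]

/-- The tensor product `gr M ⊗ gr N` over the base ring. -/
def GrTensor (v : M) (w : N) : Type _ := Gr R L v ⊗[R] Gr R L w

instance (v : M) (w : N) : AddCommGroup (GrTensor R L v w) :=
  inferInstanceAs (AddCommGroup (Gr R L v ⊗[R] Gr R L w))

instance (v : M) (w : N) : Module R (GrTensor R L v w) :=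
  inferInstanceAs (Module R (Gr R L v ⊗[R] Gr R L w))

/-- The operator `x ⊗ 1 + 1 ⊗ x` on `gr M ⊗ gr N`, as a linear function of `x ∈ L`. -/
def tensorActHom (v : M) (w : N) : L →ₗ[R] Module.End R (GrTensor R L v w) :=
  LinearMap.rTensorHom (Gr R L w) ∘ₗ grActHom R L v +
    LinearMap.lTensorHom (Gr R L v) ∘ₗ grActHom R L w

theorem tensorActHom_comm (v : M) (w : N) (x y : L) :
    tensorActHom R L v w x * tensorActHom R L v w y =
      tensorActHom R L v w y * tensorActHom R L v w x := by
  refine TensorProduct.ext' fun a b => ?_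
  have h₁ : ∀ a, grActHom R L v x (grActHom R L v y a) = grActHom R L v y (grActHom R L v x a) :=
    fun a => congrArg (fun F : Module.End R (Gr R L v) => F a) (grActHom_comm R L v x y)
  have h₂ : ∀ b, grActHom R L w x (grActHom R L w y b) = grActHom R L w y (grActHom R L w x b) :=
    fun b => congrArg (fun F : Module.End R (Gr R L w) => F b) (grActHom_comm R L w x y)
  have h : ∀ (z : L) (a : Gr R L v) (b : Gr R L w),
      tensorActHom R L v w z (a ⊗ₜ[R] b) =
        (grActHom R L v z a ⊗ₜ[R] b + a ⊗ₜ[R] grActHom R L w z b : Gr R L v ⊗[R] Gr R L w) :=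
    fun _ _ _ => rfl
  change tensorActHom R L v w x (tensorActHom R L v w y (a ⊗ₜ[R] b)) =
    tensorActHom R L v w y (tensorActHom R L v w x (a ⊗ₜ[R] b))
  rw [h, h]
  erw [map_add, map_add, h, h, h, h, h₁, h₂]
  abel

/-- `gr M ⊗ gr N` as an `S(L)`-module, where `x ∈ L` acts by `x ⊗ 1 + 1 ⊗ x`. -/
instance (v : M) (w : N) : Module (SymmetricAlgebra R L) (GrTensor R L v w) :=
  Module.compHom (GrTensor R L v w)
    (symRep (tensorActHom R L v w) (tensorActHom_comm R L v w)).toRingHom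

instance (v : M) (w : N) : IsScalarTower R (SymmetricAlgebra R L) (GrTensor R L v w) where
  smul_assoc c p a := by
    change symRep (tensorActHom R L v w) (tensorActHom_comm R L v w) (c • p) a =
      c • symRep (tensorActHom R L v w) (tensorActHom_comm R L v w) p a
    rw [map_smul, LinearMap.smul_apply]

theorem ι_smul_tensor (v : M) (w : N) (x : L) (a : Gr R L v) (b : Gr R L w) :
    SymmetricAlgebra.ι R L x • (show GrTensor R L v w from a ⊗ₜ[R] b) =
      (show GrTensor R L v w from
        (SymmetricAlgebra.ι R L x • a) ⊗ₜ[R] b + a ⊗ₜ[R] (SymmetricAlgebra.ι R L x • b)) := by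
  have h₁ : grActHom R L v x a = SymmetricAlgebra.ι R L x • a :=
    (congrArg (fun F : Module.End R (Gr R L v) => F a)
      (symRep_ι _ (grActHom_comm R L v) x)).symm
  have h₂ : grActHom R L w x b = SymmetricAlgebra.ι R L x • b :=
    (congrArg (fun F : Module.End R (Gr R L w) => F b)
      (symRep_ι _ (grActHom_comm R L w) x)).symm
  rw [← h₁, ← h₂]
  exact congrArg (fun F : Module.End R (GrTensor R L v w) => F _)
    (symRep_ι _ (tensorActHom_comm R L v w) x)

/-- The `S(L)`-submodule `gr(M, N)` of `gr M ⊗ gr N` generated by the tensor product of the cyclic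
vectors. -/
def grCartan (v : M) (w : N) : Submodule (SymmetricAlgebra R L) (GrTensor R L v w) :=
  Submodule.span (SymmetricAlgebra R L) {(grVec R L v ⊗ₜ[R] grVec R L w : Gr R L v ⊗[R] Gr R L w)}

end Tensor

/-! ### The symplectic Lie algebra and its standard Cartan decomposition -/

section Symplectic

attribute [local instance 100] LieRing.ofAssociativeRing

/-- The symplectic Lie algebra `sp_{2n}(ℂ)`: the block matrices `(a, b; c, -aᵀ)` with `b` and `c`
symmetric. -/
abbrev sp (n : ℕ) : LieSubalgebra ℂ (Matrix (Fin n ⊕ Fin n) (Fin n ⊕ Fin n) ℂ) :=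
  LieAlgebra.Symplectic.sp (Fin n) ℂ

theorem mem_sp_iff {n : ℕ} (A : Matrix (Fin n ⊕ Fin n) (Fin n ⊕ Fin n) ℂ) :
    A ∈ sp n ↔ (∀ i j, A (.inr i) (.inr j) = -A (.inl j) (.inl i)) ∧
      (∀ i j, A (.inl i) (.inr j) = A (.inl j) (.inr i)) ∧
      (∀ i j, A (.inr i) (.inl j) = A (.inr j) (.inl i)) := by
  have h : A ∈ sp n ↔ A.transpose * Matrix.J (Fin n) ℂ = Matrix.J (Fin n) ℂ * (-A) := by
    rw [sp, LieAlgebra.Symplectic.sp, mem_skewAdjointMatricesLieSubalgebra,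
      mem_skewAdjointMatricesSubmodule]
    rfl
  rw [h, ← Matrix.ext_iff]
  simp only [Matrix.J, Matrix.mul_apply, Fintype.sum_sum_type, Sum.forall, Matrix.transpose_apply,
    Matrix.fromBlocks_apply₁₁, Matrix.fromBlocks_apply₁₂, Matrix.fromBlocks_apply₂₁,
    Matrix.fromBlocks_apply₂₂, Matrix.zero_apply, Matrix.neg_apply, Matrix.one_apply]
  simp only [mul_zero, Finset.sum_const_zero, zero_add, add_zero, zero_mul, mul_neg, neg_mul,
    mul_ite, mul_one, ite_mul, one_mul, Finset.sum_neg_distrib, Finset.sum_ite_eq,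
    Finset.sum_ite_eq', Finset.mem_univ, if_true, neg_neg, neg_zero]
  constructor
  · intro H
    exact ⟨fun i j => (H.2 j).1 i, fun i j => neg_injective ((H.2 j).2 i), fun i j => (H.1 j).1 i⟩
  · rintro ⟨h₁, h₂, h₃⟩
    exact ⟨fun a => ⟨fun b => h₃ b a, fun b => (h₁ a b).symm⟩,
      fun b => ⟨fun a => h₁ a b, fun a => by rw [h₂ a b]⟩⟩

/-- The position of a basis vector in the ordering `1 < ⋯ < n < n̄ < ⋯ < 1̄` of the standard basis
of `ℂ^{2n}`, for which the standard Borel subalgebra is upper triangular. -/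
def pos {n : ℕ} : Fin n ⊕ Fin n → ℕ
  | .inl i => i
  | .inr i => 2 * n - 1 - i

/-- The Cartan subalgebra `h` of diagonal matrices. -/
def cartan (n : ℕ) : LieSubalgebra ℂ (sp n) where
  carrier := {A | ∀ p q, p ≠ q → A.1 p q = 0}
  add_mem' := by
    intro A B hA hB p q h
    simp [hA p q h, hB p q h]
  zero_mem' := by
    intro p q _
    simp
  smul_mem' := by
    intro c A hA p q h
    simp [hA p q h]
  lie_mem' := by
    intro A B hA hB p q h
    change (A.1 * B.1 - B.1 * A.1) p q = 0
    rw [Matrix.sub_apply, Matrix.mul_apply, Matrix.mul_apply,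
      Finset.sum_eq_zero, Finset.sum_eq_zero, sub_zero]
    · intro r _
      by_cases hr : p = r
      · subst hr
        rw [hA p q h, mul_zero]
      · rw [hB p r hr, zero_mul]
    · intro r _
      by_cases hr : p = r
      · subst hr
        rw [hB p q h, mul_zero]
      · rw [hA p r hr, zero_mul]

/-- The nilpotent subalgebra `n⁺` of strictly upper triangular matrices. -/
def nPlus (n : ℕ) : LieSubalgebra ℂ (sp n) where
  carrier := {A | ∀ p q, pos q ≤ pos p → A.1 p q = 0}
  add_mem' := by
    intro A B hA hB p q h
    simp [hA p q h, hB p q h]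
  zero_mem' := by
    intro p q _
    simp
  smul_mem' := by
    intro c A hA p q h
    simp [hA p q h]
  lie_mem' := by
    intro A B hA hB p q h
    change (A.1 * B.1 - B.1 * A.1) p q = 0
    rw [Matrix.sub_apply, Matrix.mul_apply, Matrix.mul_apply,
      Finset.sum_eq_zero, Finset.sum_eq_zero, sub_zero]
    · intro r _
      rcases le_total (pos r) (pos p) with hr | hr
      · rw [hB p r hr, zero_mul]
      · rw [hA r q (h.trans hr), mul_zero]
    · intro r _
      rcases le_total (pos r) (pos p) with hr | hr
      · rw [hA p r hr, zero_mul]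
      · rw [hB r q (h.trans hr), mul_zero]

/-- The nilpotent subalgebra `n⁻` of strictly lower triangular matrices. -/
def nMinus (n : ℕ) : LieSubalgebra ℂ (sp n) where
  carrier := {A | ∀ p q, pos p ≤ pos q → A.1 p q = 0}
  add_mem' := by
    intro A B hA hB p q h
    simp [hA p q h, hB p q h]
  zero_mem' := by
    intro p q _
    simp
  smul_mem' := by
    intro c A hA p q h
    simp [hA p q h]
  lie_mem' := by
    intro A B hA hB p q h
    change (A.1 * B.1 - B.1 * A.1) p q = 0
    rw [Matrix.sub_apply, Matrix.mul_apply, Matrix.mul_apply,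
      Finset.sum_eq_zero, Finset.sum_eq_zero, sub_zero]
    · intro r _
      rcases le_total (pos p) (pos r) with hr | hr
      · rw [hB p r hr, zero_mul]
      · rw [hA r q (hr.trans h), mul_zero]
    · intro r _
      rcases le_total (pos p) (pos r) with hr | hr
      · rw [hA p r hr, zero_mul]
      · rw [hB r q (hr.trans h), mul_zero]

/-- The projection `sp_{2n} = n⁺ ⊕ h ⊕ n⁻ → n⁻`: it keeps the strictly lower triangular entries. -/
def lowerPart (n : ℕ) : sp n →ₗ[ℂ] nMinus n where
  toFun A := ⟨⟨Matrix.of fun p q => if pos q < pos p then A.1 p q else 0, by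
    have hA := (mem_sp_iff A.1).1 A.2
    rw [mem_sp_iff]
    refine ⟨fun i j => ?_, fun i j => ?_, fun i j => ?_⟩ <;> have hi := i.2 <;> have hj := j.2 <;>
      rw [Matrix.of_apply, Matrix.of_apply]
    · by_cases h : (i : ℕ) < j
      · rw [if_pos (by simpa [pos] using by omega), if_pos (by simpa [pos] using h), hA.1]
      · rw [if_neg (by simpa [pos] using by omega), if_neg (by simpa [pos] using h), neg_zero]
    · rw [if_neg (by simpa [pos] using by omega), if_neg (by simpa [pos] using by omega)]
    · rw [if_pos (by simpa [pos] using by omega), if_pos (by simpa [pos] using by omega),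
        hA.2.2]⟩, by
    intro p q h
    simp [not_lt.2 h]⟩
  map_add' A B := by
    ext p q
    by_cases h : pos q < pos p <;> simp [h]
  map_smul' c A := by
    ext p q
    by_cases h : pos q < pos p <;> simp [h]

theorem lowerPart_apply {n : ℕ} (A : sp n) (p q : Fin n ⊕ Fin n) :
    (lowerPart n A).1.1 p q = if pos q < pos p then A.1 p q else 0 := rfl

/-- The kernel of the projection to `n⁻` is the Borel subalgebra `h ⊕ n⁺` of upper triangular
matrices. -/
theorem lowerPart_eq_zero_iff {n : ℕ} (A : sp n) :
    lowerPart n A = 0 ↔ ∀ p q, pos q < pos p → A.1 p q = 0 := by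
  constructor
  · intro h p q hpq
    have := lowerPart_apply A p q
    rw [h, if_pos hpq] at this
    exact this.symm
  · intro h
    ext p q
    rw [lowerPart_apply]
    by_cases hpq : pos q < pos p
    · rw [if_pos hpq, h p q hpq]
      rfl
    · rw [if_neg hpq]
      rfl

theorem lowerPart_coe {n : ℕ} (y : nMinus n) : lowerPart n (y : sp n) = y := by
  ext p q
  rw [lowerPart_apply]
  by_cases hpq : pos q < pos p
  · rw [if_pos hpq]
  · rw [if_neg hpq, y.2 p q (not_lt.1 hpq)]

theorem lowerPart_lie_lowerPart {n : ℕ} (e : nPlus n) (A : sp n) :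
    lowerPart n ⁅(e : sp n), (lowerPart n A : sp n)⁆ = lowerPart n ⁅(e : sp n), A⁆ := by
  rw [← sub_eq_zero, ← map_sub, ← lie_sub, lowerPart_eq_zero_iff]
  have hB : ∀ p q, pos q < pos p → ((lowerPart n A : sp n) - A).1 p q = 0 := by
    intro p q h
    change (lowerPart n A).1.1 p q - A.1 p q = 0
    rw [lowerPart_apply, if_pos h, sub_self]
  generalize (lowerPart n A : sp n) - A = B at hB
  intro p q h
  change (e.1.1 * B.1 - B.1 * e.1.1) p q = 0
  rw [Matrix.sub_apply, Matrix.mul_apply, Matrix.mul_apply,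
    Finset.sum_eq_zero, Finset.sum_eq_zero, sub_zero]
  · intro r _
    rcases lt_or_ge (pos r) (pos p) with hr | hr
    · rw [hB p r hr, zero_mul]
    · rw [e.2 r q (h.le.trans hr), mul_zero]
  · intro r _
    rcases lt_or_ge (pos p) (pos r) with hr | hr
    · rw [hB r q (h.trans hr), mul_zero]
    · rw [e.2 p r hr, zero_mul]

/-- The linear map `y ↦ [e, y]` modulo `h ⊕ n⁺` on `n⁻ = sp_{2n} / (h ⊕ n⁺)`, for `e ∈ n⁺`. -/
def adLower {n : ℕ} (e : nPlus n) : nMinus n →ₗ[ℂ] nMinus n where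
  toFun y := lowerPart n ⁅(e : sp n), (y : sp n)⁆
  map_add' y z := by
    rw [← map_add, ← lie_add]
    rfl
  map_smul' c y := by
    rw [RingHom.id_apply, ← map_smul, ← lie_smul]
    rfl

theorem adLower_apply {n : ℕ} (e : nPlus n) (y : nMinus n) :
    adLower e y = lowerPart n ⁅(e : sp n), (y : sp n)⁆ := rfl

theorem adLower_add {n : ℕ} (e e' : nPlus n) : adLower (e + e') = adLower e + adLower e' := by
  refine LinearMap.ext fun y => ?_
  rw [LinearMap.add_apply, adLower_apply, adLower_apply, adLower_apply, ← map_add, ← add_lie]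
  rfl

theorem adLower_smul {n : ℕ} (c : ℂ) (e : nPlus n) : adLower (c • e) = c • adLower e := by
  refine LinearMap.ext fun y => ?_
  rw [LinearMap.smul_apply, adLower_apply, adLower_apply, ← map_smul, ← smul_lie]
  rfl

theorem adLower_lie {n : ℕ} (e e' : nPlus n) (y : nMinus n) :
    adLower ⁅e, e'⁆ y = adLower e (adLower e' y) - adLower e' (adLower e y) := by
  simp only [adLower_apply]
  rw [lowerPart_lie_lowerPart, lowerPart_lie_lowerPart, ← map_sub, ← lie_lie]
  rfl

/-- The symmetric algebra `S(n⁻)`. -/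
abbrev SymMinus (n : ℕ) : Type := SymmetricAlgebra ℂ (nMinus n)

/-- The action of `n⁺` on `S(n⁻) = S(sp_{2n}) / S(sp_{2n})(h ⊕ n⁺)` induced by the adjoint action
on `S(sp_{2n})`: the element `e` acts as the derivation with `y ↦ [e, y]` modulo `h ⊕ n⁺`. -/
def nPlusAction (n : ℕ) : nPlus n →ₗ⁅ℂ⁆ Module.End ℂ (SymMinus n) :=
  symDerivationHom adLower adLower_add adLower_smul adLower_lie

theorem nPlusAction_apply {n : ℕ} (e : nPlus n) (p : SymMinus n) :
    nPlusAction n e p = symDerivation (adLower e) p := rfl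

/-- The action of the enveloping algebra `U(n⁺)` on `S(n⁻)`. -/
def envAction (n : ℕ) :
    UniversalEnvelopingAlgebra ℂ (nPlus n) →ₐ[ℂ] Module.End ℂ (SymMinus n) :=
  UniversalEnvelopingAlgebra.lift ℂ (nPlusAction n)

/-! ### Roots and weights -/

/-- The simple roots of `sp_{2n}` (indexed from `0`): `α_i = ε_i - ε_{i+1}` except for the last one,
which is `2 ε_{n-1}`; here `ε_i` is the `i`-th diagonal entry. -/
def simpleRoot {n : ℕ} (i : Fin n) (H : cartan n) : ℂ :=
  if h : (i : ℕ) + 1 < n then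
    H.1.1 (.inl i) (.inl i) - H.1.1 (.inl ⟨i + 1, h⟩) (.inl ⟨i + 1, h⟩)
  else 2 * H.1.1 (.inl i) (.inl i)

/-- The fundamental weights `ω_i = ε_0 + ⋯ + ε_i` (indexed from `0`). -/
def fundWeight {n : ℕ} (i : Fin n) (H : cartan n) : ℂ :=
  ∑ k ∈ Finset.Iic i, H.1.1 (.inl k) (.inl k)

/-- The dominant integral weight `λ = ∑ m_i ω_i`. -/
def domWeight {n : ℕ} (m : Fin n → ℕ) (H : cartan n) : ℂ :=
  ∑ i, (m i : ℂ) * fundWeight i H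

/-- The alphabet `J = {1 < ⋯ < n < \overline{n-1} < ⋯ < \overline{1}}` is represented by the
positions `0, …, 2n - 2` of its letters; `letter t` is the underlying element of `{1, …, n}`
(indexed from `0`) of the letter in position `t`, barred or not. -/
def letter {n : ℕ} (t : Fin (2 * n - 1)) : Fin n :=
  ⟨min (t : ℕ) (2 * n - 2 - t), by have := t.2; omega⟩

/-- The positive roots `α_{i,q}` of `sp_{2n}`, with `i ∈ {1, …, n}`, `q ∈ J` and
`i ≤ q ≤ \overline{i}`. In positions, the unbarred letter `j` is `j`, and the barred letter
`\overline{j}` is `2n - 2 - j`, all indexed from `0`. -/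
def PosRoot (n : ℕ) : Type :=
  {p : Fin n × Fin (2 * n - 1) // (p.1 : ℕ) ≤ p.2 ∧ (p.1 : ℕ) + p.2 ≤ 2 * n - 2}

instance (n : ℕ) : Fintype (PosRoot n) :=
  inferInstanceAs (Fintype
    {p : Fin n × Fin (2 * n - 1) // (p.1 : ℕ) ≤ p.2 ∧ (p.1 : ℕ) + p.2 ≤ 2 * n - 2})

/-- The first index `i` of `α_{i,q}`. -/
def PosRoot.row {n : ℕ} (β : PosRoot n) : Fin n := β.1.1

/-- The second index `q` of `α_{i,q}`, as a position in `J`. -/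
def PosRoot.col {n : ℕ} (β : PosRoot n) : Fin (2 * n - 1) := β.1.2

/-- The root `α_{i,q}` as a functional: the sum of `α_{|t|}` over all letters `i ≤ t ≤ q` of `J`,
that is, `α_{i,j} = α_i + ⋯ + α_j` and
`α_{i,\overline{j}} = α_i + ⋯ + α_n + α_{n-1} + ⋯ + α_j`. -/
def PosRoot.toFunctional {n : ℕ} (β : PosRoot n) (H : cartan n) : ℂ :=
  ∑ t : Fin (2 * n - 1),
    if (β.row : ℕ) ≤ t ∧ (t : ℕ) ≤ β.col then simpleRoot (letter t) H else 0

/-- `β` is a simple root `α_j = α_{j,j}`. -/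
def PosRoot.IsSimple {n : ℕ} (β : PosRoot n) : Prop := (β.col : ℕ) = β.row

/-- `β` is a root of the form `α_{j,\overline{j}}`. -/
def PosRoot.IsBar {n : ℕ} (β : PosRoot n) : Prop := (β.row : ℕ) + β.col = 2 * n - 2

/-- A choice of a nonzero root vector `f_β ∈ n⁻_{-β}` for every positive root `β`. -/
def IsRootVectors {n : ℕ} (f : PosRoot n → nMinus n) : Prop :=
  ∀ β, f β ≠ 0 ∧ ∀ H : cartan n,
    ⁅(H : sp n), (f β : sp n)⁆ = (-β.toFunctional H) • (f β : sp n)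

/-- `v` is a highest weight vector of weight `λ = ∑ m_i ω_i`. -/
structure IsHighestWeightVector {n : ℕ} (m : Fin n → ℕ) {V : Type*} [AddCommGroup V] [Module ℂ V]
    [LieRingModule (sp n) V] [LieModule ℂ (sp n) V] (v : V) : Prop where
  ne_zero : v ≠ 0
  nPlus_lie : ∀ x : nPlus n, ⁅(x : sp n), v⁆ = 0
  cartan_lie : ∀ H : cartan n, ⁅(H : sp n), v⁆ = domWeight m H • v

/-! ### Symplectic Dyck paths and the polytope -/

/-- `γ` may follow `β` in a Dyck path: if `β = α_{r,q}` then `γ = α_{r,q+1}` or `γ = α_{r+1,q}`. -/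
def DyckStep {n : ℕ} (β γ : PosRoot n) : Prop :=
  ((γ.row : ℕ) = β.row ∧ (γ.col : ℕ) = β.col + 1) ∨
    ((γ.row : ℕ) = β.row + 1 ∧ (γ.col : ℕ) = β.col)

/-- A symplectic Dyck path: a nonempty sequence of positive roots, starting at a simple root, ending
at a simple root or a root `α_{j,\overline{j}}`, with consecutive members related by `DyckStep`. -/
structure DyckPath (n : ℕ) where
  roots : List (PosRoot n)
  ne_nil : roots ≠ []
  chain : roots.IsChain DyckStep
  start_simple : (roots.head ne_nil).IsSimple
  end_simple_or_bar : (roots.getLast ne_nil).IsSimple ∨ (roots.getLast ne_nil).IsBar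

/-- The starting root `p(0)`. -/
def DyckPath.first {n : ℕ} (p : DyckPath n) : PosRoot n := p.roots.head p.ne_nil

/-- The final root `p(k)`. -/
def DyckPath.last {n : ℕ} (p : DyckPath n) : PosRoot n := p.roots.getLast p.ne_nil

/-- The polytope `P(λ)`, `λ = ∑ m_i ω_i`. -/
def polytope {n : ℕ} (m : Fin n → ℕ) : Set (PosRoot n → ℝ) :=
  {s | (∀ β, 0 ≤ s β) ∧ ∀ p : DyckPath n,
    (p.last.IsSimple →
      (p.roots.map s).sum ≤ ∑ k ∈ Finset.Icc p.first.row p.last.row, (m k : ℝ)) ∧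
    (p.last.IsBar →
      (p.roots.map s).sum ≤ ∑ k ∈ Finset.Ici p.first.row, (m k : ℝ))}

/-- The set `S(λ)` of lattice points of `P(λ)`. -/
def latticePoints {n : ℕ} (m : Fin n → ℕ) : Set (PosRoot n → ℕ) :=
  {s | (fun β => (s β : ℝ)) ∈ polytope m}

/-- The monomial `f^s = ∏ f_β^{s_β} ∈ S(n⁻)`. -/
def monomial {n : ℕ} (f : PosRoot n → nMinus n) (s : PosRoot n → ℕ) : SymMinus n :=
  ∏ β, SymmetricAlgebra.ι ℂ (nMinus n) (f β) ^ s β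

/-! ### The defining relations -/

/-- The space `R`, spanned by the powers `f_{α_{i,j}}^{m_i + ⋯ + m_j + 1}`, `1 ≤ i ≤ j ≤ n - 1`, and
`f_{α_{i,\overline{i}}}^{m_i + ⋯ + m_n + 1}`, `1 ≤ i ≤ n`. -/
def relSpace {n : ℕ} (f : PosRoot n → nMinus n) (m : Fin n → ℕ) : Submodule ℂ (SymMinus n) :=
  Submodule.span ℂ
    ({p | ∃ β : PosRoot n, (β.col : ℕ) + 1 < n ∧
        p = SymmetricAlgebra.ι ℂ (nMinus n) (f β) ^
          (∑ k ∈ Finset.Icc β.row (letter β.col), m k + 1)} ∪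
      {p | ∃ β : PosRoot n, β.IsBar ∧
        p = SymmetricAlgebra.ι ℂ (nMinus n) (f β) ^ (∑ k ∈ Finset.Ici β.row, m k + 1)})

/-- The ideal `S(n⁻)(U(n⁺) ∘ R)` of `S(n⁻)`. -/
def relIdeal {n : ℕ} (f : PosRoot n → nMinus n) (m : Fin n → ℕ) : Ideal (SymMinus n) :=
  Ideal.span {p | ∃ u : UniversalEnvelopingAlgebra ℂ (nPlus n), ∃ r ∈ relSpace f m,
    p = envAction n u r}

end Symplectic

end PBW

end

noncomputable section

namespace PBW

/-! ### Exponents of monomials: the lexicographic order and letter contents. -/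

section Combinatorics

variable {n : ℕ}

/-! Write $I$ for the ideal `relIdeal f m`. The proof bounds $S(\mathfrak n^-)/I$ from above and
$gr\,V(\lambda)$ from below. Both bounds are triangular for the same lexicographic order on
exponents, and they meet at $S(\lambda)$.

The identification $\mathfrak{sp}_{2n}\cong Sym^2(\mathbb C^{2n})$ is used throughout. Order the
standard basis by position. Up to a scalar and modulo $\mathfrak h\oplus\mathfrak n^+$, the root
vector of $\alpha_{r,q}$ is then a product of two basis vectors, its two "letters". In particular
$f_{\alpha_{i,\bar i}}$ is a square $e_i^2$.

Upper bound. $I$ is stable under the derivations coming from $\mathfrak n^+$, hence under their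
exponentials. From $(e_i^2)^N\in I$ follows $(z^2)^N\in I$ for every vector $z$ with nonzero $i$-th
coordinate and no earlier ones; $e_i\bar e_b$ is treated in the same way inside the
$\mathfrak{gl}_n$ part. Expanding in the coordinates of $z$ and separating torus weights gives
relations among monomials with equal letter content. An exponent supported on a Dyck path is the
lexicographically largest one with its letter content (`lex_lt_of_letterContent_eq`). A monomial
violating a Dyck path inequality is therefore congruent to smaller ones, and induction shows that
the $f^{\mathbf s}$ with $\mathbf s\in S(\lambda)$ span modulo $I$ (`exists_sub_mem_relIdeal`).

The relations hold. The module $V(\lambda)$ embeds in a tensor power of $\mathbb C^{2n}$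
(`exists_embedding`), where $\mathfrak{sl}_2$-theory kills the powers in $R$. Since $\mathfrak n^+$
acts on $gr\,V(\lambda)$ compatibly with its action on $S(\mathfrak n^-)$ and kills $v_\lambda$, all
of $I$ kills $v_\lambda$.

Lower bound. Every lattice point of $P(\lambda)$ is a sum of antichains of roots, $m_i$ of them at
the node $i$ (`exists_isAntichainSum`). The antichains prescribe a multi-index of the tensor power,
one column $e_1\wedge\dots\wedge e_i$ per antichain. Evaluation there induces a functional on
$gr\,V(\lambda)$ that is nonzero on $f^{\mathbf s}v_\lambda$ and vanishes on $f^{\mathbf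
t}v_\lambda$ unless $\mathbf t\ge\mathbf s$ (`exists_isLowFunctional`). This gives linear
independence, hence i) and ii).

For iii), the antichain decomposition splits a point of $S(\lambda+\mu)$ into a point for $\lambda$
and one for $\mu$, and tensor products of such functionals have the same triangularity
(`IsLowFunctional.tensor`). Thus $v_\lambda\otimes v_\mu$ and $v_{\lambda+\mu}$ have the same
annihilator. -/

theorem PosRoot.ext {β γ : PosRoot n} (h₁ : (β.row : ℕ) = γ.row) (h₂ : (β.col : ℕ) = γ.col) :
    β = γ :=
  Subtype.ext (Prod.ext (Fin.ext h₁) (Fin.ext h₂))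

/-- Positive roots are ordered lexicographically, by row and then by column. -/
instance : LinearOrder (PosRoot n) :=
  LinearOrder.lift' (fun β : PosRoot n => toLex (β.row, β.col)) fun β γ h => by
    have h' : (β.row, β.col) = (γ.row, γ.col) := h
    rw [Prod.mk.injEq] at h'
    exact PosRoot.ext (by rw [h'.1]) (by rw [h'.2])

theorem PosRoot.le_iff {β γ : PosRoot n} :
    β ≤ γ ↔ (β.row : ℕ) < γ.row ∨ (β.row : ℕ) = γ.row ∧ (β.col : ℕ) ≤ γ.col := by
  change toLex (β.row, β.col) ≤ toLex (γ.row, γ.col) ↔ _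
  rw [Prod.Lex.toLex_le_toLex]
  simp only [Fin.lt_def, Fin.le_def, Fin.ext_iff]

/-- The componentwise order on positive roots. -/
def PosRoot.Below (β γ : PosRoot n) : Prop :=
  (β.row : ℕ) ≤ γ.row ∧ (β.col : ℕ) ≤ γ.col

theorem PosRoot.Below.le {β γ : PosRoot n} (h : β.Below γ) : β ≤ γ := by
  rw [PosRoot.le_iff]
  have := h.1
  have := h.2
  omega

theorem PosRoot.Below.refl (β : PosRoot n) : β.Below β := ⟨le_rfl, le_rfl⟩

theorem PosRoot.Below.trans {β γ δ : PosRoot n} (h : β.Below γ) (h' : γ.Below δ) : β.Below δ :=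
  ⟨h.1.trans h'.1, h.2.trans h'.2⟩

/-- The componentwise strict order on positive roots. -/
def PosRoot.SBelow (β γ : PosRoot n) : Prop := β.Below γ ∧ β ≠ γ

theorem PosRoot.SBelow.lt {β γ : PosRoot n} (h : β.SBelow γ) : β < γ :=
  lt_of_le_of_ne h.1.le h.2

theorem PosRoot.SBelow.trans {β γ δ : PosRoot n} (h : β.SBelow γ) (h' : γ.SBelow δ) :
    β.SBelow δ :=
  ⟨h.1.trans h'.1, (h.lt.trans h'.lt).ne⟩

theorem PosRoot.bounds (β : PosRoot n) :
    (β.row : ℕ) < n ∧ (β.row : ℕ) ≤ β.col ∧ (β.row : ℕ) + β.col ≤ 2 * n - 2 ∧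
      (β.col : ℕ) < 2 * n - 1 :=
  ⟨β.row.2, β.2.1, β.2.2, β.col.2⟩

/-- The first nonzero place of `t` is at or before `β`, where `s` is still zero. Both strict
comparisons of exponents, the one for straightening and the one for independence, are obtained from
this. -/
theorem lex_lt_of_vanish {s t : PosRoot n → ℕ} (β : PosRoot n) (hs : ∀ γ ≤ β, s γ = 0)
    (ht : t β ≠ 0) : toLex s < toLex t := by
  classical
  obtain ⟨γ, hγ, hmin⟩ := (Finset.univ.filter fun γ => t γ ≠ 0).exists_min_image id
    ⟨β, by simpa using ht⟩
  have hγ' : t γ ≠ 0 := by simpa using hγ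
  have hγβ : γ ≤ β := hmin β (by simpa using ht)
  refine ⟨γ, fun δ hδ => ?_, ?_⟩
  · change s δ = t δ
    rw [hs δ (hδ.le.trans hγβ)]
    by_contra h
    exact absurd (hmin δ (by simpa using Ne.symm h)) (not_le.2 hδ)
  · change s γ < t γ
    rw [hs γ hγβ]
    exact Nat.pos_of_ne_zero hγ'

/-- The two letters of a root: for `α_{r,q}` these are `r` and the mirror image of the successor
of `q`. -/
def PosRoot.letters (β : PosRoot n) (x : ℕ) : ℕ :=
  (if (β.row : ℕ) = x then 1 else 0) + if 2 * n - 2 - (β.col : ℕ) = x then 1 else 0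

/-- The letter content of an exponent. -/
def letterContent (s : PosRoot n → ℕ) (x : ℕ) : ℕ := ∑ β, s β * β.letters x

theorem letterContent_add (s t : PosRoot n → ℕ) (x : ℕ) :
    letterContent (s + t) x = letterContent s x + letterContent t x := by
  simp [letterContent, add_mul, Finset.sum_add_distrib]

theorem letterContent_ne_zero {s : PosRoot n → ℕ} {x : ℕ} :
    letterContent s x ≠ 0 ↔ ∃ β, s β ≠ 0 ∧ ((β.row : ℕ) = x ∨ 2 * n - 2 - (β.col : ℕ) = x) := by
  rw [letterContent, Ne, Finset.sum_eq_zero_iff]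
  push Not
  refine exists_congr fun β => ?_
  rw [mul_ne_zero_iff]
  simp only [Finset.mem_univ, true_and, PosRoot.letters]
  refine and_congr Iff.rfl ?_
  split_ifs <;> simp_all

/-- The least root of a chain carries its two extreme letters, so all letters of the chain lie
between them. An exponent with the same letters cannot use a root that comes earlier. This makes the
chain exponent the leading one among exponents of equal letter content. -/
theorem lex_lt_of_letterContent_eq {s t : PosRoot n → ℕ}
    (hs : ∀ β γ, s β ≠ 0 → s γ ≠ 0 → β.Below γ ∨ γ.Below β)
    (hc : ∀ x, letterContent s x = letterContent t x) (hne : s ≠ t) : toLex t < toLex s := by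
  classical
  -- Cancelling the common part keeps the letter contents equal and makes the supports disjoint.
  set u : PosRoot n → ℕ := fun β => min (s β) (t β) with hu
  set s' : PosRoot n → ℕ := fun β => s β - u β with hs'
  set t' : PosRoot n → ℕ := fun β => t β - u β with ht'
  have hsu : s = s' + u := by
    funext β
    simp only [hs', hu, Pi.add_apply]
    omega
  have htu : t = t' + u := by
    funext β
    simp only [ht', hu, Pi.add_apply]
    omega
  have hc' : ∀ x, letterContent s' x = letterContent t' x := by
    intro x
    have := hc x
    rw [hsu, htu, letterContent_add, letterContent_add] at this
    omega
  have hdisj : ∀ β, s' β = 0 ∨ t' β = 0 := by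
    intro β
    simp only [hs', ht', hu]
    omega
  have hs0 : ∃ β, s' β ≠ 0 := by
    by_contra! h0
    have h1 : ∀ β, t' β = 0 := by
      intro β
      by_contra hβ
      have h2 : letterContent t' β.row ≠ 0 := letterContent_ne_zero.2 ⟨β, hβ, .inl rfl⟩
      rw [← hc', letterContent_ne_zero] at h2
      obtain ⟨γ, hγ, -⟩ := h2
      exact hγ (h0 γ)
    exact hne (by rw [hsu, htu]; funext β; simp [h0, h1])
  obtain ⟨β, hβ, hmin⟩ := (Finset.univ.filter fun γ => s' γ ≠ 0).exists_min_image id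
    (by obtain ⟨β, hβ⟩ := hs0; exact ⟨β, by simpa using hβ⟩)
  have hβ' : s' β ≠ 0 := by simpa using hβ
  have hsub : ∀ γ, s' γ ≠ 0 → s γ ≠ 0 := by
    intro γ hγ
    simp only [hs'] at hγ
    omega
  have hmin' : ∀ γ, s' γ ≠ 0 → β.Below γ := by
    intro γ hγ
    rcases hs β γ (hsub β hβ') (hsub γ hγ) with h | h
    · exact h
    · have := le_antisymm (hmin γ (by simpa using hγ)) h.le
      subst this
      exact h
  have hlex : toLex t' < toLex s' := by
    refine lex_lt_of_vanish β (fun γ hγ => ?_) hβ'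
    by_contra hγ0
    have h1 : letterContent t' γ.row ≠ 0 := letterContent_ne_zero.2 ⟨γ, hγ0, .inl rfl⟩
    have h2 : letterContent t' (2 * n - 2 - γ.col) ≠ 0 :=
      letterContent_ne_zero.2 ⟨γ, hγ0, .inr rfl⟩
    rw [← hc', letterContent_ne_zero] at h1 h2
    obtain ⟨δ, hδ, hδ'⟩ := h1
    obtain ⟨ε, hε, hε'⟩ := h2
    have bβ := β.bounds
    have bγ := γ.bounds
    have bδ := δ.bounds
    have bε := ε.bounds
    have cδ := hmin' δ hδ
    have cε := hmin' ε hε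
    have e1 := cδ.1
    have e2 := cδ.2
    have e3 := cε.1
    have e4 := cε.2
    -- Both letters of `γ` occur in `s'`, whose letters all lie in the interval from `β.row` to `2n
    -- - 2 - β.col`.
    have hbelow : β.Below γ := ⟨by omega, by omega⟩
    have := le_antisymm hγ hbelow.le
    subst this
    rcases hdisj γ with h | h
    · exact hβ' h
    · exact hγ0 h
  rw [hsu, htu]
  change toLex t' + toLex u < toLex s' + toLex u
  exact add_lt_add_left hlex _

/-! ### Chains and Dyck paths -/

/-- The indices `i` with `a ≤ i ≤ b`. -/
def indexInterval (n a b : ℕ) : Finset (Fin n) :=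
  Finset.univ.filter fun i : Fin n => a ≤ (i : ℕ) ∧ (i : ℕ) ≤ b

theorem mem_indexInterval {a b : ℕ} {i : Fin n} :
    i ∈ indexInterval n a b ↔ a ≤ (i : ℕ) ∧ (i : ℕ) ≤ b := by
  simp [indexInterval]

/-- The chain form of the inequalities of the polytope. -/
def ChainBound (m : Fin n → ℕ) (s : PosRoot n → ℕ) : Prop :=
  ∀ l : List (PosRoot n), l.Pairwise PosRoot.SBelow → ∀ a b : ℕ,
    (∀ β ∈ l, a ≤ β.row ∧ (β.col : ℕ) ≤ b) →
      (l.map s).sum ≤ ∑ i ∈ indexInterval n a b, m i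

theorem DyckStep.sBelow {β γ : PosRoot n} (h : DyckStep β γ) : β.SBelow γ := by
  refine ⟨⟨?_, ?_⟩, ?_⟩
  · rcases h with h | h <;> omega
  · rcases h with h | h <;> omega
  · rintro rfl
    rcases h with h | h <;> omega

instance : IsTrans (PosRoot n) PosRoot.SBelow := ⟨fun _ _ _ => PosRoot.SBelow.trans⟩

theorem DyckPath.pairwise (p : DyckPath n) : p.roots.Pairwise PosRoot.SBelow :=
  List.isChain_iff_pairwise.1 (p.chain.imp fun _ _ h => h.sBelow)

/-- The column is raised before the row: in this order the intermediate pairs still satisfy `row ≤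
col`, as well as the bound on `row + col`. -/
theorem reflTransGen_dyckStep {β γ : PosRoot n} (h : β.Below γ) :
    Relation.ReflTransGen DyckStep β γ := by
  obtain ⟨k, hk⟩ : ∃ k, k = ((γ.row : ℕ) - β.row) + (γ.col - β.col) := ⟨_, rfl⟩
  induction k generalizing β with
  | zero =>
    have : β = γ := PosRoot.ext (by have := h.1; omega) (by have := h.2; omega)
    rw [this]
  | succ k ih =>
    have h1 := h.1
    have h2 := h.2
    have b := β.bounds
    have g := γ.bounds
    by_cases hc : (β.col : ℕ) < γ.col
    · let δ : PosRoot n := ⟨(β.row, ⟨β.col + 1, by omega⟩), by simp; omega, by simp; omega⟩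
      have hr : (δ.row : ℕ) = β.row := rfl
      have hcol : (δ.col : ℕ) = β.col + 1 := rfl
      exact Relation.ReflTransGen.head (Or.inl ⟨hr, hcol⟩)
        (ih (β := δ) ⟨by omega, by omega⟩ (by omega))
    · let δ : PosRoot n := ⟨(⟨β.row + 1, by omega⟩, β.col), by simp; omega, by simp; omega⟩
      have hr : (δ.row : ℕ) = β.row + 1 := rfl
      have hcol : (δ.col : ℕ) = β.col := rfl
      exact Relation.ReflTransGen.head (Or.inr ⟨hr, hcol⟩)
        (ih (β := δ) ⟨by omega, by omega⟩ (by omega))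

theorem exists_dyck_list {l : List (PosRoot n)} {β γ : PosRoot n}
    (hl : (β :: l).Pairwise PosRoot.SBelow) (hγ : ∀ δ ∈ β :: l, δ.Below γ) :
    ∃ L : List (PosRoot n), ∃ h : L ≠ [], L.IsChain DyckStep ∧ L.head h = β ∧
      L.getLast h = γ ∧ (β :: l).Sublist L := by
  have key : ∀ {β γ : PosRoot n}, β.Below γ → ∃ L : List (PosRoot n),
      (β :: L).IsChain DyckStep ∧ (β :: L).getLast (by simp) = γ := fun h =>
    List.exists_isChain_cons_of_relationReflTransGen (reflTransGen_dyckStep h)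
  induction l generalizing β with
  | nil =>
    obtain ⟨L, h1, h2⟩ := key (hγ β (by simp))
    exact ⟨β :: L, by simp, h1, rfl, h2, by simp⟩
  | cons c l ih =>
    obtain ⟨L', hL', c2, c1, c3, c4⟩ := ih (List.pairwise_cons.1 hl).2
      (fun δ hδ => hγ δ (List.mem_cons_of_mem _ hδ))
    have hβc : β.SBelow c := (List.pairwise_cons.1 hl).1 c (by simp)
    obtain ⟨L, h1, h2⟩ := key hβc.1
    obtain ⟨c', L'', rfl⟩ := List.exists_cons_of_ne_nil hL'
    obtain rfl : c' = c := c1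
    have hL : L ≠ [] := by
      rintro rfl
      exact hβc.2 h2
    refine ⟨β :: L ++ L'', by simp, ?_, by simp, ?_, ?_⟩
    · rw [List.isChain_append]
      refine ⟨h1, (List.isChain_cons.1 c2).2, ?_⟩
      intro x hx y hy
      rw [List.getLast?_eq_getLast_of_ne_nil (by simp), h2] at hx
      obtain rfl : c' = x := by simpa using hx
      exact (List.isChain_cons.1 c2).1 y hy
    · by_cases hLL : L'' = []
      · subst hLL
        simpa [h2] using c3
      · rw [List.getLast_append_of_ne_nil _ hLL]
        rw [List.getLast_cons hLL] at c3
        exact c3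
    · have hsp : L = L.dropLast ++ [c'] := by
        conv_lhs => rw [← List.dropLast_append_getLast hL]
        rw [List.getLast_cons hL] at h2
        rw [h2]
      rw [hsp]
      have : β :: (L.dropLast ++ [c']) ++ L'' = β :: (L.dropLast ++ (c' :: L'')) := by simp
      rw [this]
      exact List.Sublist.cons_cons _ (c4.trans (List.sublist_append_right _ _))

/-- A root `α_{r,q}` has an end of a Dyck path above it, whose column is `q` if `q` is unbarred. -/
theorem exists_end (β : PosRoot n) :
    ∃ γ : PosRoot n, β.Below γ ∧ (γ.IsSimple ∨ n ≤ (γ.col : ℕ) ∧ γ.IsBar) ∧ γ.col = β.col := by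
  have b := β.bounds
  by_cases h : (β.col : ℕ) < n
  · exact ⟨⟨(⟨β.col, h⟩, β.col), by simp, by simp; omega⟩, ⟨b.2.1, le_rfl⟩, Or.inl rfl, rfl⟩
  · refine ⟨⟨(⟨2 * n - 2 - β.col, by omega⟩, β.col), by simp; omega, by simp; omega⟩,
      ⟨?_, le_rfl⟩, Or.inr ⟨not_lt.1 h, ?_⟩, rfl⟩
    · change (β.row : ℕ) ≤ 2 * n - 2 - β.col
      omega
    · change 2 * n - 2 - (β.col : ℕ) + β.col = 2 * n - 2
      omega

/-- A chain is completed to a Dyck path by prepending the simple root of its first row, filling the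
gaps, and appending an admissible end in its last column; nonnegativity makes the path sum dominate.
For `b ≥ n - 1` the upper limit in `indexInterval` is void, so one family of interval bounds covers
both kinds of inequality. -/
theorem chainBound_of_mem_latticePoints {m : Fin n → ℕ} {s : PosRoot n → ℕ}
    (hs : s ∈ latticePoints m) : ChainBound m s := by
  intro l hl a b hab
  cases l with
  | nil => simp
  | cons β l =>
    have bβ := β.bounds
    obtain ⟨γ, hγm, hγ⟩ : ∃ γ ∈ β :: l, ∀ δ ∈ β :: l, δ.Below γ :=
      ⟨(β :: l).getLast (by simp), List.getLast_mem _, fun δ hδ =>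
        (hl.imp fun h => h.1).rel_getLast_of_rel_getLast_getLast hδ (.refl _)⟩
    obtain ⟨ε, hε, hend, hcol⟩ := exists_end γ
    let β₀ : PosRoot n := ⟨(β.row, ⟨β.row, by omega⟩), by simp, by simp; omega⟩
    have hβ₀r : (β₀.row : ℕ) = β.row := rfl
    have hβ₀c : (β₀.col : ℕ) = β.row := rfl
    have hβ₀ : β₀.Below β := ⟨le_rfl, bβ.2.1⟩
    obtain ⟨L, hL, h1, h2, h3, h4⟩ : ∃ L : List (PosRoot n), ∃ h : L ≠ [], L.IsChain DyckStep ∧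
        L.head h = β₀ ∧ L.getLast h = ε ∧ (β :: l).Sublist L := by
      by_cases hb : β₀ = β
      · rw [hb]
        exact exists_dyck_list hl fun δ hδ => (hγ δ hδ).trans hε
      · obtain ⟨L, hL, h1, h2, h3, h4⟩ := exists_dyck_list (l := β :: l) (β := β₀) (γ := ε)
          (by
            refine List.pairwise_cons.2 ⟨fun δ hδ => ?_, hl⟩
            rcases List.mem_cons.1 hδ with rfl | hδ
            · exact ⟨hβ₀, hb⟩
            · exact PosRoot.SBelow.trans ⟨hβ₀, hb⟩ ((List.pairwise_cons.1 hl).1 δ hδ)) (by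
            intro δ hδ
            rcases List.mem_cons.1 hδ with rfl | hδ
            · exact hβ₀.trans ((hγ β (by simp)).trans hε)
            · exact (hγ δ hδ).trans hε)
        exact ⟨L, hL, h1, h2, h3, (List.sublist_cons_self _ _).trans h4⟩
    let p : DyckPath n := ⟨L, hL, h1, by rw [h2]; rfl, by rw [h3]; exact hend.imp id And.right⟩
    have hsum : (((β :: l).map s).sum : ℕ) ≤ (p.roots.map s).sum :=
      (h4.map s).sum_le_sum fun _ _ => Nat.zero_le _
    refine hsum.trans ?_
    have hcast : ((p.roots.map fun β => (s β : ℝ)).sum : ℝ) = ((p.roots.map s).sum : ℕ) := by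
      rw [Nat.cast_list_sum, List.map_map]
      rfl
    have hf : p.first.row = β.row := by rw [DyckPath.first, h2]; rfl
    have hla : p.last = ε := h3
    have hab1 := hab β (by simp)
    have hab2 := hab γ hγm
    rcases hend with hend | ⟨hn, hend⟩
    · have := (hs.2 p).1 (by rw [hla]; exact hend)
      rw [hcast, hf, hla, ← Nat.cast_sum, Nat.cast_le] at this
      refine this.trans (Finset.sum_le_sum_of_subset fun i hi => ?_)
      have hend' : (ε.col : ℕ) = ε.row := hend
      rw [hcol] at hend'
      simp only [Finset.mem_Icc, Fin.le_def] at hi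
      simp only [mem_indexInterval]
      omega
    · have := (hs.2 p).2 (by rw [hla]; exact hend)
      rw [hcast, hf, ← Nat.cast_sum, Nat.cast_le] at this
      refine this.trans (Finset.sum_le_sum_of_subset fun i hi => ?_)
      rw [hcol] at hn
      simp only [Finset.mem_Ici, Fin.le_def] at hi
      simp only [mem_indexInterval]
      have := i.2
      omega

/-- `A` is a set of pairwise incomparable roots `α_{r,q}` with `r ≤ i ≤ q`. -/
def IsAntichainAt (i : Fin n) (A : Finset (PosRoot n)) : Prop :=
  (∀ β ∈ A, (β.row : ℕ) ≤ i ∧ (i : ℕ) ≤ β.col) ∧ ∀ β ∈ A, ∀ γ ∈ A, β.Below γ → β = γ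

/-- `s` is a sum of indicator functions of antichains `A i k`, `k < m_i`. -/
def IsAntichainSum (m : Fin n → ℕ) (s : PosRoot n → ℕ) (A : Fin n → ℕ → Finset (PosRoot n)) :
    Prop :=
  (∀ i k, IsAntichainAt i (A i k)) ∧
    ∀ β, s β = ∑ i, ∑ k ∈ Finset.range (m i), if β ∈ A i k then 1 else 0

/-- With `exists_isAntichainSum`, this cuts a lattice point for `l + m` into one part for each
summand, which is what part iii) needs. -/
theorem IsAntichainSum.split {l m : Fin n → ℕ} {s : PosRoot n → ℕ}
    {A : Fin n → ℕ → Finset (PosRoot n)} (h : IsAntichainSum (l + m) s A) :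
    ∃ s₁ s₂ A₁ A₂, s = s₁ + s₂ ∧ IsAntichainSum l s₁ A₁ ∧ IsAntichainSum m s₂ A₂ := by
  refine ⟨_, _, A, fun i k => A i (l i + k), ?_, ⟨h.1, fun β => rfl⟩,
    ⟨fun i k => h.1 _ _, fun β => rfl⟩⟩
  funext β
  rw [h.2, Pi.add_apply, ← Finset.sum_add_distrib]
  exact Finset.sum_congr rfl fun i _ => by rw [Pi.add_apply, Finset.sum_range_add]

/-- A greedy argument in the style of Mirsky's theorem. At the first node `i` with `m i ≠ 0`, peel
off the minimal roots of the support that cover `i`. They form an antichain, and every chain whose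
bound involves `m i` either meets it, or can be extended by one of its members, or has slack
already. -/
theorem exists_isAntichainSum {m : Fin n → ℕ} {s : PosRoot n → ℕ} (hs : ChainBound m s) :
    ∃ A, IsAntichainSum m s A := by
  classical
  obtain ⟨N, hN⟩ : ∃ N, N = ∑ i, m i := ⟨_, rfl⟩
  induction N generalizing m s with
  | zero =>
    refine ⟨fun _ _ => ∅, fun i k => ⟨by simp, by simp⟩, fun β => ?_⟩
    have h0 : ∀ i, m i = 0 := fun i =>
      Finset.sum_eq_zero_iff.1 hN.symm i (Finset.mem_univ i)
    have := hs [β] (by simp) 0 β.col (by simp)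
    simpa [h0] using this
  | succ N ih =>
    obtain ⟨i, hi, himin⟩ : ∃ i, m i ≠ 0 ∧ ∀ j, m j ≠ 0 → i ≤ j := by
      obtain ⟨i, hi, himin⟩ := (Finset.univ.filter fun i => m i ≠ 0).exists_min_image id (by
        by_contra h
        rw [Finset.not_nonempty_iff_eq_empty, Finset.filter_eq_empty_iff] at h
        have : ∑ i, m i = 0 := Finset.sum_eq_zero fun i hi => not_not.1 (h hi)
        omega)
      exact ⟨i, by simpa using hi, fun j hj => himin j (by simpa using hj)⟩
    set S : Finset (PosRoot n) :=
      Finset.univ.filter fun β => s β ≠ 0 ∧ (β.row : ℕ) ≤ i ∧ (i : ℕ) ≤ β.col with hS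
    set A₀ : Finset (PosRoot n) := S.filter fun β => ∀ γ ∈ S, γ.Below β → γ = β with hA₀
    have hA₀S : ∀ β ∈ A₀, β ∈ S := fun β hβ => (Finset.mem_filter.1 hβ).1
    have hSm : ∀ β ∈ S, s β ≠ 0 ∧ (β.row : ℕ) ≤ i ∧ (i : ℕ) ≤ β.col := fun β hβ =>
      (Finset.mem_filter.1 hβ).2
    have hanti : IsAntichainAt i A₀ :=
      ⟨fun β hβ => (hSm β (hA₀S β hβ)).2, fun β hβ γ hγ h =>
        (Finset.mem_filter.1 hγ).2 β (hA₀S β hβ) h⟩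
    have hex : ∀ β ∈ S, ∃ α ∈ A₀, α.Below β := by
      intro β hβ
      obtain ⟨α, hα, hαmin⟩ := (S.filter fun α => α.Below β).exists_min_image id
        ⟨β, Finset.mem_filter.2 ⟨hβ, .refl _⟩⟩
      rw [Finset.mem_filter] at hα
      refine ⟨α, Finset.mem_filter.2 ⟨hα.1, fun γ hγ hγα => ?_⟩, hα.2⟩
      exact le_antisymm hγα.le (hαmin γ (Finset.mem_filter.2 ⟨hγ, hγα.trans hα.2⟩))
    set m' : Fin n → ℕ := Function.update m i (m i - 1) with hm'
    set s' : PosRoot n → ℕ := fun β => s β - if β ∈ A₀ then 1 else 0 with hs'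
    have hmm' : ∀ T : Finset (Fin n), i ∈ T → ∑ j ∈ T, m' j + 1 = ∑ j ∈ T, m j := by
      intro T hT
      rw [← Finset.add_sum_erase T m' hT, ← Finset.add_sum_erase T m hT, hm',
        Function.update_self,
        Finset.sum_congr rfl fun j hj => Function.update_of_ne (Finset.ne_of_mem_erase hj) _ m]
      change m i - 1 + ∑ x ∈ T.erase i, m x + 1 = m i + ∑ x ∈ T.erase i, m x
      omega
    have hmm'' : ∀ T : Finset (Fin n), i ∉ T → ∑ j ∈ T, m' j = ∑ j ∈ T, m j := by
      intro T hT
      refine Finset.sum_congr rfl fun j hj => Function.update_of_ne ?_ _ _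
      rintro rfl
      exact hT hj
    have hle : ∀ l : List (PosRoot n), (l.map s').sum ≤ (l.map s).sum := fun l =>
      List.sum_le_sum fun β _ => Nat.sub_le _ _
    have hbound : ChainBound m' s' := by
      intro l hl a b hab
      -- Only bounds over intervals containing `i` become stricter, each by one.
      by_cases hiab : a ≤ (i : ℕ) ∧ (i : ℕ) ≤ b
      swap
      · rw [hmm'' _ (fun h => hiab (mem_indexInterval.1 h))]
        exact (hle l).trans (hs l hl a b hab)
      have hiT : i ∈ indexInterval n a b := mem_indexInterval.2 hiab
      refine Nat.le_of_add_le_add_right (b := 1) ?_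
      rw [hmm' _ hiT]
      -- Roots with `s β = 0` are dropped, so that the head of the chain lies in the support.
      have hfil : ∀ l : List (PosRoot n),
          (l.map s').sum = ((l.filter fun β => s β ≠ 0).map s').sum := by
        intro l
        induction l with
        | nil => rfl
        | cons β l ih =>
          by_cases hβ : s β = 0
          · have : s' β = 0 := by simp [hs', hβ]
            rw [List.map_cons, List.sum_cons, this, ih, List.filter_cons_of_neg (by simpa using hβ),
              zero_add]
          · rw [List.map_cons, List.sum_cons, ih, List.filter_cons_of_pos (by simpa using hβ),
              List.map_cons, List.sum_cons]
      rw [hfil]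
      have hl' := hl.sublist (List.filter_sublist (p := fun β => decide (s β ≠ 0)))
      have hab' : ∀ β ∈ l.filter (fun β => s β ≠ 0),
          (a ≤ β.row ∧ (β.col : ℕ) ≤ b) ∧ s β ≠ 0 := fun β hβ =>
        ⟨hab β (List.mem_filter.1 hβ).1, by simpa using (List.mem_filter.1 hβ).2⟩
      generalize l.filter (fun β => s β ≠ 0) = l' at hl' hab'
      cases l' with
      | nil =>
        have := Finset.single_le_sum (f := m) (fun _ _ => Nat.zero_le _) hiT
        simp only [List.map_nil, List.sum_nil]
        omega
      | cons c l' =>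
        have hcb := hab' c (by simp)
        have hrow : ∀ β ∈ c :: l', c.Below β := by
          intro β hβ
          rcases List.mem_cons.1 hβ with rfl | hβ
          · exact .refl _
          · exact ((List.pairwise_cons.1 hl').1 β hβ).1
        by_cases hci : (i : ℕ) < c.row
        -- The chain starts to the right of `i`: shortening the interval to `[c.row, b]` saves `m i
        -- ≥ 1`.
        · have h1 := hs _ hl' c.row b fun β hβ => ⟨(hrow β hβ).1, (hab' β hβ).1.2⟩
          have h2 : ∑ j ∈ indexInterval n c.row b, m j + m i ≤
              ∑ j ∈ indexInterval n a b, m j := by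
            rw [← Finset.sum_erase_add _ _ hiT]
            refine Nat.add_le_add_right (Finset.sum_le_sum_of_subset fun j hj => ?_) _
            simp only [mem_indexInterval, Finset.mem_erase, ne_eq,
              Fin.ext_iff] at hj ⊢
            omega
          have h3 := hle (c :: l')
          omega
        -- If `c` ended before `i`, all weights on its interval would vanish by minimality of `i`,
        -- forcing `s c = 0`.
        · have hic : (i : ℕ) ≤ c.col := by
            by_contra hic
            have h1 := hs [c] (by simp) c.row c.col (by simp)
            rw [Finset.sum_eq_zero] at h1
            · exact hcb.2 (by simpa using h1)
            · intro j hj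
              simp only [mem_indexInterval] at hj
              by_contra hj0
              have := himin j hj0
              rw [Fin.le_def] at this
              omega
          have hcS : c ∈ S := by
            rw [hS, Finset.mem_filter]
            exact ⟨Finset.mem_univ _, hcb.2, not_lt.1 hci, hic⟩
          by_cases hcA : c ∈ A₀
          · have h1 := hs _ hl' a b fun β hβ => (hab' β hβ).1
            have h2 := hle l'
            have h3 : s' c + 1 = s c := by
              have := hcb.2
              simp only [hs', if_pos hcA]
              omega
            simp only [List.map_cons, List.sum_cons] at h1 ⊢
            omega
          -- A peeled root `α` strictly below `c` can be prepended to the chain; its contribution `s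
          -- α ≥ 1` is the required slack.
          · obtain ⟨α, hα, hαc⟩ := hex c hcS
            have hαc' : α.SBelow c := ⟨hαc, fun h => hcA (h ▸ hα)⟩
            have hαS := hSm α (hA₀S α hα)
            have h1 := hs (α :: c :: l')
              (List.pairwise_cons.2 ⟨fun β hβ => by
                rcases List.mem_cons.1 hβ with rfl | hβ
                · exact hαc'
                · exact hαc'.trans ((List.pairwise_cons.1 hl').1 β hβ), hl'⟩) α.row b (by
                intro β hβ
                rcases List.mem_cons.1 hβ with rfl | hβ
                · exact ⟨le_rfl, hαc.2.trans hcb.1.2⟩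
                · exact ⟨hαc.1.trans (hrow β hβ).1, (hab' β hβ).1.2⟩)
            -- Possibly `α.row < a`, but the additional indices precede `i` and have weight zero.
            have h2 : ∑ j ∈ indexInterval n α.row b, m j ≤
                ∑ j ∈ indexInterval n a b, m j := by
              refine Finset.sum_le_sum_of_ne_zero fun j hj hj0 => ?_
              have := himin j hj0
              rw [Fin.le_def] at this
              simp only [mem_indexInterval] at hj ⊢
              omega
            have h3 := hle (c :: l')
            simp only [List.map_cons, List.sum_cons] at h1 h3 ⊢
            omega
    obtain ⟨A, hA1, hA2⟩ := ih hbound (by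
      have := hmm' Finset.univ (Finset.mem_univ i)
      omega)
    -- The new antichain takes the slot `m i - 1`, the only one at node `i` beyond those counted by
    -- `m'`.
    refine ⟨fun j k => if j = i ∧ k = m i - 1 then A₀ else A j k, fun j k => ?_, fun β => ?_⟩
    · beta_reduce
      split_ifs with h
      · rw [h.1]
        exact hanti
      · exact hA1 j k
    · have hsβ : s β = s' β + if β ∈ A₀ then 1 else 0 := by
        by_cases hβ : β ∈ A₀
        · have := (hSm β (hA₀S β hβ)).1
          simp only [hs', if_pos hβ]
          omega
        · simp [hs', hβ]
      rw [hsβ, hA2, ← Finset.add_sum_erase Finset.univ _ (Finset.mem_univ i),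
        ← Finset.add_sum_erase (a := i) Finset.univ (fun j => ∑ k ∈ Finset.range (m j), _)
          (Finset.mem_univ i)]
      have e1 : m' i = m i - 1 := Function.update_self _ _ _
      obtain ⟨q, hq⟩ := Nat.exists_eq_succ_of_ne_zero hi
      have e2 : m i - 1 = q := by omega
      rw [e1, e2, hq, Finset.sum_range_succ]
      have e3 : ∑ k ∈ Finset.range q, (if β ∈ (if i = i ∧ k = q then A₀ else A i k) then 1 else 0)
          = ∑ k ∈ Finset.range q, if β ∈ A i k then 1 else 0 := by
        refine Finset.sum_congr rfl fun k hk => ?_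
        rw [if_neg (c := i = i ∧ k = q)]
        have := Finset.mem_range.1 hk
        omega
      have e4 : ∑ j ∈ Finset.univ.erase i, ∑ k ∈ Finset.range (m j),
            (if β ∈ (if j = i ∧ k = q then A₀ else A j k) then 1 else 0)
          = ∑ j ∈ Finset.univ.erase i, ∑ k ∈ Finset.range (m' j), if β ∈ A j k then 1 else 0 := by
        refine Finset.sum_congr rfl fun j hj => ?_
        have hji := Finset.ne_of_mem_erase hj
        rw [hm', Function.update_of_ne hji]
        refine Finset.sum_congr rfl fun k hk => ?_
        rw [if_neg (c := j = i ∧ k = q) fun h => hji h.1]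
      rw [e3, e4]
      simp only [and_self, if_true]
      omega

end Combinatorics

/-! ### Root vectors as matrix entries, and the monomials in them. -/

section RootVectors

attribute [local instance 100] LieRing.ofAssociativeRing

variable {n : ℕ}

/-! ### Positions of matrix entries -/

theorem pos_lt (p : Fin n ⊕ Fin n) : pos p < 2 * n := by
  rcases p with i | i <;> have := i.2 <;> simp only [pos] <;> omega

theorem pos_swap (p : Fin n ⊕ Fin n) : pos p.swap = 2 * n - 1 - pos p := by
  rcases p with i | i <;> have := i.2 <;> simp only [pos, Sum.swap_inl, Sum.swap_inr]
  omega

theorem pos_injective : Function.Injective (pos : Fin n ⊕ Fin n → ℕ) := by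
  rintro (i | i) (j | j) h <;> have hi := i.2 <;> have hj := j.2 <;> simp only [pos] at h
  · exact congrArg Sum.inl (Fin.ext h)
  · omega
  · omega
  · exact congrArg Sum.inr (Fin.ext (by omega))

/-- The sign of a basis vector. -/
def sgn (p : Fin n ⊕ Fin n) : ℂ := Sum.elim (fun _ => 1) (fun _ => -1) p

theorem sgn_swap (p : Fin n ⊕ Fin n) : sgn p.swap = -sgn p := by
  rcases p with i | i <;> simp [sgn]

theorem sgn_mul_self (p : Fin n ⊕ Fin n) : sgn p * sgn p = 1 := by
  rcases p with i | i <;> simp [sgn]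

theorem sgn_ne_zero (p : Fin n ⊕ Fin n) : sgn p ≠ 0 := by
  rcases p with i | i <;> simp [sgn]

theorem mem_sp_iff_sgn (A : Matrix (Fin n ⊕ Fin n) (Fin n ⊕ Fin n) ℂ) :
    A ∈ sp n ↔ ∀ p q, A p q = -(sgn p * sgn q) * A q.swap p.swap := by
  rw [mem_sp_iff]
  constructor
  · rintro ⟨h1, h2, h3⟩ (i | i) (j | j)
    · simp [sgn, h1 j i]
    · simp [sgn, h2 i j]
    · simp [sgn, h3 i j]
    · simp [sgn, h1 i j]
  · intro h
    refine ⟨fun i j => ?_, fun i j => ?_, fun i j => ?_⟩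
    · simpa [sgn] using h (.inr i) (.inr j)
    · simpa [sgn] using h (.inl i) (.inr j)
    · simpa [sgn] using h (.inr i) (.inl j)

theorem sp_entry (A : sp n) (p q : Fin n ⊕ Fin n) :
    A.1 p q = -(sgn p * sgn q) * A.1 q.swap p.swap :=
  (mem_sp_iff_sgn A.1).1 A.2 p q

theorem sp_entry_ne_zero_iff (A : sp n) (p q : Fin n ⊕ Fin n) :
    A.1 p q ≠ 0 ↔ A.1 q.swap p.swap ≠ 0 := by
  rw [sp_entry A p q]
  simp [sgn_ne_zero]

/-- The diagonal matrix with entries `d, -d`. -/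
def cartanOf (d : Fin n → ℂ) : cartan n :=
  ⟨⟨Matrix.diagonal (Sum.elim d (-d)), by
    rw [mem_sp_iff]
    refine ⟨fun i j => ?_, fun i j => ?_, fun i j => ?_⟩
    · by_cases h : i = j
      · subst h
        simp
      · rw [Matrix.diagonal_apply_ne _ (by simpa using h),
          Matrix.diagonal_apply_ne _ (by simpa using Ne.symm h), neg_zero]
    · simp
    · simp⟩, fun p q h => Matrix.diagonal_apply_ne _ h⟩

theorem cartanOf_inl (d : Fin n → ℂ) (i : Fin n) : (cartanOf d).1.1 (.inl i) (.inl i) = d i := by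
  simp [cartanOf]

theorem cartanOf_inr (d : Fin n → ℂ) (i : Fin n) : (cartanOf d).1.1 (.inr i) (.inr i) = -d i := by
  simp [cartanOf]

theorem cartan_inr (H : cartan n) (i : Fin n) :
    H.1.1 (.inr i) (.inr i) = -H.1.1 (.inl i) (.inl i) :=
  ((mem_sp_iff H.1.1).1 H.1.2).1 i i

/-- The column of the matrix entry of a root. -/
def PosRoot.src (β : PosRoot n) : Fin n ⊕ Fin n := .inl β.row

/-- The row of the matrix entry of a root. -/
def PosRoot.tgt (β : PosRoot n) : Fin n ⊕ Fin n :=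
  if h : (β.col : ℕ) + 1 < n then .inl ⟨β.col + 1, h⟩
  else .inr ⟨2 * n - 2 - β.col, by have := β.bounds; omega⟩

theorem PosRoot.pos_src (β : PosRoot n) : pos β.src = β.row := rfl

theorem PosRoot.pos_tgt (β : PosRoot n) : pos β.tgt = β.col + 1 := by
  have := β.bounds
  by_cases h : (β.col : ℕ) + 1 < n
  · simp [PosRoot.tgt, h, pos]
  · simp only [PosRoot.tgt, h, pos, dif_neg, not_false_iff]
    omega

theorem PosRoot.pos_src_lt (β : PosRoot n) : pos β.src < pos β.tgt := by
  have := β.bounds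
  rw [β.pos_src, β.pos_tgt]
  omega

/-- The diagonal entries of `H`, by position. -/
def diagAt (H : cartan n) (t : ℕ) : ℂ :=
  if h : t < n then H.1.1 (.inl ⟨t, h⟩) (.inl ⟨t, h⟩)
  else if h' : 2 * n - 1 - t < n then -H.1.1 (.inl ⟨2 * n - 1 - t, h'⟩) (.inl ⟨2 * n - 1 - t, h'⟩)
  else 0

theorem diagAt_pos (H : cartan n) (p : Fin n ⊕ Fin n) : diagAt H (pos p) = H.1.1 p p := by
  rcases p with i | i
  · have := i.2
    simp [diagAt, pos]
  · have hi := i.2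
    have h1 : ¬ 2 * n - 1 - (i : ℕ) < n := by omega
    have h2 : 2 * n - 1 - (2 * n - 1 - (i : ℕ)) = i := by omega
    simp only [diagAt, pos, h1, dif_neg, not_false_iff, h2, hi, dif_pos, Fin.eta, cartan_inr]

/-- In terms of positions every simple root is a difference of neighbouring diagonal entries, so
roots telescope. The doubled root `2ε` fits because the entries at positions `n - 1` and `n` are
opposite. -/
theorem simpleRoot_letter (H : cartan n) (t : Fin (2 * n - 1)) :
    simpleRoot (letter t) H = diagAt H t - diagAt H (t + 1) := by
  have ht := t.2
  rcases lt_trichotomy ((t : ℕ) + 1) n with h | h | h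
  · have e : letter t = ⟨t, by omega⟩ := Fin.ext (by simp [letter]; omega)
    rw [e]
    simp [simpleRoot, diagAt, h, (by omega : (t : ℕ) < n)]
  · have e : letter t = ⟨t, by omega⟩ := Fin.ext (by simp [letter]; omega)
    rw [e]
    have h2 : 2 * n - 1 - ((t : ℕ) + 1) = t := by omega
    have h3 : ¬ (t : ℕ) + 1 < n := by omega
    simp only [simpleRoot, diagAt, h2, h3, (by omega : (t : ℕ) < n), dif_pos, dif_neg,
      not_false_iff]
    ring
  · have e : letter t = ⟨2 * n - 2 - t, by omega⟩ := Fin.ext (by simp [letter]; omega)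
    rw [e]
    have h1 : ¬ (t : ℕ) < n := by omega
    have h3 : ¬ (t : ℕ) + 1 < n := by omega
    have h4 : 2 * n - 1 - (t : ℕ) < n := by omega
    have h5 : 2 * n - 1 - ((t : ℕ) + 1) < n := by omega
    have h7 : 2 * n - 1 - ((t : ℕ) + 1) = 2 * n - 2 - t := by omega
    have h8 : 2 * n - 2 - (t : ℕ) + 1 = 2 * n - 1 - t := by omega
    simp only [simpleRoot, diagAt, h1, h3, h4, dif_pos, dif_neg, not_false_iff, h7, h8,
      (by omega : 2 * n - 2 - (t : ℕ) < n)]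
    ring

theorem toFunctional_eq (β : PosRoot n) (H : cartan n) :
    β.toFunctional H = H.1.1 β.src β.src - H.1.1 β.tgt β.tgt := by
  have hb := β.bounds
  rw [← diagAt_pos, ← diagAt_pos, β.pos_src, β.pos_tgt, PosRoot.toFunctional]
  simp_rw [simpleRoot_letter]
  rw [Fin.sum_univ_eq_sum_range (fun t => if (β.row : ℕ) ≤ t ∧ t ≤ β.col then
    diagAt H t - diagAt H (t + 1) else 0), ← Finset.sum_filter]
  have : (Finset.range (2 * n - 1)).filter (fun t => (β.row : ℕ) ≤ t ∧ t ≤ β.col) =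
      Finset.Ico (β.row : ℕ) (β.col + 1) := by
    ext t
    simp only [Finset.mem_filter, Finset.mem_range, Finset.mem_Ico]
    omega
  rw [this, Finset.sum_Ico_eq_sum_range]
  simp_rw [add_assoc]
  rw [Finset.sum_range_sub' fun k => diagAt H (β.row + k)]
  congr 2
  omega

theorem PosRoot.eq_of_toFunctional_eq {β γ : PosRoot n}
    (h : ∀ H, β.toFunctional H = γ.toFunctional H) : β = γ := by
  have hv : ∀ (δ : PosRoot n) (k : Fin n), δ.toFunctional (cartanOf (Pi.single k 1)) =
      (((if (δ.row : ℕ) = k then 1 else 0) + (if (δ.col : ℕ) + 1 < n then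
        (if (δ.col : ℕ) + 1 = k then -1 else 0) else if 2 * n - 2 - (δ.col : ℕ) = k then 1 else 0)
        : ℤ) : ℂ) := by
    intro δ k
    rw [toFunctional_eq, PosRoot.src, PosRoot.tgt, cartanOf_inl]
    by_cases h1 : (δ.col : ℕ) + 1 < n
    · simp only [h1, dif_pos, if_true, cartanOf_inl]
      simp only [Pi.single_apply, Fin.ext_iff]
      push_cast
      rw [sub_eq_add_neg]
      congr 1
      split_ifs <;> simp
    · simp only [h1, dif_neg, not_false_iff, if_false, cartanOf_inr]
      simp only [Pi.single_apply, Fin.ext_iff]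
      push_cast
      rw [sub_neg_eq_add]
  have hk : ∀ k : ℕ, k < n →
      ((if (β.row : ℕ) = k then 1 else 0) + (if (β.col : ℕ) + 1 < n then
        (if (β.col : ℕ) + 1 = k then -1 else 0) else if 2 * n - 2 - (β.col : ℕ) = k then 1 else 0)
        : ℤ) =
      ((if (γ.row : ℕ) = k then 1 else 0) + (if (γ.col : ℕ) + 1 < n then
        (if (γ.col : ℕ) + 1 = k then -1 else 0) else if 2 * n - 2 - (γ.col : ℕ) = k then 1 else 0)
        : ℤ) := by
    intro k hk
    have := h (cartanOf (Pi.single ⟨k, hk⟩ 1))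
    rw [hv, hv] at this
    exact_mod_cast this
  have b := β.bounds
  have g := γ.bounds
  have h1 := hk β.row b.1
  have h2 := hk γ.row g.1
  have hrow : (β.row : ℕ) = γ.row := by
    rcases lt_trichotomy (β.row : ℕ) γ.row with hlt | heq | hlt
    · split_ifs at h1 <;> omega
    · exact heq
    · split_ifs at h2 <;> omega
  refine PosRoot.ext hrow ?_
  have h3 := fun hlt => hk (β.col + 1) hlt
  have h4 := fun hlt => hk (2 * n - 2 - β.col) hlt
  have h5 := fun hlt => hk (γ.col + 1) hlt
  have h6 := fun hlt => hk (2 * n - 2 - γ.col) hlt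
  by_cases c1 : (β.col : ℕ) + 1 < n <;> by_cases c2 : (γ.col : ℕ) + 1 < n
  · have := h3 c1
    simp only [c1, c2, if_true] at this
    split_ifs at this <;> omega
  · have := h3 c1
    simp only [c1, c2, if_true, if_false] at this
    split_ifs at this <;> omega
  · have := h5 c2
    simp only [c1, c2, if_true, if_false] at this
    split_ifs at this <;> omega
  · have := h4 (by omega)
    simp only [c1, c2, if_false] at this
    split_ifs at this <;> omega

/-- The root of the matrix entry `(p, q)`. -/
def rootOf (p q : Fin n ⊕ Fin n) (h : pos q < pos p) : PosRoot n :=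
  if h' : pos p + pos q ≤ 2 * n - 1 then
    ⟨(⟨pos q, by omega⟩, ⟨pos p - 1, by have := pos_lt p; omega⟩), by simp; omega, by simp; omega⟩
  else
    ⟨(⟨2 * n - 1 - pos p, by have := pos_lt p; omega⟩,
      ⟨2 * n - 2 - pos q, by have := pos_lt p; omega⟩),
      by have := pos_lt p; simp; omega, by have := pos_lt p; simp; omega⟩

theorem rootOf_cases (p q : Fin n ⊕ Fin n) (h : pos q < pos p) :
    ((rootOf p q h).tgt = p ∧ (rootOf p q h).src = q) ∨
      ((rootOf p q h).tgt = q.swap ∧ (rootOf p q h).src = p.swap) := by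
  have hp := pos_lt p
  by_cases h' : pos p + pos q ≤ 2 * n - 1
  · have e : (rootOf p q h).1 = (⟨pos q, by omega⟩, ⟨pos p - 1, by omega⟩) :=
      congrArg Subtype.val (dif_pos h')
    refine .inl ⟨pos_injective ?_, pos_injective ?_⟩
    · rw [PosRoot.pos_tgt, PosRoot.col, e]
      change pos p - 1 + 1 = pos p
      omega
    · rw [PosRoot.pos_src, PosRoot.row, e]
  · have e : (rootOf p q h).1 =
        (⟨2 * n - 1 - pos p, by omega⟩, ⟨2 * n - 2 - pos q, by omega⟩) :=
      congrArg Subtype.val (dif_neg h')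
    refine .inr ⟨pos_injective ?_, pos_injective ?_⟩
    · rw [PosRoot.pos_tgt, pos_swap, PosRoot.col, e]
      change 2 * n - 2 - pos q + 1 = 2 * n - 1 - pos q
      omega
    · rw [PosRoot.pos_src, pos_swap, PosRoot.row, e]

theorem cartan_swap (H : cartan n) (p : Fin n ⊕ Fin n) : H.1.1 p.swap p.swap = -H.1.1 p p := by
  rcases p with i | i <;> simp [cartan_inr]

theorem toFunctional_rootOf (p q : Fin n ⊕ Fin n) (h : pos q < pos p) (H : cartan n) :
    (rootOf p q h).toFunctional H = H.1.1 q q - H.1.1 p p := by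
  rw [toFunctional_eq]
  rcases rootOf_cases p q h with ⟨h1, h2⟩ | ⟨h1, h2⟩
  · rw [h1, h2]
  · rw [h1, h2, cartan_swap, cartan_swap]
    ring

theorem cartan_lie_apply (H : cartan n) (A : sp n) (p q : Fin n ⊕ Fin n) :
    ⁅(H : sp n), A⁆.1 p q = (H.1.1 p p - H.1.1 q q) * A.1 p q := by
  change (H.1.1 * A.1 - A.1 * H.1.1) p q = _
  rw [Matrix.sub_apply, Matrix.mul_apply, Matrix.mul_apply,
    Finset.sum_eq_single p (fun r _ hr => by rw [H.2 p r hr.symm, zero_mul]) (by simp),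
    Finset.sum_eq_single q (fun r _ hr => by rw [H.2 r q hr, mul_zero]) (by simp)]
  ring

theorem eq_zero_of_root_entries {A : nMinus n} (h : ∀ β : PosRoot n, A.1.1 β.tgt β.src = 0) :
    A = 0 := by
  ext p q
  change A.1.1 p q = 0
  by_cases hpq : pos q < pos p
  · rcases rootOf_cases p q hpq with ⟨h1, h2⟩ | ⟨h1, h2⟩
    · have := h (rootOf p q hpq)
      rwa [h1, h2] at this
    · have := h (rootOf p q hpq)
      rw [h1, h2] at this
      rw [sp_entry, this, mul_zero]
  · exact A.2 p q (not_lt.1 hpq)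

variable {f : PosRoot n → nMinus n}

/-- Under `ad H` the entry `(p, q)` is scaled by `H p p - H q q`, and distinct positive roots are
distinct functionals. Hence a root vector lives on a single entry and its mirror image. -/
theorem IsRootVectors.eq_rootOf (hf : IsRootVectors f) {β : PosRoot n} {p q : Fin n ⊕ Fin n}
    (h : pos q < pos p) (h0 : (f β).1.1 p q ≠ 0) : β = rootOf p q h := by
  refine PosRoot.eq_of_toFunctional_eq fun H => ?_
  have h1 := cartan_lie_apply H (f β).1 p q
  rw [(hf β).2 H] at h1
  change -β.toFunctional H * (f β).1.1 p q = _ at h1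
  rw [toFunctional_rootOf]
  have := mul_right_cancel₀ h0 h1
  linear_combination -this

theorem IsRootVectors.entry_eq_zero (hf : IsRootVectors f) {β γ : PosRoot n} (h : β ≠ γ) :
    (f β).1.1 γ.tgt γ.src = 0 := by
  by_contra h0
  refine h ((hf.eq_rootOf γ.pos_src_lt h0).trans ?_)
  refine PosRoot.eq_of_toFunctional_eq fun H => ?_
  rw [toFunctional_rootOf, toFunctional_eq]

theorem IsRootVectors.entry_ne_zero (hf : IsRootVectors f) (β : PosRoot n) :
    (f β).1.1 β.tgt β.src ≠ 0 := by
  intro h0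
  refine (hf β).1 (eq_zero_of_root_entries fun γ => ?_)
  by_cases h : β = γ
  · rw [← h, h0]
  · exact hf.entry_eq_zero h

theorem IsRootVectors.entry_ne_zero_iff (hf : IsRootVectors f) {β : PosRoot n}
    {p q : Fin n ⊕ Fin n} (h : pos q < pos p) : (f β).1.1 p q ≠ 0 ↔ β = rootOf p q h := by
  refine ⟨hf.eq_rootOf h, fun hβ => ?_⟩
  have h0 := hf.entry_ne_zero β
  rcases rootOf_cases p q h with ⟨h1, h2⟩ | ⟨h1, h2⟩ <;> rw [← hβ] at h1 h2 <;> rw [h1, h2] at h0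
  · exact h0
  · rwa [sp_entry_ne_zero_iff]

theorem nMinus_eq_sum (hf : IsRootVectors f) (A : nMinus n) :
    A = ∑ β, (A.1.1 β.tgt β.src / (f β).1.1 β.tgt β.src) • f β := by
  classical
  rw [← sub_eq_zero]
  refine eq_zero_of_root_entries fun γ => ?_
  let φ : nMinus n →ₗ[ℂ] ℂ :=
    { toFun := fun B => B.1.1 γ.tgt γ.src, map_add' := fun _ _ => rfl, map_smul' := fun _ _ => rfl }
  change φ (A - ∑ β, (A.1.1 β.tgt β.src / (f β).1.1 β.tgt β.src) • f β) = 0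
  rw [map_sub, map_sum, Finset.sum_eq_single γ]
  · rw [map_smul, smul_eq_mul]
    change A.1.1 γ.tgt γ.src - _ / (f γ).1.1 γ.tgt γ.src * (f γ).1.1 γ.tgt γ.src = 0
    rw [div_mul_cancel₀ _ (hf.entry_ne_zero γ), sub_self]
  · intro β _ hβ
    rw [map_smul]
    change _ • (f β).1.1 γ.tgt γ.src = 0
    rw [hf.entry_eq_zero hβ, smul_zero]
  · simp

/-- The root vectors form a basis of `n⁻`. -/
def rootBasis (hf : IsRootVectors f) : Module.Basis (PosRoot n) ℂ (nMinus n) :=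
  Module.Basis.mk (v := f) (by
    classical
    rw [Fintype.linearIndependent_iff]
    intro g hg γ
    let φ : nMinus n →ₗ[ℂ] ℂ :=
      { toFun := fun B => B.1.1 γ.tgt γ.src, map_add' := fun _ _ => rfl,
        map_smul' := fun _ _ => rfl }
    have h := congrArg φ hg
    rw [map_sum, map_zero, Finset.sum_eq_single γ] at h
    · rw [map_smul, smul_eq_mul] at h
      exact (mul_eq_zero.1 h).resolve_right (hf.entry_ne_zero γ)
    · intro β _ hβ
      rw [map_smul]
      change _ • (f β).1.1 γ.tgt γ.src = 0
      rw [hf.entry_eq_zero hβ, smul_zero]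
    · simp) (by
    rintro A -
    rw [nMinus_eq_sum hf A]
    exact Submodule.sum_mem _ fun β _ => Submodule.smul_mem _ _ (Submodule.subset_span ⟨β, rfl⟩))

theorem rootBasis_apply (hf : IsRootVectors f) (β : PosRoot n) : rootBasis hf β = f β := by
  simp [rootBasis]

theorem span_range_rootVectors (hf : IsRootVectors f) : Submodule.span ℂ (Set.range f) = ⊤ := by
  rw [← (rootBasis hf).span_eq]
  congr 2
  funext β
  rw [rootBasis_apply]

/-- The monomials `f^s` span `S(n⁻)`. -/
theorem span_monomial (hf : IsRootVectors f) :
    Submodule.span ℂ (Set.range (monomial f)) = ⊤ := by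
  have hmul : ∀ s t, monomial f s * monomial f t = monomial f (s + t) := by
    intro s t
    simp [monomial, pow_add, Finset.prod_mul_distrib]
  rw [eq_top_iff]
  rintro p -
  induction p using SymmetricAlgebra.induction with
  | algebraMap r =>
    rw [Algebra.algebraMap_eq_smul_one]
    exact Submodule.smul_mem _ _ (Submodule.subset_span ⟨0, by simp [monomial]⟩)
  | ι x =>
    have hx : x ∈ Submodule.span ℂ (Set.range f) := by
      rw [span_range_rootVectors hf]
      trivial
    induction hx using Submodule.span_induction with
    | mem x hx =>
      obtain ⟨β, rfl⟩ := hx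
      classical
      refine Submodule.subset_span ⟨Pi.single β 1, ?_⟩
      rw [monomial, Finset.prod_eq_single β]
      · simp
      · intro γ _ hγ
        simp [hγ]
      · simp
    | zero => simp
    | add x y _ _ hx hy =>
      rw [map_add]
      exact add_mem hx hy
    | smul c x _ hx =>
      rw [map_smul]
      exact Submodule.smul_mem _ _ hx
  | mul a b ha hb =>
    induction ha using Submodule.span_induction with
    | zero => simp
    | add x y _ _ hx hy =>
      rw [add_mul]
      exact add_mem hx hy
    | smul c x _ hx =>
      rw [smul_mul_assoc]
      exact Submodule.smul_mem _ _ hx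
    | mem x hx =>
      obtain ⟨s, rfl⟩ := hx
      induction hb using Submodule.span_induction with
      | zero => simp
      | add x y _ _ hx hy =>
        rw [mul_add]
        exact add_mem hx hy
      | smul c x _ hx =>
        rw [mul_smul_comm]
        exact Submodule.smul_mem _ _ hx
      | mem x hx =>
        obtain ⟨t, rfl⟩ := hx
        exact Submodule.subset_span ⟨s + t, (hmul s t).symm⟩
  | add a b ha hb => exact add_mem ha hb

theorem monomial_add (s t : PosRoot n → ℕ) :
    monomial f (s + t) = monomial f s * monomial f t := by
  simp [monomial, pow_add, Finset.prod_mul_distrib]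

/-- The exponent of a word in the positive roots. -/
def content (l : List (PosRoot n)) : PosRoot n → ℕ := fun β => l.count β

theorem content_cons (β : PosRoot n) (l : List (PosRoot n)) :
    content (β :: l) = Pi.single β 1 + content l := by
  funext γ
  rw [content, List.count_cons, Pi.add_apply, content, add_comm, Pi.single_apply]
  congr 1
  by_cases h : β = γ
  · simp [h]
  · simp [h, Ne.symm h]

theorem monomial_single (β : PosRoot n) :
    monomial f (Pi.single β 1) = SymmetricAlgebra.ι ℂ (nMinus n) (f β) := by
  rw [monomial, Finset.prod_eq_single β]
  · simp
  · intro γ _ hγ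
    simp [hγ]
  · simp

theorem monomial_content (l : List (PosRoot n)) :
    monomial f (content l) =
      (l.map fun β => SymmetricAlgebra.ι ℂ (nMinus n) (f β)).prod := by
  induction l with
  | nil => simp [monomial, content]
  | cons β l ih =>
    rw [content_cons, monomial_add, monomial_single, ih, List.map_cons, List.prod_cons]

theorem exists_content_eq (s : PosRoot n → ℕ) : ∃ l : List (PosRoot n), content l = s := by
  refine ⟨(∑ β, Multiset.replicate (s β) β : Multiset (PosRoot n)).toList, ?_⟩
  funext γ
  rw [content, ← Multiset.coe_count, Multiset.coe_toList, Multiset.count_sum',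
    Finset.sum_eq_single γ]
  · simp
  · intro β _ hβ
    simp [Multiset.count_replicate, hβ]
  · simp

theorem sum_content (l : List (PosRoot n)) : ∑ β, content l β = l.length := by
  induction l with
  | nil => simp [content]
  | cons β l ih =>
    rw [content_cons]
    simp only [Pi.add_apply, Finset.sum_add_distrib, ih, Finset.sum_pi_single', Finset.mem_univ,
      if_true, List.length_cons]
    omega

end RootVectors

/-! ### Words acting on a module and on its associated graded module -/

section Words

variable {R L : Type*} [CommRing R] [LieRing L] [LieAlgebra R L]
variable {M : Type*} [AddCommGroup M] [Module R M] [LieRingModule L M] [LieModule R L M]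

/-- The action `x₁ (x₂ (⋯ (x_l m)))` of a word `x₁ ⋯ x_l`. -/
def wordAct (l : List L) (m : M) : M := l.foldr (fun x m => ⁅x, m⁆) m

theorem wordAct_cons (x : L) (l : List L) (m : M) : wordAct (x :: l) m = ⁅x, wordAct l m⁆ := rfl

theorem wordAct_nil (m : M) : wordAct ([] : List L) m = m := rfl

theorem orbitMap_prod (v : M) (l : List L) :
    orbitMap R L v (l.map (UniversalEnvelopingAlgebra.ι R)).prod = wordAct l v := by
  induction l with
  | nil => simp [orbitMap, wordAct]
  | cons x l ih =>
    rw [wordAct_cons, ← ih]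
    simp [orbitMap]

theorem filtration_eq_span (v : M) (s : ℕ) :
    filtration R L v s = Submodule.span R {m | ∃ l : List L, l.length ≤ s ∧ m = wordAct l v} := by
  rw [filtration, envFiltration, Submodule.map_span]
  congr 1
  ext m
  constructor
  · rintro ⟨_, ⟨l, hl, rfl⟩, rfl⟩
    exact ⟨l, hl, orbitMap_prod v l⟩
  · rintro ⟨l, hl, rfl⟩
    exact ⟨_, ⟨l, hl, rfl⟩, orbitMap_prod v l⟩

theorem wordAct_mem_filtration (v : M) (l : List L) {s : ℕ} (h : l.length ≤ s) :
    wordAct l v ∈ filtration R L v s := by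
  rw [filtration_eq_span]
  exact Submodule.subset_span ⟨l, h, rfl⟩

theorem filtration_mono (v : M) {s t : ℕ} (h : s ≤ t) :
    filtration R L v s ≤ filtration R L v t := by
  rw [filtration_eq_span, filtration_eq_span]
  refine Submodule.span_mono ?_
  rintro m ⟨l, hl, rfl⟩
  exact ⟨l, hl.trans h, rfl⟩

theorem grClass_eq_zero_iff (v : M) (s : ℕ) (m : filtration R L v s) :
    grClass R L v s m = 0 ↔ (m : M) ∈ filtrationPred R L v s :=
  (Submodule.Quotient.mk_eq_zero _).trans Submodule.mem_comap

theorem prod_ι_smul_grVec (v : M) (l : List L) :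
    (l.map (SymmetricAlgebra.ι R L)).prod • grVec R L v =
      grOf R L v l.length (grClass R L v l.length
        ⟨wordAct l v, wordAct_mem_filtration v l le_rfl⟩) := by
  induction l with
  | nil =>
    rw [List.map_nil, List.prod_nil, one_smul]
    rfl
  | cons x l ih =>
    rw [List.map_cons, List.prod_cons, mul_smul, ih, ι_smul_gr]
    rfl

theorem ι_smul_eq_grActHom (v : M) (x : L) (a : Gr R L v) :
    SymmetricAlgebra.ι R L x • a = grActHom R L v x a :=
  congrArg (fun F : Module.End R (Gr R L v) => F a) (symRep_ι _ (grActHom_comm R L v) x)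

/-- In degree `s` only words of length exactly `s` survive, and these are monomials applied to the
cyclic vector. -/
theorem span_grVec (v : M) :
    Submodule.span (SymmetricAlgebra R L) {grVec R L v} = ⊤ := by
  set N := Submodule.span (SymmetricAlgebra R L) {grVec R L v}
  rw [eq_top_iff]
  rintro a -
  have key : ∀ (s : ℕ) (m : filtration R L v s), grOf R L v s (grClass R L v s m) ∈ N := by
    rintro s ⟨m, hm⟩
    have hm' := hm
    rw [filtration_eq_span] at hm'
    induction hm' using Submodule.span_induction with
    | mem m h =>
      obtain ⟨l, hl, rfl⟩ := h
      rcases hl.lt_or_eq with hl | rfl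
      · have : grClass R L v s ⟨wordAct l v, hm⟩ = 0 := by
          rw [grClass_eq_zero_iff]
          cases s with
          | zero => omega
          | succ s => exact wordAct_mem_filtration v l (Nat.lt_succ_iff.1 hl)
        rw [this, map_zero]
        exact zero_mem _
      · rw [← prod_ι_smul_grVec]
        exact Submodule.smul_mem _ _ (Submodule.mem_span_singleton_self _)
    | zero =>
      have : grClass R L v s ⟨0, hm⟩ = 0 := (grClass R L v s).map_zero
      rw [this, map_zero]
      exact zero_mem _
    | add x y hx hy ihx ihy =>
      rw [← filtration_eq_span] at hx hy
      have : grClass R L v s ⟨x + y, hm⟩ = grClass R L v s ⟨x, hx⟩ + grClass R L v s ⟨y, hy⟩ := rfl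
      rw [this, map_add]
      exact add_mem (ihx hx) (ihy hy)
    | smul c x hx ih =>
      rw [← filtration_eq_span] at hx
      have : grClass R L v s ⟨c • x, hm⟩ = c • grClass R L v s ⟨x, hx⟩ := rfl
      rw [this, map_smul]
      exact (N.restrictScalars R).smul_mem c (ih hx)
  change (⨁ s, GrPiece R L v s) at a
  induction a using DirectSum.induction_on with
  | zero => exact zero_mem N
  | of s x =>
    obtain ⟨m, rfl⟩ := Submodule.Quotient.mk_surjective _ x
    exact key s m
  | add x y hx hy => exact add_mem hx hy

end Words

/-! ### Induction on enveloping algebras, and stable ideals -/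

section Env

attribute [local instance 100] LieRing.ofAssociativeRing

variable {R L : Type*} [CommRing R] [LieRing L] [LieAlgebra R L]

theorem env_adjoin_eq_top :
    Algebra.adjoin R (Set.range (UniversalEnvelopingAlgebra.ι R : L →ₗ⁅R⁆ _)) = ⊤ := by
  set A := Algebra.adjoin R (Set.range (UniversalEnvelopingAlgebra.ι R : L →ₗ⁅R⁆ _)) with hA
  let g : L →ₗ⁅R⁆ A :=
    { toFun := fun x => ⟨UniversalEnvelopingAlgebra.ι R x, Algebra.subset_adjoin ⟨x, rfl⟩⟩
      map_add' := fun x y => Subtype.ext (map_add _ x y)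
      map_smul' := fun c x => Subtype.ext (map_smul _ c x)
      map_lie' := fun {x y} => Subtype.ext (LieHom.map_lie _ x y) }
  have h : A.val.comp (UniversalEnvelopingAlgebra.lift R g) = AlgHom.id R _ := by
    apply UniversalEnvelopingAlgebra.hom_ext
    ext x
    simp [g]
  rw [eq_top_iff]
  rintro u -
  have := congrArg (fun F => F u) h
  simp only [AlgHom.comp_apply, AlgHom.id_apply] at this
  rw [← this]
  exact (UniversalEnvelopingAlgebra.lift R g u).2

theorem env_lift_ι_mul {A : Type*} [Ring A] [Algebra R A] (φ : L →ₗ⁅R⁆ A) (e : L)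
    (u : UniversalEnvelopingAlgebra R L) :
    UniversalEnvelopingAlgebra.lift R φ (UniversalEnvelopingAlgebra.ι R e * u) =
      φ e * UniversalEnvelopingAlgebra.lift R φ u := by
  rw [map_mul, UniversalEnvelopingAlgebra.lift_ι_apply]

variable {S : Type*} [CommRing S] [Algebra R S]

theorem derivation_mem_span (D : Derivation R S S) {G : Set S}
    (h : ∀ g ∈ G, D g ∈ Ideal.span G) {p : S} (hp : p ∈ Ideal.span G) : D p ∈ Ideal.span G := by
  induction hp using Submodule.span_induction with
  | mem p hp => exact h p hp
  | zero => simp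
  | add x y _ _ hx hy =>
    rw [map_add]
    exact add_mem hx hy
  | smul a x hx' hx =>
    rw [smul_eq_mul, Derivation.leibniz, smul_eq_mul, smul_eq_mul]
    exact add_mem (Ideal.mul_mem_left _ _ hx) (Ideal.mul_mem_right _ _ hx')

theorem symDerivation_action {E : Type*} [AddCommGroup E] [Module R E]
    [Module (SymmetricAlgebra R L) E] [IsScalarTower R (SymmetricAlgebra R L) E]
    (T : E →ₗ[R] E) (d : L →ₗ[R] L)
    (hT : ∀ (y : L) a, T (SymmetricAlgebra.ι R L y • a) =
      SymmetricAlgebra.ι R L y • T a + SymmetricAlgebra.ι R L (d y) • a)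
    (p : SymmetricAlgebra R L) (a : E) : T (p • a) = p • T a + symDerivation d p • a := by
  induction p using SymmetricAlgebra.induction generalizing a with
  | algebraMap r => simp [algebraMap_smul]
  | ι y => rw [hT, symDerivation_ι]
  | mul p q hp hq =>
    rw [mul_smul, hp, hq, Derivation.leibniz, smul_add, add_smul, smul_eq_mul, smul_eq_mul,
      mul_comm q]
    simp only [mul_smul]
    rw [add_assoc]
  | add p q hp hq =>
    rw [add_smul, map_add, hp, hq, map_add, add_smul, add_smul]
    abel

end Env

section Symplectic

attribute [local instance 100] LieRing.ofAssociativeRing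

variable {n : ℕ}

theorem envAction_mem {J : Submodule ℂ (SymMinus n)}
    (hJ : ∀ (e : nPlus n), ∀ p ∈ J, nPlusAction n e p ∈ J)
    (u : UniversalEnvelopingAlgebra ℂ (nPlus n)) : ∀ p ∈ J, envAction n u p ∈ J := by
  have hu : u ∈ Algebra.adjoin ℂ (Set.range
      (UniversalEnvelopingAlgebra.ι ℂ : nPlus n →ₗ⁅ℂ⁆ _)) := by
    rw [env_adjoin_eq_top]
    trivial
  induction hu using Algebra.adjoin_induction with
  | mem u h =>
    obtain ⟨e, rfl⟩ := h
    intro p hp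
    rw [envAction, UniversalEnvelopingAlgebra.lift_ι_apply]
    exact hJ e p hp
  | algebraMap c =>
    intro p hp
    rw [AlgHom.commutes]
    exact J.smul_mem c hp
  | add a b _ _ ha hb =>
    intro p hp
    rw [map_add]
    exact add_mem (ha p hp) (hb p hp)
  | mul a b _ _ ha hb =>
    intro p hp
    rw [map_mul]
    exact ha _ (hb p hp)

theorem envAction_ι_mul (e : nPlus n) (u : UniversalEnvelopingAlgebra ℂ (nPlus n))
    (p : SymMinus n) :
    envAction n (UniversalEnvelopingAlgebra.ι ℂ e * u) p = nPlusAction n e (envAction n u p) :=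
  congrArg (fun F : Module.End ℂ (SymMinus n) => F p) (env_lift_ι_mul (nPlusAction n) e u)

theorem nPlusAction_mem_relIdeal (f : PosRoot n → nMinus n) (m : Fin n → ℕ) (e : nPlus n)
    {p : SymMinus n} (hp : p ∈ relIdeal f m) : nPlusAction n e p ∈ relIdeal f m := by
  rw [nPlusAction_apply, relIdeal]
  rw [relIdeal] at hp
  refine derivation_mem_span (symDerivation (adLower e)) (fun g hg => ?_) hp
  obtain ⟨u, r, hr, rfl⟩ := hg
  rw [← nPlusAction_apply, ← envAction_ι_mul]
  exact Ideal.subset_span ⟨UniversalEnvelopingAlgebra.ι ℂ e * u, r, hr, rfl⟩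

theorem relSpace_le_relIdeal (f : PosRoot n → nMinus n) (m : Fin n → ℕ) {r : SymMinus n}
    (hr : r ∈ relSpace f m) : r ∈ relIdeal f m :=
  Ideal.subset_span ⟨1, r, hr, by simp⟩

section Stable

variable {E : Type*} [AddCommGroup E] [Module ℂ E] [Module (SymMinus n) E]
  [IsScalarTower ℂ (SymMinus n) E]

/-- By the Leibniz rule the annihilator of a vector killed by all `T e` is stable under `n⁺`, so it
is enough to test the powers spanning `R`. The space `E` is left abstract because the lemma serves
both `gr V` and `gr V ⊗ gr W`. -/
theorem relIdeal_le_torsionOf (f : PosRoot n → nMinus n) (m : Fin n → ℕ) (T : nPlus n → E →ₗ[ℂ] E)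
    (hT : ∀ e (y : nMinus n) a, T e (SymmetricAlgebra.ι ℂ (nMinus n) y • a) =
      SymmetricAlgebra.ι ℂ (nMinus n) y • T e a +
        SymmetricAlgebra.ι ℂ (nMinus n) (adLower e y) • a)
    (u : E) (hu : ∀ e, T e u = 0) (hR : ∀ r ∈ relSpace f m, r • u = 0) :
    relIdeal f m ≤ Ideal.torsionOf (SymMinus n) E u := by
  rw [relIdeal, Ideal.span_le]
  rintro _ ⟨w, r, hr, rfl⟩
  refine envAction_mem (J := (Ideal.torsionOf (SymMinus n) E u).restrictScalars ℂ) ?_ w r ?_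
  · intro e p hp
    rw [Submodule.restrictScalars_mem, Ideal.mem_torsionOf_iff] at hp ⊢
    have := symDerivation_action (T e) (adLower e) (hT e) p u
    rw [nPlusAction_apply]
    rwa [hp, hu, smul_zero, zero_add, map_zero, eq_comm] at this
  · rw [Submodule.restrictScalars_mem, Ideal.mem_torsionOf_iff]
    exact hR r hr

end Stable

/-! ### The action of `n⁺` on the associated graded module -/

section GradedAction

variable {V : Type*} [AddCommGroup V] [Module ℂ V] [LieRingModule (sp n) V] [LieModule ℂ (sp n) V]

/-- `v` is a common eigenvector of the upper triangular matrices. -/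
def IsBorelEigenvector (n : ℕ) {V : Type*} [AddCommGroup V] [Module ℂ V]
    [LieRingModule (sp n) V] (v : V) : Prop :=
  ∀ A : sp n, lowerPart n A = 0 → ∃ c : ℂ, ⁅A, v⁆ = c • v

theorem lowerPart_sub_lowerPart (A : sp n) :
    lowerPart n (A - (lowerPart n A : sp n)) = 0 := by
  rw [map_sub, lowerPart_coe, sub_self]

theorem lowerPart_nPlus (e : nPlus n) : lowerPart n (e : sp n) = 0 :=
  (lowerPart_eq_zero_iff _).2 fun p q h => e.2 p q h.le

theorem exists_cartan_nPlus {A : sp n} (h : lowerPart n A = 0) :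
    ∃ (H : cartan n) (e : nPlus n), A = (H : sp n) + (e : sp n) := by
  rw [lowerPart_eq_zero_iff] at h
  let H : cartan n := cartanOf fun i => A.1 (.inl i) (.inl i)
  have hH : ∀ p, H.1.1 p p = A.1 p p := by
    rintro (i | i)
    · exact cartanOf_inl _ i
    · exact (cartanOf_inr _ i).trans (((mem_sp_iff A.1).1 A.2).1 i i).symm
  refine ⟨H, ⟨A - (H : sp n), fun p q hpq => ?_⟩, by simp⟩
  change A.1 p q - H.1.1 p q = 0
  rcases hpq.lt_or_eq with hlt | heq
  · rw [h p q hlt, H.2 p q (fun h' => by rw [h'] at hlt; omega), sub_zero]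
  · rw [pos_injective heq, hH, sub_self]

theorem IsHighestWeightVector.isBorelEigenvector {m : Fin n → ℕ} {v : V}
    (h : IsHighestWeightVector m v) : IsBorelEigenvector n v := by
  intro A hA
  obtain ⟨H, e, rfl⟩ := exists_cartan_nPlus hA
  exact ⟨domWeight m H, by rw [add_lie, h.nPlus_lie, h.cartan_lie, add_zero]⟩

omit [Module ℂ V] [LieModule ℂ (sp n) V] in
theorem coe_nMinus_lie (y : nMinus n) (m : V) : ⁅(y : sp n), m⁆ = ⁅y, m⁆ := rfl

theorem lie_mem_filtration_of_forall {v : V} {s : ℕ}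
    (h : ∀ A : sp n, lowerPart n A = 0 → ∀ m ∈ filtration ℂ (nMinus n) v s,
      ⁅A, m⁆ ∈ filtration ℂ (nMinus n) v s)
    (A : sp n) {m : V} (hm : m ∈ filtration ℂ (nMinus n) v s) :
    ⁅A, m⁆ ∈ filtration ℂ (nMinus n) v (s + 1) := by
  have e : ⁅A, m⁆ = ⁅lowerPart n A, m⁆ + ⁅A - (lowerPart n A : sp n), m⁆ := by
    rw [← coe_nMinus_lie, ← add_lie, add_sub_cancel]
  rw [e]
  exact add_mem (lie_mem_filtration ℂ _ v s _ hm)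
    (filtration_mono v (Nat.le_succ s) (h _ (lowerPart_sub_lowerPart A) m hm))

/-- Induction on the length of a word: moving `A` past the first letter `y` costs `[A, y]`, whose
lower part adds back at most one letter and whose remaining part is upper triangular again. -/
theorem IsBorelEigenvector.lie_mem {v : V} (hv : IsBorelEigenvector n v) (s : ℕ) :
    ∀ A : sp n, lowerPart n A = 0 → ∀ m ∈ filtration ℂ (nMinus n) v s,
      ⁅A, m⁆ ∈ filtration ℂ (nMinus n) v s := by
  induction s with
  | zero =>
    intro A hA m hm
    have hm' := hm
    rw [filtration_eq_span] at hm'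
    induction hm' using Submodule.span_induction with
    | mem m h =>
      obtain ⟨l, hl, rfl⟩ := h
      obtain rfl : l = [] := List.length_eq_zero_iff.1 (Nat.le_zero.1 hl)
      obtain ⟨c, hc⟩ := hv A hA
      rw [wordAct_nil, hc]
      exact Submodule.smul_mem _ _ (mem_filtration_zero ℂ _ v)
    | zero => simp
    | add x y hx hy ihx ihy =>
      rw [← filtration_eq_span] at hx hy
      rw [lie_add]
      exact add_mem (ihx hx) (ihy hy)
    | smul c x hx ih =>
      rw [← filtration_eq_span] at hx
      rw [lie_smul]
      exact Submodule.smul_mem _ _ (ih hx)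
  | succ s ih =>
    intro A hA m hm
    rw [filtration_eq_span] at hm
    induction hm using Submodule.span_induction with
    | mem m h =>
      obtain ⟨l, hl, rfl⟩ := h
      cases l with
      | nil =>
        obtain ⟨c, hc⟩ := hv A hA
        rw [wordAct_nil, hc]
        exact Submodule.smul_mem _ _
          (filtration_mono v (Nat.zero_le _) (mem_filtration_zero ℂ _ v))
      | cons y l =>
        have hw : wordAct l v ∈ filtration ℂ (nMinus n) v s :=
          wordAct_mem_filtration v l (by simpa using hl)
        rw [wordAct_cons, ← coe_nMinus_lie, leibniz_lie]
        exact add_mem (lie_mem_filtration_of_forall ih _ hw)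
          (lie_mem_filtration ℂ _ v s y (ih A hA _ hw))
    | zero => simp
    | add x y _ _ ihx ihy =>
      rw [lie_add]
      exact add_mem ihx ihy
    | smul c x _ ih =>
      rw [lie_smul]
      exact Submodule.smul_mem _ _ ih

variable {v : V} (hv : IsBorelEigenvector n v)

theorem IsBorelEigenvector.lie_mem_pred {v : V} (hv : IsBorelEigenvector n v) (s : ℕ) (A : sp n)
    (hA : lowerPart n A = 0) {m : V} (hm : m ∈ filtrationPred ℂ (nMinus n) v s) :
    ⁅A, m⁆ ∈ filtrationPred ℂ (nMinus n) v s := by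
  cases s with
  | zero =>
    have : m = 0 := hm
    simp [this]
  | succ s => exact hv.lie_mem s A hA m hm

/-- The action of an element of `n⁺` on `M_s`. -/
def raiseFil (e : nPlus n) (s : ℕ) :
    filtration ℂ (nMinus n) v s →ₗ[ℂ] filtration ℂ (nMinus n) v s :=
  (LieModule.toEnd ℂ (sp n) V (e : sp n)).restrict
    (hv.lie_mem s (e : sp n) (lowerPart_nPlus e))

/-- The operator on `gr M` induced by an element of `n⁺`. -/
def raise (e : nPlus n) : Module.End ℂ (Gr ℂ (nMinus n) v) :=
  DirectSum.toModule ℂ ℕ (Gr ℂ (nMinus n) v) fun s =>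
    grOf ℂ (nMinus n) v s ∘ₗ Submodule.mapQ _ _ (raiseFil hv e s)
      fun _ hm => hv.lie_mem_pred s (e : sp n) (lowerPart_nPlus e) hm

theorem raise_apply (e : nPlus n) (s : ℕ) (m : filtration ℂ (nMinus n) v s) :
    raise hv e (grOf ℂ (nMinus n) v s (grClass ℂ (nMinus n) v s m)) =
      grOf ℂ (nMinus n) v s (grClass ℂ (nMinus n) v s (raiseFil hv e s m)) := by
  erw [DirectSum.toModule_lof]
  rfl

/-- The component of `[e, y]` in `h ⊕ n⁺` does not raise the filtration degree, hence is invisible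
in degree `s + 1` of the graded module. This is where the action modulo `h ⊕ n⁺` comes from. -/
theorem lie_lie_sub_mem {v : V} (hv : IsBorelEigenvector n v) (e : nPlus n) (y : nMinus n) (s : ℕ)
    {m : V} (hm : m ∈ filtration ℂ (nMinus n) v s) :
    ⁅(e : sp n), ⁅y, m⁆⁆ - (⁅y, ⁅(e : sp n), m⁆⁆ + ⁅adLower e y, m⁆) ∈
      filtration ℂ (nMinus n) v s := by
  have h := hv.lie_mem s _ (lowerPart_sub_lowerPart ⁅(e : sp n), (y : sp n)⁆) m hm
  rw [sub_lie, lie_lie, coe_nMinus_lie, coe_nMinus_lie, coe_nMinus_lie, ← adLower_apply,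
    sub_sub] at h
  exact h

theorem raise_ι_smul_grOf (e : nPlus n) (y : nMinus n) (s : ℕ)
    (m : filtration ℂ (nMinus n) v s) :
    raise hv e (SymmetricAlgebra.ι ℂ (nMinus n) y •
        grOf ℂ (nMinus n) v s (grClass ℂ (nMinus n) v s m)) =
      SymmetricAlgebra.ι ℂ (nMinus n) y •
        raise hv e (grOf ℂ (nMinus n) v s (grClass ℂ (nMinus n) v s m)) +
        SymmetricAlgebra.ι ℂ (nMinus n) (adLower e y) •
          grOf ℂ (nMinus n) v s (grClass ℂ (nMinus n) v s m) := by
  rw [ι_smul_gr, ι_smul_gr, raise_apply, raise_apply, ι_smul_gr, ← map_add, ← map_add]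
  congr 1
  rw [← sub_eq_zero, ← map_sub, grClass_eq_zero_iff]
  exact lie_lie_sub_mem hv e y s m.2

theorem raise_ι_smul (e : nPlus n) (y : nMinus n) (a : Gr ℂ (nMinus n) v) :
    raise hv e (SymmetricAlgebra.ι ℂ (nMinus n) y • a) =
      SymmetricAlgebra.ι ℂ (nMinus n) y • raise hv e a +
        SymmetricAlgebra.ι ℂ (nMinus n) (adLower e y) • a := by
  have h : raise hv e ∘ₗ grActHom ℂ (nMinus n) v y =
      grActHom ℂ (nMinus n) v y ∘ₗ raise hv e + grActHom ℂ (nMinus n) v (adLower e y) := by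
    refine gr_hom_ext ℂ (nMinus n) v fun s m => ?_
    have := raise_ι_smul_grOf hv e y s m
    rw [ι_smul_eq_grActHom, ι_smul_eq_grActHom, ι_smul_eq_grActHom] at this
    exact this
  rw [ι_smul_eq_grActHom, ι_smul_eq_grActHom, ι_smul_eq_grActHom]
  exact congrArg (fun F : Module.End ℂ (Gr ℂ (nMinus n) v) => F a) h

theorem raise_grVec (e : nPlus n) (h : ⁅(e : sp n), v⁆ = 0) :
    raise hv e (grVec ℂ (nMinus n) v) = 0 := by
  rw [grVec, raise_apply]
  have : raiseFil hv e 0 ⟨v, mem_filtration_zero ℂ (nMinus n) v⟩ = 0 := Subtype.ext h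
  rw [this, map_zero, map_zero]

end GradedAction

end Symplectic

/-! ### Tensor powers of the vector representation. -/

section TensorFunctions

attribute [local instance 100] LieRing.ofAssociativeRing

/-- The tensor power `(ℂ^{2n})^{⊗ι}`, as functions on multi-indices. -/
def TensorFun (n : ℕ) (ι : Type) : Type := (ι → Fin n ⊕ Fin n) → ℂ

variable {n : ℕ} {ι : Type}

instance : AddCommGroup (TensorFun n ι) := inferInstanceAs (AddCommGroup ((ι → _) → ℂ))
instance : Module ℂ (TensorFun n ι) := inferInstanceAs (Module ℂ ((ι → _) → ℂ))

theorem TensorFun.add_apply (φ ψ : TensorFun n ι) (p : ι → Fin n ⊕ Fin n) :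
    (φ + ψ) p = φ p + ψ p := rfl

theorem TensorFun.smul_apply (c : ℂ) (φ : TensorFun n ι) (p : ι → Fin n ⊕ Fin n) :
    (c • φ) p = c * φ p := rfl

variable [Fintype ι] [DecidableEq ι]

instance : FiniteDimensional ℂ (TensorFun n ι) :=
  inferInstanceAs (FiniteDimensional ℂ ((ι → Fin n ⊕ Fin n) → ℂ))

/-- The action of a matrix on the tensor power, by derivations. -/
def tensorMap (A : Matrix (Fin n ⊕ Fin n) (Fin n ⊕ Fin n) ℂ) (φ : TensorFun n ι) :
    TensorFun n ι :=
  fun p => ∑ k, ∑ x, A (p k) x * φ (Function.update p k x)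

theorem tensorMap_apply (A : Matrix (Fin n ⊕ Fin n) (Fin n ⊕ Fin n) ℂ) (φ : TensorFun n ι)
    (p : ι → Fin n ⊕ Fin n) :
    tensorMap A φ p = ∑ k, ∑ x, A (p k) x * φ (Function.update p k x) := rfl

/-- Terms with both matrices in the same slot give the product `A * B`; terms in different slots are
symmetric in `A` and `B` and cancel in the commutator. -/
theorem tensorMap_tensorMap (A B : Matrix (Fin n ⊕ Fin n) (Fin n ⊕ Fin n) ℂ)
    (φ : TensorFun n ι) (p : ι → Fin n ⊕ Fin n) :
    tensorMap A (tensorMap B φ) p = tensorMap (A * B) φ p +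
      ∑ k, ∑ l ∈ Finset.univ.erase k, ∑ x, ∑ y,
        A (p k) x * B (p l) y * φ (Function.update (Function.update p k x) l y) := by
  rw [tensorMap_apply, tensorMap_apply, ← Finset.sum_add_distrib]
  refine Finset.sum_congr rfl fun k _ => ?_
  have h1 : ∀ x, A (p k) x * tensorMap B φ (Function.update p k x) =
      ∑ y, A (p k) x * B x y * φ (Function.update p k y) +
      ∑ l ∈ Finset.univ.erase k, ∑ y,
        A (p k) x * B (p l) y * φ (Function.update (Function.update p k x) l y) := by
    intro x
    rw [tensorMap_apply, ← Finset.add_sum_erase _ _ (Finset.mem_univ k), mul_add, Finset.mul_sum,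
      Finset.mul_sum]
    congr 1
    · refine Finset.sum_congr rfl fun y _ => ?_
      rw [Function.update_self, Function.update_idem, mul_assoc]
    · refine Finset.sum_congr rfl fun l hl => ?_
      rw [Finset.mul_sum]
      refine Finset.sum_congr rfl fun y _ => ?_
      rw [Function.update_of_ne (Finset.ne_of_mem_erase hl), mul_assoc]
  simp_rw [h1]
  rw [Finset.sum_add_distrib]
  congr 1
  · rw [Finset.sum_comm]
    refine Finset.sum_congr rfl fun y _ => ?_
    rw [Matrix.mul_apply, Finset.sum_mul]
  · rw [Finset.sum_comm]

theorem tensorMap_comm (A B : Matrix (Fin n ⊕ Fin n) (Fin n ⊕ Fin n) ℂ) (φ : TensorFun n ι) :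
    tensorMap (A * B - B * A) φ = tensorMap A (tensorMap B φ) - tensorMap B (tensorMap A φ) := by
  funext p
  have hsub : tensorMap (A * B - B * A) φ p = tensorMap (A * B) φ p - tensorMap (B * A) φ p := by
    simp only [tensorMap_apply, Matrix.sub_apply, sub_mul, Finset.sum_sub_distrib]
  change _ = tensorMap A (tensorMap B φ) p - tensorMap B (tensorMap A φ) p
  rw [hsub, tensorMap_tensorMap, tensorMap_tensorMap, add_sub_add_comm]
  have hswap : ∑ k, ∑ l ∈ Finset.univ.erase k, ∑ x, ∑ y,
        A (p k) x * B (p l) y * φ (Function.update (Function.update p k x) l y) =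
      ∑ k, ∑ l ∈ Finset.univ.erase k, ∑ x, ∑ y,
        B (p k) x * A (p l) y * φ (Function.update (Function.update p k x) l y) := by
    rw [Finset.sum_comm' (s' := fun l => Finset.univ.erase l) (t' := Finset.univ)
      (by simp [eq_comm])]
    refine Finset.sum_congr rfl fun l _ => Finset.sum_congr rfl fun k hk => ?_
    rw [Finset.sum_comm]
    refine Finset.sum_congr rfl fun y _ => Finset.sum_congr rfl fun x _ => ?_
    rw [Function.update_comm (Finset.ne_of_mem_erase hk), mul_comm (A _ _)]
  rw [hswap, sub_self, add_zero]

instance : LieRingModule (sp n) (TensorFun n ι) where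
  bracket A φ := tensorMap A.1 φ
  add_lie A B φ := by
    funext p
    change tensorMap (A.1 + B.1) φ p = tensorMap A.1 φ p + tensorMap B.1 φ p
    simp only [tensorMap_apply, Matrix.add_apply, add_mul, Finset.sum_add_distrib]
  lie_add A φ ψ := by
    funext p
    change tensorMap A.1 (φ + ψ) p = tensorMap A.1 φ p + tensorMap A.1 ψ p
    simp only [tensorMap_apply, TensorFun.add_apply, mul_add, Finset.sum_add_distrib]
  leibniz_lie A B φ := by
    change tensorMap A.1 (tensorMap B.1 φ) =
      tensorMap (A.1 * B.1 - B.1 * A.1) φ + tensorMap B.1 (tensorMap A.1 φ)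
    rw [tensorMap_comm, sub_add_cancel]

instance : LieModule ℂ (sp n) (TensorFun n ι) where
  smul_lie c A φ := by
    funext p
    change tensorMap (c • A.1) φ p = c * tensorMap A.1 φ p
    simp only [tensorMap_apply, Matrix.smul_apply, smul_eq_mul, Finset.mul_sum, mul_assoc]
  lie_smul c A φ := by
    funext p
    change tensorMap A.1 (c • φ) p = c * tensorMap A.1 φ p
    simp only [tensorMap_apply, TensorFun.smul_apply, Finset.mul_sum, mul_left_comm]

theorem lie_tensorFun (A : sp n) (φ : TensorFun n ι) : ⁅A, φ⁆ = tensorMap A.1 φ := rfl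

theorem nMinus_lie_tensorFun (y : nMinus n) (φ : TensorFun n ι) : ⁅y, φ⁆ = tensorMap y.1.1 φ := rfl

/-! ### The invariant Hermitian form -/

/-- The standard Hermitian form. -/
def herm (φ ψ : TensorFun n ι) : ℂ := ∑ p, star (φ p) * ψ p

theorem herm_add_right (φ ψ χ : TensorFun n ι) : herm φ (ψ + χ) = herm φ ψ + herm φ χ := by
  simp only [herm, TensorFun.add_apply, mul_add, Finset.sum_add_distrib]

theorem herm_smul_right (c : ℂ) (φ ψ : TensorFun n ι) : herm φ (c • ψ) = c * herm φ ψ := by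
  simp only [herm, TensorFun.smul_apply, Finset.mul_sum, mul_left_comm]

theorem herm_zero_left (ψ : TensorFun n ι) : herm 0 ψ = 0 :=
  Finset.sum_eq_zero fun p _ => by
    change star (0 : ℂ) * _ = 0
    simp

theorem herm_zero_right (φ : TensorFun n ι) : herm φ 0 = 0 :=
  Finset.sum_eq_zero fun _ _ => mul_zero _

theorem star_herm (φ ψ : TensorFun n ι) : star (herm φ ψ) = herm ψ φ := by
  simp only [herm, star_sum, star_mul', star_star, mul_comm]

open scoped ComplexOrder in
theorem herm_self_eq_zero {φ : TensorFun n ι} (h : herm φ φ = 0) : φ = 0 :=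
  dotProduct_star_self_eq_zero.1 h

/-- The conjugate transpose of an element of `sp_{2n}`. -/
def spStar (A : sp n) : sp n :=
  ⟨A.1.conjTranspose, by
    rw [mem_sp_iff_sgn]
    intro p q
    rw [Matrix.conjTranspose_apply, Matrix.conjTranspose_apply, sp_entry A q p, star_mul', star_neg,
      star_mul']
    have h : ∀ r : Fin n ⊕ Fin n, star (sgn r) = sgn r := by
      rintro (i | i) <;> simp [sgn]
    rw [h, h, mul_comm (sgn q)]⟩

theorem herm_lie (A : sp n) (φ ψ : TensorFun n ι) : herm ⁅A, φ⁆ ψ = herm φ ⁅spStar A, ψ⁆ := by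
  rw [lie_tensorFun, lie_tensorFun]
  simp only [herm, tensorMap_apply, star_sum, star_mul', Finset.sum_mul, Finset.mul_sum]
  rw [Finset.sum_comm]
  conv_rhs => rw [Finset.sum_comm]
  refine Finset.sum_congr rfl fun k _ => ?_
  rw [← Fintype.sum_prod_type', ← Fintype.sum_prod_type']
  -- Exchanging the coordinate `p k` with the summation index is an involution that turns a matrix
  -- into its transpose.
  let e : (ι → Fin n ⊕ Fin n) × (Fin n ⊕ Fin n) → (ι → Fin n ⊕ Fin n) × (Fin n ⊕ Fin n) :=
    fun z => (Function.update z.1 k z.2, z.1 k)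
  have he : Function.Involutive e := fun z => by simp [e]
  refine Fintype.sum_equiv (he.toPerm e) _ _ fun z => ?_
  have h1 : (he.toPerm e z).1 = Function.update z.1 k z.2 := rfl
  have h2 : (he.toPerm e z).2 = z.1 k := rfl
  rw [h1, h2, Function.update_idem, Function.update_eq_self, Function.update_self]
  change _ = _ * (star (A.1 (z.1 k) z.2) * _)
  ring

/-- The conjugate transpose of an element of `n⁻` lies in `n⁺` and kills `v`. -/
theorem herm_word_eq_zero {v : TensorFun n ι} (hv : ∀ e : nPlus n, ⁅(e : sp n), v⁆ = 0)
    (y : nMinus n) (φ : TensorFun n ι) : herm v ⁅y, φ⁆ = 0 := by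
  have hs : spStar (spStar (y : sp n)) = (y : sp n) := by
    ext p q
    exact star_star _
  have := herm_lie (spStar (y : sp n)) v φ
  rw [hs] at this
  change herm v ⁅(y : sp n), φ⁆ = 0
  rw [← this]
  have he := hv ⟨spStar (y : sp n), fun p q h => by
    change star (y.1.1 q p) = 0
    rw [y.2 q p h, star_zero]⟩
  change ⁅spStar (y : sp n), v⁆ = 0 at he
  rw [he, herm_zero_left]

end TensorFunctions

/-! ### The highest weight vector -/

section HighestWeight

attribute [local instance 100] LieRing.ofAssociativeRing

variable {n : ℕ}

/-- The columns of the Young diagram of `∑ m_i ω_i`. -/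
abbrev YCol (m : Fin n → ℕ) : Type := Σ i : Fin n, Fin (m i)

/-- The boxes of the Young diagram of `∑ m_i ω_i`. -/
abbrev YBox (m : Fin n → ℕ) : Type := Σ c : YCol m, {k : Fin n // k ≤ c.1}

variable {m : Fin n → ℕ}

/-- The matrix whose determinant is the contribution of a column to the highest weight vector. -/
def colMatrix (p : YBox m → Fin n ⊕ Fin n) (c : YCol m) :
    Matrix {k : Fin n // k ≤ c.1} {k : Fin n // k ≤ c.1} ℂ :=
  fun l k => if p ⟨c, k⟩ = .inl l.1 then 1 else 0

/-- The product of the vectors `e_0 ∧ ⋯ ∧ e_i` over all columns. -/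
def highestVec (m : Fin n → ℕ) : TensorFun n (YBox m) := fun p => ∏ c, (colMatrix p c).det

/-- This is the derivative of the determinant along `B ↦ D * B`, one column at a time. -/
theorem trace_adjugate_sum {α : Type*} [Fintype α] [DecidableEq α] (B D : Matrix α α ℂ) :
    ∑ k, (B.updateCol k fun l => (D * B) l k).det = D.trace * B.det := by
  have h : ∀ k, (B.updateCol k fun l => (D * B) l k).det =
      ∑ l, B.adjugate k l * (D * B) l k := by
    intro k
    rw [← Matrix.cramer_apply, Matrix.cramer_eq_adjugate_mulVec]
    rfl
  simp_rw [h]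
  have : ∑ k, ∑ l, B.adjugate k l * (D * B) l k = (B.adjugate * (D * B)).trace := by
    simp [Matrix.trace, Matrix.mul_apply]
  rw [this, Matrix.trace_mul_comm, Matrix.mul_assoc, Matrix.mul_adjugate, Matrix.mul_smul,
    Matrix.mul_one, Matrix.trace_smul, smul_eq_mul, mul_comm]

theorem sum_mul_det_updateCol {α γ : Type*} [Fintype α] [DecidableEq α] [Fintype γ]
    (B : Matrix α α ℂ) (k : α) (a : γ → ℂ) (w : γ → α → ℂ) :
    ∑ x, a x * (B.updateCol k (w x)).det = (B.updateCol k fun l => ∑ x, a x * w x l).det := by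
  have h : (fun l => ∑ x, a x * w x l) = ∑ x, a x • w x := by
    funext l
    simp
  simp_rw [h, ← Matrix.cramer_apply, map_sum, map_smul, Finset.sum_apply, Pi.smul_apply,
    smul_eq_mul]

/-- Column by column, an upper triangular `A` preserves the span of the first basis vectors, so it
acts on their wedge by the trace of its restriction. -/
theorem tensorMap_highestVec {A : sp n} (hA : lowerPart n A = 0) :
    ⁅A, highestVec m⁆ =
      (∑ c : YCol m, ∑ k : {k : Fin n // k ≤ c.1}, A.1 (.inl k.1) (.inl k.1)) • highestVec m := by
  rw [lowerPart_eq_zero_iff] at hA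
  funext p
  rw [lie_tensorFun, tensorMap_apply, TensorFun.smul_apply, Finset.sum_mul, Fintype.sum_sigma]
  refine Finset.sum_congr rfl fun c _ => ?_
  set B := colMatrix p c with hB
  set D : Matrix {k : Fin n // k ≤ c.1} {k : Fin n // k ≤ c.1} ℂ :=
    fun l k => A.1 (.inl k.1) (.inl l.1) with hD
  have h1 : ∀ (k : {k : Fin n // k ≤ c.1}) (x : Fin n ⊕ Fin n),
      highestVec m (Function.update p ⟨c, k⟩ x) =
        (B.updateCol k fun l => if x = .inl l.1 then 1 else 0).det *
          ∏ c' ∈ Finset.univ.erase c, (colMatrix p c').det := by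
    intro k x
    rw [highestVec, ← Finset.mul_prod_erase _ _ (Finset.mem_univ c)]
    congr 1
    · congr 1
      ext l k'
      by_cases hk : k' = k
      · subst hk
        simp [colMatrix]
      · rw [Matrix.updateCol_ne hk, hB, colMatrix, colMatrix,
          Function.update_of_ne (by simpa using hk)]
    · refine Finset.prod_congr rfl fun c' hc' => ?_
      congr 1
      ext l k'
      have hne : (⟨c', k'⟩ : YBox m) ≠ ⟨c, k⟩ := fun h =>
        Finset.ne_of_mem_erase hc' (congrArg Sigma.fst h)
      rw [colMatrix, colMatrix, Function.update_of_ne hne]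
  have h2 : ∀ k : {k : Fin n // k ≤ c.1},
      ∑ x, A.1 (p ⟨c, k⟩) x * highestVec m (Function.update p ⟨c, k⟩ x) =
        (B.updateCol k fun l => (D * B) l k).det *
          ∏ c' ∈ Finset.univ.erase c, (colMatrix p c').det := by
    intro k
    simp_rw [h1, ← mul_assoc]
    rw [← Finset.sum_mul]
    congr 1
    refine (sum_mul_det_updateCol B k _ _).trans ?_
    congr 2
    funext l
    rw [Matrix.mul_apply]
    simp only [mul_ite, mul_one, mul_zero, Finset.sum_ite_eq',
      Finset.mem_univ, if_true, hB, colMatrix, hD]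
    rcases hp : p ⟨c, k⟩ with j | j
    · by_cases hj : j ≤ c.1
      · rw [Finset.sum_eq_single ⟨j, hj⟩]
        · simp
        · intro b _ hb
          rw [if_neg]
          intro h
          exact hb (Subtype.ext (Sum.inl_injective h).symm)
        · simp
      -- Here `j` lies beyond the column, so the entry of `A` in question is strictly below the
      -- diagonal.
      · rw [hA, Finset.sum_eq_zero]
        · intro b _
          rw [if_neg]
          intro h
          exact hj (Sum.inl_injective h ▸ b.2)
        · have := l.2
          have := not_le.1 hj
          rw [Fin.lt_def] at this
          rw [Fin.le_def] at *
          simp only [pos]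
          omega
    · rw [hA, Finset.sum_eq_zero]
      · intro b _
        rw [if_neg (by simp)]
      · have := l.1.2
        have := j.2
        simp only [pos]
        omega
  rw [Finset.sum_congr rfl fun k _ => h2 k, ← Finset.sum_mul, trace_adjugate_sum, mul_assoc]
  congr 1
  rw [highestVec, ← Finset.mul_prod_erase _ _ (Finset.mem_univ c)]

theorem highestVec_isHighestWeightVector : IsHighestWeightVector m (highestVec m) where
  ne_zero := by
    intro h
    have := congrFun h fun b => .inl b.2.1
    rw [highestVec] at this
    change _ = (0 : ℂ) at this
    rw [Finset.prod_eq_one] at this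
    · exact one_ne_zero this
    · intro c _
      have : colMatrix (fun b : YBox m => .inl b.2.1) c = 1 := by
        ext l k
        simp [colMatrix, Matrix.one_apply, Subtype.ext_iff, eq_comm]
      rw [this, Matrix.det_one]
  nPlus_lie e := by
    rw [tensorMap_highestVec (lowerPart_nPlus e)]
    rw [Finset.sum_eq_zero, zero_smul]
    exact fun c _ => Finset.sum_eq_zero fun k _ => e.2 _ _ le_rfl
  cartan_lie H := by
    rw [tensorMap_highestVec]
    · congr 1
      rw [Fintype.sum_sigma, domWeight]
      refine Finset.sum_congr rfl fun i _ => ?_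
      have h : ∀ y : Fin (m i), ∑ k : {k : Fin n // k ≤ (⟨i, y⟩ : YCol m).1},
          H.1.1 (.inl k.1) (.inl k.1) = fundWeight i H := fun y =>
        (Finset.sum_subtype (Finset.Iic i) (by simp) fun k => H.1.1 (.inl k) (.inl k)).symm
      rw [Finset.sum_congr rfl fun y _ => h y, Finset.sum_const, Finset.card_univ,
        Fintype.card_fin, nsmul_eq_mul]
    · rw [lowerPart_eq_zero_iff]
      intro p q h
      exact H.2 p q (by rintro rfl; omega)

end HighestWeight

/-! ### Products of Lie modules. -/

section ProductModule

variable {L M N : Type*} [LieRing L] [AddCommGroup M] [AddCommGroup N] [LieRingModule L M]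
  [LieRingModule L N]

instance prodLieRingModule : LieRingModule L (M × N) where
  bracket x p := (⁅x, p.1⁆, ⁅x, p.2⁆)
  add_lie x y p := Prod.ext (add_lie x y p.1) (add_lie x y p.2)
  lie_add x p q := Prod.ext (lie_add x p.1 q.1) (lie_add x p.2 q.2)
  leibniz_lie x y p := Prod.ext (leibniz_lie x y p.1) (leibniz_lie x y p.2)

theorem lie_prod (x : L) (p : M × N) : ⁅x, p⁆ = (⁅x, p.1⁆, ⁅x, p.2⁆) := rfl

variable {R : Type*} [CommRing R] [LieAlgebra R L] [Module R M] [Module R N] [LieModule R L M]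
  [LieModule R L N]

instance prodLieModule : LieModule R L (M × N) where
  smul_lie c x p := Prod.ext (smul_lie c x p.1) (smul_lie c x p.2)
  lie_smul c x p := Prod.ext (lie_smul c x p.1) (lie_smul c x p.2)

end ProductModule

/-! ### Cyclic submodules, and the embedding of an irreducible module into a tensor power. -/

section Cyclic

attribute [local instance 100] LieRing.ofAssociativeRing

variable {n : ℕ}

theorem wordAct_prod {V W : Type*} [AddCommGroup V] [LieRingModule (sp n) V] [AddCommGroup W]
    [LieRingModule (sp n) W] (l : List (nMinus n)) (v : V) (w : W) :
    wordAct l (v, w) = (wordAct l v, wordAct l w) := by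
  induction l with
  | nil => rfl
  | cons y l ih =>
    rw [wordAct_cons, ih]
    rfl

variable {V : Type*} [AddCommGroup V] [Module ℂ V] [LieRingModule (sp n) V] [LieModule ℂ (sp n) V]

/-- The span of all words in `n⁻` applied to `v`. -/
def cyclicSpan (n : ℕ) {V : Type*} [AddCommGroup V] [Module ℂ V] [LieRingModule (sp n) V]
    (v : V) : Submodule ℂ V :=
  Submodule.span ℂ (Set.range fun l : List (nMinus n) => wordAct l v)

/-- The span of all nonempty words in `n⁻` applied to `v`. -/
def cyclicSpanPos (n : ℕ) {V : Type*} [AddCommGroup V] [Module ℂ V] [LieRingModule (sp n) V]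
    (v : V) : Submodule ℂ V :=
  Submodule.span ℂ {m | ∃ (y : nMinus n) (l : List (nMinus n)), m = wordAct (y :: l) v}

theorem filtration_le_cyclicSpan (v : V) (s : ℕ) :
    filtration ℂ (nMinus n) v s ≤ cyclicSpan n v := by
  rw [filtration_eq_span]
  refine Submodule.span_mono ?_
  rintro _ ⟨l, -, rfl⟩
  exact ⟨l, rfl⟩

theorem IsBorelEigenvector.lie_mem_cyclicSpan {v : V} (hv : IsBorelEigenvector n v) (A : sp n)
    {m : V} (hm : m ∈ cyclicSpan n v) : ⁅A, m⁆ ∈ cyclicSpan n v := by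
  induction hm using Submodule.span_induction with
  | mem m h =>
    obtain ⟨l, rfl⟩ := h
    exact filtration_le_cyclicSpan v (l.length + 1)
      (lie_mem_filtration_of_forall (hv.lie_mem l.length) A
        (wordAct_mem_filtration v l le_rfl))
  | zero => simp
  | add x y _ _ hx hy =>
    rw [lie_add]
    exact add_mem hx hy
  | smul c x _ hx =>
    rw [lie_smul]
    exact Submodule.smul_mem _ _ hx

/-- The element of the Cartan subalgebra on which every simple root takes the value `1`. -/
def gradingElt (n : ℕ) : cartan n := cartanOf fun i => (2 * n - 1) / 2 - i

theorem gradingElt_apply (p : Fin n ⊕ Fin n) :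
    (gradingElt n).1.1 p p = (2 * n - 1) / 2 - (pos p : ℂ) := by
  rcases p with i | i
  · exact cartanOf_inl _ i
  · rw [gradingElt, cartanOf_inr, pos]
    have := i.2
    rw [Nat.cast_sub (by omega), Nat.cast_sub (by omega)]
    push_cast
    ring

theorem toFunctional_gradingElt (β : PosRoot n) :
    ∃ k : ℕ, β.toFunctional (gradingElt n) = k + 1 := by
  have hb := β.bounds
  refine ⟨β.col - β.row, ?_⟩
  rw [toFunctional_eq, gradingElt_apply, gradingElt_apply, β.pos_src, β.pos_tgt,
    Nat.cast_sub hb.2.1]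
  push_cast
  ring

variable {f : PosRoot n → nMinus n} {m : Fin n → ℕ}

/-- The grading element takes a positive integer value on every positive root. Nonempty words thus
land in eigenspaces with eigenvalues `a - (k + 1)`, and these are independent of the `a`-eigenspace
containing `v`. -/
theorem IsHighestWeightVector.notMem_cyclicSpanPos {v : V} (hf : IsRootVectors f)
    (hv : IsHighestWeightVector m v) : v ∉ cyclicSpanPos n v := by
  set H : Module.End ℂ V := LieModule.toEnd ℂ (sp n) V (gradingElt n : sp n) with hH
  set a := domWeight m (gradingElt n)
  set G₀ : Submodule ℂ V := ⨆ k : ℕ, H.eigenspace (a - k)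
  set G : Submodule ℂ V := ⨆ k : ℕ, H.eigenspace (a - (k + 1))
  have hGG₀ : G ≤ G₀ := iSup_le fun k => by
    have := le_iSup (fun k : ℕ => H.eigenspace (a - k)) (k + 1)
    push_cast at this
    exact this
  have hfG : ∀ β, ∀ u ∈ G₀, ⁅f β, u⁆ ∈ G := by
    intro β u hu
    induction hu using Submodule.iSup_induction' with
    | mem k u hu =>
      obtain ⟨j, hj⟩ := toFunctional_gradingElt β
      refine Submodule.mem_iSup_of_mem (k + j) ?_
      rw [Module.End.mem_eigenspace_iff] at hu ⊢
      change ⁅(gradingElt n : sp n), u⁆ = _ at hu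
      change ⁅(gradingElt n : sp n), ⁅(f β : sp n), u⁆⁆ = _ • ⁅(f β : sp n), u⁆
      rw [leibniz_lie, (hf β).2, hj, smul_lie, hu, lie_smul, ← add_smul]
      congr 1
      push_cast
      ring
    | zero => simp
    | add x y _ _ hx hy =>
      rw [lie_add]
      exact add_mem hx hy
  have hyG : ∀ y : nMinus n, ∀ u ∈ G₀, ⁅y, u⁆ ∈ G := by
    intro y u hu
    have hy : y ∈ Submodule.span ℂ (Set.range f) := by
      rw [span_range_rootVectors hf]
      trivial
    induction hy using Submodule.span_induction with
    | mem y h =>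
      obtain ⟨β, rfl⟩ := h
      exact hfG β u hu
    | zero => simp
    | add x y _ _ hx hy =>
      rw [add_lie]
      exact add_mem hx hy
    | smul c x _ hx =>
      rw [smul_lie]
      exact Submodule.smul_mem _ _ hx
  have hvE : v ∈ H.eigenspace a := by
    rw [Module.End.mem_eigenspace_iff]
    exact hv.cartan_lie _
  have hw : ∀ l : List (nMinus n), wordAct l v ∈ G₀ := by
    intro l
    induction l with
    | nil => exact Submodule.mem_iSup_of_mem 0 (by simpa [wordAct_nil] using hvE)
    | cons y l ih => exact hGG₀ (hyG y _ ih)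
  have hle : cyclicSpanPos n v ≤ G := by
    refine Submodule.span_le.2 ?_
    rintro _ ⟨y, l, rfl⟩
    exact hyG y _ (hw l)
  intro hmem
  have hdis := (Module.End.eigenspaces_iSupIndep H) a
  have hG : G ≤ ⨆ (μ : ℂ) (_ : μ ≠ a), H.eigenspace μ := iSup_le fun k => by
    refine le_iSup₂_of_le (a - (k + 1)) ?_ le_rfl
    intro h
    have h' : (k : ℂ) + 1 = 0 := by linear_combination -h
    exact Nat.cast_add_one_ne_zero k h'
  exact hv.ne_zero ((Submodule.disjoint_def.1 hdis) v hvE (hG (hle hmem)))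

omit [LieModule ℂ (sp n) V] in
theorem exists_of_mem_cyclicSpan_prod {W : Type*} [AddCommGroup W] [Module ℂ W]
    [LieRingModule (sp n) W] [LieModule ℂ (sp n) W] {v : V} {w : W} {z : V × W}
    (hz : z ∈ cyclicSpan n (v, w)) :
    ∃ (c : ℂ), ∃ d₁ ∈ cyclicSpanPos n v, ∃ d₂ ∈ cyclicSpanPos n w,
      z.1 = c • v + d₁ ∧ z.2 = c • w + d₂ := by
  induction hz using Submodule.span_induction with
  | mem z h =>
    obtain ⟨l, rfl⟩ := h
    dsimp only
    rw [wordAct_prod]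
    cases l with
    | nil => exact ⟨1, 0, zero_mem _, 0, zero_mem _, by simp [wordAct], by simp [wordAct]⟩
    | cons y l =>
      exact ⟨0, _, Submodule.subset_span ⟨y, l, rfl⟩, _, Submodule.subset_span ⟨y, l, rfl⟩,
        by simp, by simp⟩
  | zero => exact ⟨0, 0, zero_mem _, 0, zero_mem _, by simp, by simp⟩
  | add x y _ _ hx hy =>
    obtain ⟨c, d₁, h₁, d₂, h₂, e₁, e₂⟩ := hx
    obtain ⟨c', d₁', h₁', d₂', h₂', e₁', e₂'⟩ := hy
    refine ⟨c + c', _, add_mem h₁ h₁', _, add_mem h₂ h₂', ?_, ?_⟩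
    · rw [Prod.fst_add, e₁, e₁', add_smul]
      abel
    · rw [Prod.snd_add, e₂, e₂', add_smul]
      abel
  | smul a x _ hx =>
    obtain ⟨c, d₁, h₁, d₂, h₂, e₁, e₂⟩ := hx
    refine ⟨a * c, _, Submodule.smul_mem _ a h₁, _, Submodule.smul_mem _ a h₂, ?_, ?_⟩
    · rw [Prod.smul_fst, e₁, smul_add, mul_smul]
    · rw [Prod.smul_snd, e₂, smul_add, mul_smul]

theorem herm_cyclicSpanPos {ι : Type} [Fintype ι] [DecidableEq ι] {v : TensorFun n ι}
    (hv : ∀ e : nPlus n, ⁅(e : sp n), v⁆ = 0) {d : TensorFun n ι} (hd : d ∈ cyclicSpanPos n v) :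
    herm v d = 0 := by
  induction hd using Submodule.span_induction with
  | mem d h =>
    obtain ⟨y, l, rfl⟩ := h
    exact herm_word_eq_zero hv y _
  | zero => exact herm_zero_right v
  | add x y _ _ hx hy => rw [herm_add_right, hx, hy, add_zero]
  | smul c x _ hx => rw [herm_smul_right, hx, mul_zero]

/-- The submodule generated by `(x, v)` in the product is the graph of the embedding. Irreducibility
of `V` controls one projection and the positive definite invariant form the other, so neither
complete reducibility nor a finite-dimensionality hypothesis on `V` is used. -/
theorem exists_embedding [LieModule.IsIrreducible ℂ (sp n) V] {ι : Type} [Fintype ι]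
    [DecidableEq ι] (hf : IsRootVectors f) {x : V} (hx : IsHighestWeightVector m x)
    {v : TensorFun n ι} (hv : IsHighestWeightVector m v) :
    ∃ θ : V →ₗ[ℂ] TensorFun n ι, Function.Injective θ ∧ θ x = v ∧
      ∀ (A : sp n) (a : V), θ ⁅A, a⁆ = ⁅A, θ a⁆ := by
  have hz : IsHighestWeightVector m (x, v) :=
    { ne_zero := fun h => hx.ne_zero (congrArg Prod.fst h)
      nPlus_lie := fun e => Prod.ext (hx.nPlus_lie e) (hv.nPlus_lie e)
      cartan_lie := fun H => Prod.ext (hx.cartan_lie H) (hv.cartan_lie H) }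
  set N := cyclicSpan n (x, v) with hN
  have hstab : ∀ (A : sp n) (z : V × TensorFun n ι), z ∈ N → ⁅A, z⁆ ∈ N := fun A z h =>
    hz.isBorelEigenvector.lie_mem_cyclicSpan A h
  have hxv : (x, v) ∈ N := Submodule.subset_span ⟨[], rfl⟩
  have hvv : herm v v ≠ 0 := fun h => hv.ne_zero (herm_self_eq_zero h)
  have hx' := hx.notMem_cyclicSpanPos hf
  -- Adjoints move letters off `wordAct l v` while preserving the shape `(0, b)`, down to the case
  -- of the empty word. Then `b` is orthogonal to the cyclic span of `v`, in which it lies itself.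
  have hinj₁ : ∀ b, (0, b) ∈ N → b = 0 := by
    have key : ∀ (l : List (nMinus n)) b, (0, b) ∈ N → herm (wordAct l v) b = 0 := by
      intro l
      induction l with
      | nil =>
        intro b hb
        obtain ⟨c, d₁, h₁, d₂, h₂, e₁, e₂⟩ := exists_of_mem_cyclicSpan_prod hb
        have hc : c = 0 := by
          by_contra hc
          refine hx' ?_
          have : x = -(c⁻¹ • d₁) := by
            rw [eq_neg_iff_add_eq_zero, ← smul_right_inj hc, smul_add, smul_smul,
              mul_inv_cancel₀ hc, one_smul, smul_zero]
            exact e₁.symm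
          have h3 := neg_mem (Submodule.smul_mem (cyclicSpanPos n x) c⁻¹ h₁)
          rwa [← this] at h3
        change b = _ at e₂
        rw [wordAct_nil, e₂, hc, zero_smul, zero_add, herm_cyclicSpanPos hv.nPlus_lie h₂]
      | cons y l ih =>
        intro b hb
        rw [wordAct_cons]
        change herm ⁅(y : sp n), wordAct l v⁆ b = 0
        rw [herm_lie]
        refine ih _ ?_
        have := hstab (spStar (y : sp n)) _ hb
        rwa [lie_prod, lie_zero] at this
    intro b hb
    have hb' : b ∈ cyclicSpan n v := by
      have hle : N ≤ (cyclicSpan n v).comap (LinearMap.snd ℂ V (TensorFun n ι)) := by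
        refine Submodule.span_le.2 ?_
        rintro _ ⟨l, rfl⟩
        dsimp only
        rw [wordAct_prod]
        exact Submodule.subset_span ⟨l, rfl⟩
      exact hle hb
    refine herm_self_eq_zero ?_
    have key' : ∀ b' ∈ cyclicSpan n v, herm b b' = 0 := by
      intro b' hb'
      induction hb' using Submodule.span_induction with
      | mem b' h =>
        obtain ⟨l, rfl⟩ := h
        rw [← star_herm, key l b hb, star_zero]
      | zero => exact herm_zero_right b
      | add x y _ _ hx hy => rw [herm_add_right, hx, hy, add_zero]
      | smul c x _ hx => rw [herm_smul_right, hx, mul_zero]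
    exact key' b hb'
  -- These `a` form a submodule of `V`. If it were everything, `(x, 0)` would belong to `N`; pairing
  -- its second component with `v` then puts `x` into the span of the nonempty words.
  have hinj₂ : ∀ a, (a, 0) ∈ N → a = 0 := by
    let K : LieSubmodule ℂ (sp n) V :=
      { toSubmodule := N.comap (LinearMap.inl ℂ V (TensorFun n ι))
        lie_mem := fun {A a} ha => by
          have := hstab A (a, 0) ha
          rwa [lie_prod, lie_zero] at this }
    have hK : K = ⊥ := by
      by_contra h
      have htop := (IsSimpleOrder.eq_bot_or_eq_top K).resolve_left h
      have hxK : x ∈ K := by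
        rw [htop]
        trivial
      obtain ⟨c, d₁, h₁, d₂, h₂, e₁, e₂⟩ := exists_of_mem_cyclicSpan_prod
        (show (x, (0 : TensorFun n ι)) ∈ N from hxK)
      have hc : c = 0 := by
        change 0 = _ at e₂
        have := congrArg (herm v) e₂
        rw [herm_zero_right, herm_add_right, herm_smul_right, herm_cyclicSpanPos hv.nPlus_lie h₂,
          add_zero] at this
        exact (mul_eq_zero.1 this.symm).resolve_right hvv
      change x = _ at e₁
      rw [hc, zero_smul, zero_add] at e₁
      rw [← e₁] at h₁
      exact hx' h₁
    intro a ha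
    have : a ∈ K := ha
    rwa [hK, LieSubmodule.mem_bot] at this
  have hsurj : ∀ a, ∃ b, (a, b) ∈ N := by
    let K : LieSubmodule ℂ (sp n) V :=
      { toSubmodule := N.map (LinearMap.fst ℂ V (TensorFun n ι))
        lie_mem := fun {A a} ha => by
          obtain ⟨z, hz, rfl⟩ := ha
          exact ⟨⁅A, z⁆, hstab A z hz, rfl⟩ }
    have hxK : x ∈ K := ⟨(x, v), hxv, rfl⟩
    have hK : K = ⊤ := by
      refine (IsSimpleOrder.eq_bot_or_eq_top K).resolve_left fun h => ?_
      rw [h, LieSubmodule.mem_bot] at hxK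
      exact hx.ne_zero hxK
    intro a
    have : a ∈ K := by
      rw [hK]
      trivial
    obtain ⟨z, hz, rfl⟩ := this
    exact ⟨z.2, hz⟩
  have huniq : ∀ a b b', (a, b) ∈ N → (a, b') ∈ N → b = b' := by
    intro a b b' h h'
    have := N.sub_mem h h'
    rw [Prod.mk_sub_mk, sub_self] at this
    exact sub_eq_zero.1 (hinj₁ _ this)
  choose θ hθ using hsurj
  refine ⟨{ toFun := θ, map_add' := fun a b => ?_, map_smul' := fun c a => ?_ }, ?_, ?_, ?_⟩
  · exact huniq _ _ _ (hθ _) (N.add_mem (hθ a) (hθ b))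
  · exact huniq _ _ _ (hθ _) (N.smul_mem c (hθ a))
  · intro a b hab
    change θ a = θ b at hab
    have := N.sub_mem (hθ a) (hθ b)
    rw [Prod.mk_sub_mk, hab, sub_self] at this
    exact sub_eq_zero.1 (hinj₂ _ this)
  · exact huniq _ _ _ (hθ x) hxv
  · intro A a
    exact huniq _ _ _ (hθ _) (hstab A _ (hθ a))

end Cyclic

/-! ### Powers of root vectors on a highest weight vector -/

section SlTwo

attribute [local instance 100] LieRing.ofAssociativeRing

variable {n : ℕ} {f : PosRoot n → nMinus n} {m : Fin n → ℕ}
variable {V : Type*} [AddCommGroup V] [Module ℂ V] [LieRingModule (sp n) V] [LieModule ℂ (sp n) V]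

/-- In a finite-dimensional module, a primitive vector of weight `N` for an `sl₂`-triple is killed
by the power `N + 1` of the lowering operator. -/
theorem pow_lie_eq_zero_of_triple [FiniteDimensional ℂ V] {v : V} (hv : IsHighestWeightVector m v)
    {y e : sp n} {H : cartan n} (he : e ∈ nPlus n) (h0 : (H : sp n) ≠ 0) (hef : ⁅e, y⁆ = H)
    (hHe : ⁅(H : sp n), e⁆ = (2 : ℂ) • e) (hHf : ⁅(H : sp n), y⁆ = -((2 : ℂ) • y)) {N : ℕ}
    (hN : domWeight m H = N) : (LieModule.toEnd ℂ (sp n) V y ^ (N + 1)) v = 0 := by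
  have t : IsSl2Triple (H : sp n) e y :=
    { h_ne_zero := h0
      lie_e_f := hef
      lie_h_e_nsmul := by rw [hHe, ofNat_smul_eq_nsmul]
      lie_h_f_nsmul := by rw [hHf, ofNat_smul_eq_nsmul] }
  have P : t.HasPrimitiveVectorWith v (N : ℂ) :=
    { ne_zero := hv.ne_zero
      lie_h := by rw [hv.cartan_lie, hN]
      lie_e := hv.nPlus_lie ⟨e, he⟩ }
  exact P.pow_toEnd_f_eq_zero_of_eq_nat rfl

theorem domWeight_cartanOf (d : Fin n → ℂ) :
    domWeight m (cartanOf d) = ∑ i, (m i : ℂ) * ∑ k ∈ Finset.Iic i, d k := by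
  simp only [domWeight, fundWeight, cartanOf_inl]

theorem sum_Iic_single (a i : Fin n) :
    ∑ k ∈ Finset.Iic i, (Pi.single a 1 : Fin n → ℂ) k = if a ≤ i then 1 else 0 := by
  rw [Finset.sum_pi_single']
  simp

/-- Root vectors are determined up to a scalar. -/
theorem IsRootVectors.eq_smul (hf : IsRootVectors f) (β : PosRoot n) (F : nMinus n)
    (h1 : F.1.1 β.tgt β.src = 1) (h2 : ∀ γ, γ ≠ β → F.1.1 γ.tgt γ.src = 0) :
    f β = ((f β).1.1 β.tgt β.src) • F := by
  rw [← sub_eq_zero]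
  refine eq_zero_of_root_entries fun γ => ?_
  change (f β).1.1 γ.tgt γ.src - (f β).1.1 β.tgt β.src * F.1.1 γ.tgt γ.src = 0
  by_cases h : γ = β
  · rw [h, h1, mul_one, sub_self]
  · rw [h2 γ h, hf.entry_eq_zero (Ne.symm h), mul_zero, sub_self]

theorem cartanOf_ne_zero {d : Fin n → ℂ} {i : Fin n} (h : d i ≠ 0) :
    (cartanOf d : sp n) ≠ 0 := by
  intro h0
  apply h
  rw [← cartanOf_inl d i, h0]
  rfl

/-- The coroot of the long root `2ε_a` is the coordinate element at `a`; it pairs to one with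
exactly the fundamental weights of index at least `a`. -/
theorem pow_lie_eq_zero_of_isBar [FiniteDimensional ℂ V] (hf : IsRootVectors f) {v : V}
    (hv : IsHighestWeightVector m v) {β : PosRoot n} (hβ : β.IsBar) :
    (LieModule.toEnd ℂ (sp n) V (f β : sp n) ^ (∑ k ∈ Finset.Ici β.row, m k + 1)) v = 0 := by
  have hb := β.bounds
  have hβ' : (β.row : ℕ) + β.col = 2 * n - 2 := hβ
  set a := β.row with ha
  have htgt : β.tgt = .inr a := pos_injective (by
    rw [β.pos_tgt]
    simp only [pos]
    omega)
  have hsrc : β.src = .inl a := rfl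
  let F : nMinus n := ⟨⟨Matrix.single (.inr a) (.inl a) 1, by
    rw [mem_sp_iff]
    simp [Matrix.single_apply, and_comm]⟩, fun p q h => by
      change Matrix.single (Sum.inr a) (Sum.inl a) (1 : ℂ) p q = 0
      rw [Matrix.single_apply, if_neg]
      rintro ⟨rfl, rfl⟩
      simp only [pos] at h
      omega⟩
  have hF : ∀ p q, F.1.1 p q = if Sum.inr a = p ∧ Sum.inl a = q then 1 else 0 := fun p q =>
    Matrix.single_apply _ _ _ _ _
  have hc := hf.entry_ne_zero β
  have hfF := hf.eq_smul β F (by rw [hF, htgt, hsrc, if_pos ⟨rfl, rfl⟩]) (fun γ hγ => by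
    rw [hF, if_neg]
    rintro ⟨h1, h2⟩
    refine hγ (PosRoot.ext ?_ ?_)
    · rw [← γ.pos_src, ← h2]
      rfl
    · have := congrArg pos (htgt.trans h1)
      rw [β.pos_tgt, γ.pos_tgt] at this
      omega)
  set c := (f β).1.1 β.tgt β.src
  let e₀ : sp n := ⟨Matrix.single (.inl a) (.inr a) 1, by
    rw [mem_sp_iff]
    simp [Matrix.single_apply, and_comm]⟩
  have he₀ : ∀ p q, e₀.1 p q = if Sum.inl a = p ∧ Sum.inr a = q then 1 else 0 := fun p q =>
    Matrix.single_apply _ _ _ _ _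
  have hH : ∀ p, (cartanOf (Pi.single a 1)).1.1 p p =
      if p = .inl a then 1 else if p = .inr a then -1 else 0 := by
    rintro (i | i)
    · rw [cartanOf_inl, Pi.single_apply]
      simp
    · rw [cartanOf_inr, Pi.single_apply]
      by_cases h : i = a <;> simp [h]
  -- The vector `f β` is `c` times a matrix unit; the factor `c⁻¹` on the raising side makes the
  -- bracket equal to the coroot.
  refine pow_lie_eq_zero_of_triple hv (e := c⁻¹ • e₀) (H := cartanOf (Pi.single a 1)) ?_
    (cartanOf_ne_zero (i := a) (by simp)) ?_ ?_ ?_ ?_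
  · intro p q h
    change c⁻¹ * e₀.1 p q = 0
    rw [he₀, if_neg, mul_zero]
    rintro ⟨rfl, rfl⟩
    simp only [pos] at h
    omega
  · rw [hfF]
    change ⁅c⁻¹ • e₀, c • (F : sp n)⁆ = _
    rw [lie_smul, smul_lie, smul_smul, mul_inv_cancel₀ hc, one_smul]
    refine Subtype.ext ?_
    change Matrix.single (Sum.inl a) (Sum.inr a) (1 : ℂ) * Matrix.single (Sum.inr a) (Sum.inl a) 1 -
      Matrix.single (Sum.inr a) (Sum.inl a) 1 * Matrix.single (Sum.inl a) (Sum.inr a) 1 = _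
    rw [Matrix.single_mul_single_same, Matrix.single_mul_single_same, one_mul]
    ext p q
    rw [Matrix.sub_apply, Matrix.single_apply, Matrix.single_apply]
    by_cases hpq : p = q
    · subst hpq
      refine Eq.trans ?_ (hH p).symm
      rcases p with i | i <;> by_cases h : i = a <;> simp [h, @eq_comm _ a i]
    · refine Eq.trans ?_ ((cartanOf (Pi.single a 1)).2 p q hpq).symm
      rw [if_neg (fun h => hpq (h.1.symm.trans h.2)), if_neg (fun h => hpq (h.1.symm.trans h.2)),
        sub_zero]
  · rw [lie_smul, smul_comm]
    congr 1
    ext p q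
    rw [cartan_lie_apply, hH, hH]
    change _ = 2 * e₀.1 p q
    rw [he₀]
    by_cases h : Sum.inl a = p ∧ Sum.inr a = q
    · obtain ⟨rfl, rfl⟩ := h
      simp only [if_true, reduceCtorEq, if_false]
      norm_num
    · rw [if_neg h]
      simp
  · rw [(hf β).2, toFunctional_eq, hH, hH, htgt, hsrc, ← neg_smul]
    congr 1
    simp only [if_true, reduceCtorEq, if_false]
    norm_num
  · rw [domWeight_cartanOf, Nat.cast_sum]
    simp_rw [sum_Iic_single, mul_ite, mul_one, mul_zero]
    rw [← Finset.sum_filter]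
    congr 1
    ext i
    simp

/-- The coroot of `ε_a - ε_b` with `b = col + 1` pairs to one with the fundamental weights `a ≤ i <
b` and to zero with the others. -/
theorem pow_lie_eq_zero_of_col_lt [FiniteDimensional ℂ V] (hf : IsRootVectors f) {v : V}
    (hv : IsHighestWeightVector m v) {β : PosRoot n} (hβ : (β.col : ℕ) + 1 < n) :
    (LieModule.toEnd ℂ (sp n) V (f β : sp n) ^
      (∑ k ∈ Finset.Icc β.row (letter β.col), m k + 1)) v = 0 := by
  have hb := β.bounds
  set a := β.row with ha
  set b : Fin n := ⟨β.col + 1, hβ⟩ with hbdef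
  have hab : a ≠ b := fun h => by
    have := congrArg Fin.val h
    simp only [hbdef] at this
    omega
  have hlt : a < b := by
    rw [Fin.lt_def]
    simp only [hbdef]
    omega
  have htgt : β.tgt = .inl b := pos_injective (by
    rw [β.pos_tgt]
    simp only [pos, hbdef])
  have hsrc : β.src = .inl a := rfl
  let F₀ : Matrix (Fin n ⊕ Fin n) (Fin n ⊕ Fin n) ℂ :=
    Matrix.single (.inl b) (.inl a) 1 - Matrix.single (.inr a) (.inr b) 1
  let E₀ : Matrix (Fin n ⊕ Fin n) (Fin n ⊕ Fin n) ℂ :=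
    Matrix.single (.inl a) (.inl b) 1 - Matrix.single (.inr b) (.inr a) 1
  have hF₀ : ∀ p q, F₀ p q = (if Sum.inl b = p ∧ Sum.inl a = q then 1 else 0) -
      (if Sum.inr a = p ∧ Sum.inr b = q then 1 else 0) := fun p q =>
    (Matrix.sub_apply _ _ _ _).trans (by rw [Matrix.single_apply, Matrix.single_apply])
  have hE₀ : ∀ p q, E₀ p q = (if Sum.inl a = p ∧ Sum.inl b = q then 1 else 0) -
      (if Sum.inr b = p ∧ Sum.inr a = q then 1 else 0) := fun p q =>
    (Matrix.sub_apply _ _ _ _).trans (by rw [Matrix.single_apply, Matrix.single_apply])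
  let F : nMinus n := ⟨⟨F₀, by
    rw [mem_sp_iff]
    simp [hF₀, and_comm]⟩, fun p q h => by
      change F₀ p q = 0
      rw [hF₀, if_neg, if_neg, sub_zero]
      · rintro ⟨rfl, rfl⟩
        simp only [pos] at h
        rw [Fin.lt_def] at hlt
        omega
      · rintro ⟨rfl, rfl⟩
        simp only [pos] at h
        rw [Fin.lt_def] at hlt
        omega⟩
  have hF : ∀ p q, F.1.1 p q = (if Sum.inl b = p ∧ Sum.inl a = q then 1 else 0) -
      (if Sum.inr a = p ∧ Sum.inr b = q then 1 else 0) := hF₀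
  have hc := hf.entry_ne_zero β
  have hfF := hf.eq_smul β F (by
    rw [hF, htgt, hsrc, if_pos ⟨rfl, rfl⟩, if_neg (by simp), sub_zero]) (fun γ hγ => by
    have hγs : γ.src = .inl γ.row := rfl
    rw [hF, if_neg, if_neg, sub_zero]
    · rw [hγs]
      simp
    · rintro ⟨h1, h2⟩
      refine hγ (PosRoot.ext ?_ ?_)
      · rw [← γ.pos_src, ← h2]
        rfl
      · have := congrArg pos (htgt.trans h1)
        rw [β.pos_tgt, γ.pos_tgt] at this
        omega)
  set c := (f β).1.1 β.tgt β.src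
  let e₀ : sp n := ⟨E₀, by
    rw [mem_sp_iff]
    simp [hE₀, and_comm]⟩
  have hH : ∀ p, (cartanOf (Pi.single a 1 - Pi.single b 1)).1.1 p p =
      (if p = .inl a then 1 else 0) - (if p = .inl b then 1 else 0) -
      ((if p = .inr a then 1 else 0) - (if p = .inr b then 1 else 0)) := by
    rintro (i | i)
    · rw [cartanOf_inl, Pi.sub_apply, Pi.single_apply, Pi.single_apply]
      simp
    · rw [cartanOf_inr, Pi.sub_apply, Pi.single_apply, Pi.single_apply]
      simp
  refine pow_lie_eq_zero_of_triple hv (e := c⁻¹ • e₀)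
    (H := cartanOf (Pi.single a 1 - Pi.single b 1)) ?_
    (cartanOf_ne_zero (i := a) (by simp [hab])) ?_ ?_ ?_ ?_
  · intro p q h
    change c⁻¹ * E₀ p q = 0
    rw [hE₀, if_neg, if_neg, sub_zero, mul_zero]
    · rintro ⟨rfl, rfl⟩
      simp only [pos] at h
      rw [Fin.lt_def] at hlt
      omega
    · rintro ⟨rfl, rfl⟩
      simp only [pos] at h
      rw [Fin.lt_def] at hlt
      omega
  · rw [hfF]
    change ⁅c⁻¹ • e₀, c • (F : sp n)⁆ = _
    rw [lie_smul, smul_lie, smul_smul, mul_inv_cancel₀ hc, one_smul]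
    refine Subtype.ext ?_
    change E₀ * F₀ - F₀ * E₀ = _
    have h1 : E₀ * F₀ = Matrix.single (.inl a) (.inl a) 1 + Matrix.single (.inr b) (.inr b) 1 := by
      simp only [E₀, F₀, sub_mul, mul_sub, Matrix.single_mul_single_same, mul_one]
      rw [Matrix.single_mul_single_of_ne _ _ _ _ (by simp),
        Matrix.single_mul_single_of_ne _ _ _ _ (by simp)]
      abel
    have h2 : F₀ * E₀ = Matrix.single (.inl b) (.inl b) 1 + Matrix.single (.inr a) (.inr a) 1 := by
      simp only [E₀, F₀, sub_mul, mul_sub, Matrix.single_mul_single_same, mul_one]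
      rw [Matrix.single_mul_single_of_ne _ _ _ _ (by simp),
        Matrix.single_mul_single_of_ne _ _ _ _ (by simp)]
      abel
    rw [h1, h2]
    ext p q
    rw [Matrix.sub_apply, Matrix.add_apply, Matrix.add_apply]
    simp only [Matrix.single_apply]
    by_cases hpq : p = q
    · subst hpq
      refine Eq.trans ?_ (hH p).symm
      simp only [and_self, eq_comm (b := p)]
      ring
    · refine Eq.trans ?_ ((cartanOf (Pi.single a 1 - Pi.single b 1)).2 p q hpq).symm
      have h : ∀ r : Fin n ⊕ Fin n, ¬(r = p ∧ r = q) := fun r h => hpq (h.1.symm.trans h.2)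
      simp [h]
  · rw [lie_smul, smul_comm]
    congr 1
    ext p q
    rw [cartan_lie_apply, hH, hH]
    change _ * E₀ p q = 2 * E₀ p q
    by_cases h : Sum.inl a = p ∧ Sum.inl b = q
    · obtain ⟨rfl, rfl⟩ := h
      simp only [Sum.inl.injEq, hab, hab.symm, if_true, reduceCtorEq, if_false]
      norm_num
    · by_cases h' : Sum.inr b = p ∧ Sum.inr a = q
      · obtain ⟨rfl, rfl⟩ := h'
        simp only [Sum.inr.injEq, hab, hab.symm, if_true, reduceCtorEq, if_false]
        norm_num
      · rw [hE₀, if_neg h, if_neg h']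
        simp
  · rw [(hf β).2, toFunctional_eq, hH, hH, htgt, hsrc, ← neg_smul]
    congr 1
    simp only [Sum.inl.injEq, hab, hab.symm, if_true, reduceCtorEq, if_false]
    norm_num
  · rw [domWeight_cartanOf, Nat.cast_sum]
    have h1 : ∀ i : Fin n, (m i : ℂ) *
        ∑ k ∈ Finset.Iic i, (Pi.single a 1 - Pi.single b 1 : Fin n → ℂ) k =
        if a ≤ i ∧ i < b then (m i : ℂ) else 0 := by
      intro i
      simp only [Pi.sub_apply, Finset.sum_sub_distrib]
      rw [sum_Iic_single, sum_Iic_single]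
      by_cases h1 : a ≤ i
      · by_cases h2 : b ≤ i
        · rw [if_pos h1, if_pos h2, if_neg (fun h => absurd h.2 (not_lt.2 h2))]
          simp
        · rw [if_pos h1, if_neg h2, if_pos ⟨h1, not_le.1 h2⟩]
          simp
      · rw [if_neg h1, if_neg (fun h => h1 (hlt.le.trans h)), if_neg (fun h => h1 h.1)]
        simp
    rw [Finset.sum_congr rfl fun i _ => h1 i, ← Finset.sum_filter]
    congr 1
    ext i
    simp only [Finset.mem_filter, Finset.mem_univ, true_and, Finset.mem_Icc, Fin.le_def,
      Fin.lt_def, letter, hbdef]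
    omega

theorem pow_lie_eq_zero_of_embedding {n : ℕ} {V W : Type*} [AddCommGroup V] [Module ℂ V]
    [LieRingModule (sp n) V] [LieModule ℂ (sp n) V] [AddCommGroup W] [Module ℂ W]
    [LieRingModule (sp n) W] [LieModule ℂ (sp n) W] {θ : V →ₗ[ℂ] W} (hθ : Function.Injective θ)
    (hA : ∀ (A : sp n) (a : V), θ ⁅A, a⁆ = ⁅A, θ a⁆) {y : sp n} {N : ℕ} {x : V}
    (h : (LieModule.toEnd ℂ (sp n) W y ^ N) (θ x) = 0) :
    (LieModule.toEnd ℂ (sp n) V y ^ N) x = 0 := by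
  apply hθ
  rw [map_zero, ← h]
  clear h
  induction N with
  | zero => rfl
  | succ N ih =>
    rw [pow_succ', pow_succ', Module.End.mul_apply, Module.End.mul_apply, ← ih]
    exact hA _ _

theorem ι_pow_smul_grVec_eq_zero {x : V} {y : nMinus n} {N : ℕ}
    (h : (LieModule.toEnd ℂ (sp n) V (y : sp n) ^ N) x = 0) :
    SymmetricAlgebra.ι ℂ (nMinus n) y ^ N • grVec ℂ (nMinus n) x = 0 := by
  have h1 : ((List.replicate N y).map (SymmetricAlgebra.ι ℂ (nMinus n))).prod =
      SymmetricAlgebra.ι ℂ (nMinus n) y ^ N := by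
    rw [List.map_replicate, List.prod_replicate]
  have h2 : ∀ N, wordAct (List.replicate N y) x =
      (LieModule.toEnd ℂ (sp n) V (y : sp n) ^ N) x := by
    intro N
    induction N with
    | zero => rfl
    | succ N ih =>
      rw [List.replicate_succ, wordAct_cons, ih, pow_succ', Module.End.mul_apply]
      rfl
  rw [← h1, prod_ι_smul_grVec]
  have h3 : ∀ hm, (⟨wordAct (List.replicate N y) x, hm⟩ :
      filtration ℂ (nMinus n) x (List.replicate N y).length) = 0 := fun hm =>
    Subtype.ext ((h2 N).trans h)
  rw [h3, map_zero, map_zero]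

/-- The space `R` kills the class of the highest weight vector of an irreducible module. -/
theorem relSpace_smul_grVec_eq_zero [LieModule.IsIrreducible ℂ (sp n) V] (hf : IsRootVectors f)
    {x : V} (hx : IsHighestWeightVector m x) {r : SymMinus n} (hr : r ∈ relSpace f m) :
    r • grVec ℂ (nMinus n) x = 0 := by
  -- The `sl₂` argument needs finite dimension, so it takes place in the tensor power and is pulled
  -- back along `θ`.
  obtain ⟨θ, hθ, hθx, hA⟩ := exists_embedding hf hx (highestVec_isHighestWeightVector (m := m))
  induction hr using Submodule.span_induction with
  | mem r h =>
    rcases h with ⟨β, hβ, rfl⟩ | ⟨β, hβ, rfl⟩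
    · refine ι_pow_smul_grVec_eq_zero (pow_lie_eq_zero_of_embedding hθ hA ?_)
      rw [hθx]
      exact pow_lie_eq_zero_of_col_lt hf highestVec_isHighestWeightVector hβ
    · refine ι_pow_smul_grVec_eq_zero (pow_lie_eq_zero_of_embedding hθ hA ?_)
      rw [hθx]
      exact pow_lie_eq_zero_of_isBar hf highestVec_isHighestWeightVector hβ
  | zero => exact zero_smul _ _
  | add p q _ _ hp hq => rw [add_smul, hp, hq, add_zero]
  | smul c p _ hp => rw [smul_assoc, hp, smul_zero]

theorem relIdeal_le_torsionOf_grVec [LieModule.IsIrreducible ℂ (sp n) V] (hf : IsRootVectors f)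
    {x : V} (hx : IsHighestWeightVector m x) :
    relIdeal f m ≤ Ideal.torsionOf (SymMinus n) (Gr ℂ (nMinus n) x) (grVec ℂ (nMinus n) x) :=
  relIdeal_le_torsionOf f m (raise hx.isBorelEigenvector)
    (fun e y a => raise_ι_smul hx.isBorelEigenvector e y a) _
    (fun e => raise_grVec hx.isBorelEigenvector e (hx.nPlus_lie e))
    fun _ hr => relSpace_smul_grVec_eq_zero hf hx hr

end SlTwo

/-! ### Evaluation of words of root vectors at a multi-index -/

section WordEvaluation

attribute [local instance 100] LieRing.ofAssociativeRing

variable {n : ℕ} {ι : Type} [Fintype ι] [DecidableEq ι]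

/-- The positions where two multi-indices differ. -/
def diffSet (p q : ι → Fin n ⊕ Fin n) : Finset ι := Finset.univ.filter fun b => p b ≠ q b

omit [DecidableEq ι] in
theorem mem_diffSet {p q : ι → Fin n ⊕ Fin n} {b : ι} : b ∈ diffSet p q ↔ p b ≠ q b := by
  simp [diffSet]

theorem erase_diffSet_subset (p q : ι → Fin n ⊕ Fin n) (b : ι) (x : Fin n ⊕ Fin n) :
    (diffSet p q).erase b ⊆ diffSet (Function.update p b x) q := by
  intro c hc
  rw [Finset.mem_erase, mem_diffSet] at hc
  rw [mem_diffSet, Function.update_of_ne hc.1]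
  exact hc.2

theorem diffSet_update_eq (p q : ι → Fin n ⊕ Fin n) (b : ι) :
    diffSet (Function.update p b (q b)) q = (diffSet p q).erase b := by
  refine Finset.Subset.antisymm (fun c hc => ?_) (erase_diffSet_subset p q b _)
  rw [mem_diffSet] at hc
  rw [Finset.mem_erase, mem_diffSet]
  by_cases h : c = b
  · subst h
    simp at hc
  · rw [Function.update_of_ne h] at hc
    exact ⟨h, hc⟩

theorem card_diffSet_le (p q : ι → Fin n ⊕ Fin n) (b : ι) (x : Fin n ⊕ Fin n) :
    (diffSet p q).card ≤ (diffSet (Function.update p b x) q).card + 1 := by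
  have h1 := Finset.card_le_card (erase_diffSet_subset p q b x)
  have h2 := Finset.pred_card_le_card_erase (s := diffSet p q) (a := b)
  omega

theorem card_diffSet_update_of_ne (p q : ι → Fin n ⊕ Fin n) {b : ι} {x : Fin n ⊕ Fin n}
    (h : x ≠ q b ∨ p b = q b) :
    (diffSet p q).card ≤ (diffSet (Function.update p b x) q).card := by
  refine Finset.card_le_card fun c hc => ?_
  by_cases hcb : c = b
  · subst hcb
    rw [mem_diffSet] at hc ⊢
    rw [Function.update_self]
    exact h.resolve_right hc
  · exact erase_diffSet_subset p q b x (Finset.mem_erase.2 ⟨hcb, hc⟩)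

/-- The indicator function of a multi-index. -/
def deltaFun (q : ι → Fin n ⊕ Fin n) : TensorFun n ι := fun p => if p = q then 1 else 0

/-- Each letter changes at most one coordinate, so a word shorter than the Hamming distance cannot
connect `q` with `p`. -/
theorem wordAct_deltaFun_eq_zero (q : ι → Fin n ⊕ Fin n) (l : List (nMinus n)) :
    ∀ p : ι → Fin n ⊕ Fin n, l.length < (diffSet p q).card → wordAct l (deltaFun q) p = 0 := by
  induction l with
  | nil =>
    intro p hp
    rw [wordAct_nil, deltaFun, if_neg]
    rintro rfl
    simp [diffSet] at hp
  | cons y l ih =>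
    intro p hp
    rw [wordAct_cons, nMinus_lie_tensorFun, tensorMap_apply]
    refine Finset.sum_eq_zero fun b _ => Finset.sum_eq_zero fun x _ => ?_
    have := card_diffSet_le p q b x
    rw [List.length_cons] at hp
    rw [ih _ (by omega), mul_zero]

/-- At the critical length no letter may be wasted: each has to move a differing coordinate directly
to its final value. -/
theorem wordAct_cons_deltaFun (q : ι → Fin n ⊕ Fin n) (y : nMinus n) (l : List (nMinus n))
    (p : ι → Fin n ⊕ Fin n) (h : l.length + 1 = (diffSet p q).card) :
    wordAct (y :: l) (deltaFun q) p = ∑ b ∈ diffSet p q,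
      y.1.1 (p b) (q b) * wordAct l (deltaFun q) (Function.update p b (q b)) := by
  rw [wordAct_cons, nMinus_lie_tensorFun, tensorMap_apply,
    ← Finset.sum_subset (Finset.subset_univ (diffSet p q))]
  · refine Finset.sum_congr rfl fun b _ => Finset.sum_eq_single _ (fun x _ hx => ?_) (by simp)
    have := card_diffSet_update_of_ne p q (b := b) (.inl hx)
    rw [wordAct_deltaFun_eq_zero q l _ (by omega), mul_zero]
  · intro b _ hb
    rw [mem_diffSet, not_not] at hb
    refine Finset.sum_eq_zero fun x _ => ?_
    have := card_diffSet_update_of_ne p q (x := x) (.inr hb)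
    rw [wordAct_deltaFun_eq_zero q l _ (by omega), mul_zero]

/-- The exponent of the root whose root vectors have a nonzero entry at `(x, z)`. -/
def entryExp (x z : Fin n ⊕ Fin n) : PosRoot n → ℕ :=
  if h : pos z < pos x then Pi.single (rootOf x z h) 1 else 0

theorem entryExp_self (x : Fin n ⊕ Fin n) : entryExp x x = 0 := dif_neg (lt_irrefl _)

theorem sum_entryExp {x z : Fin n ⊕ Fin n} (h : pos z < pos x) : ∑ β, entryExp x z β = 1 := by
  rw [entryExp, dif_pos h]
  simp

/-- The exponent of the shortest words leading from `q` to `p`. -/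
def totalExp (p q : ι → Fin n ⊕ Fin n) : PosRoot n → ℕ := ∑ b, entryExp (p b) (q b)

theorem totalExp_update (p q : ι → Fin n ⊕ Fin n) (b : ι) :
    totalExp p q = entryExp (p b) (q b) + totalExp (Function.update p b (q b)) q := by
  rw [totalExp, totalExp, ← Finset.add_sum_erase _ _ (Finset.mem_univ b),
    ← Finset.add_sum_erase (a := b) _ (fun c => entryExp (Function.update p b (q b) c) (q c))
    (Finset.mem_univ b), Function.update_self, entryExp_self, zero_add]
  congr 1
  refine Finset.sum_congr rfl fun c hc => ?_
  rw [Function.update_of_ne (Finset.ne_of_mem_erase hc)]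

omit [DecidableEq ι] in
theorem sum_totalExp {p q : ι → Fin n ⊕ Fin n} (h : ∀ b, p b ≠ q b → pos (q b) < pos (p b)) :
    ∑ β, totalExp p q β = (diffSet p q).card := by
  simp only [totalExp, Finset.sum_apply]
  rw [Finset.sum_comm, diffSet, Finset.card_filter]
  refine Finset.sum_congr rfl fun b _ => ?_
  by_cases hb : p b = q b
  · rw [hb, entryExp_self, if_neg (by simp)]
    simp
  · rw [if_pos hb, sum_entryExp (h b hb)]

variable {f : PosRoot n → nMinus n}

/-- At critical length each differing coordinate uses exactly one letter, namely the only root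
vector with a nonzero entry there. So the content of the word is forced. -/
theorem content_eq_totalExp (hf : IsRootVectors f) (q : ι → Fin n ⊕ Fin n) (l : List (PosRoot n)) :
    ∀ p : ι → Fin n ⊕ Fin n, l.length = (diffSet p q).card →
      wordAct (l.map f) (deltaFun q) p ≠ 0 → content l = totalExp p q := by
  induction l with
  | nil =>
    intro p hp h
    have hpq : p = q := by
      by_contra h'
      exact h (if_neg h')
    rw [hpq]
    have : totalExp q q = 0 := Finset.sum_eq_zero fun b _ => entryExp_self _
    rw [this]
    rfl
  | cons β l ih =>
    intro p hp h
    rw [List.map_cons, wordAct_cons_deltaFun q _ _ p (by simpa using hp)] at h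
    obtain ⟨b, hb, hne⟩ := Finset.exists_ne_zero_of_sum_ne_zero h
    have h1 := left_ne_zero_of_mul hne
    have h2 := right_ne_zero_of_mul hne
    have hlt : pos (q b) < pos (p b) := by
      by_contra hc
      exact h1 ((f β).2 _ _ (not_lt.1 hc))
    rw [content_cons, ih _ _ h2, totalExp_update p q b, entryExp, dif_pos hlt,
      hf.eq_rootOf hlt h1]
    rw [diffSet_update_eq, Finset.card_erase_of_mem hb, ← hp]
    rfl

/-- The product of the entries of root vectors leading from `q` to `p`. -/
def entryProd (f : PosRoot n → nMinus n) (p q : ι → Fin n ⊕ Fin n) : ℂ :=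
  ∏ b, if h : pos (q b) < pos (p b) then (f (rootOf (p b) (q b) h)).1.1 (p b) (q b) else 1

omit [DecidableEq ι] in
theorem entryProd_ne_zero (hf : IsRootVectors f) (p q : ι → Fin n ⊕ Fin n) :
    entryProd f p q ≠ 0 := by
  refine Finset.prod_ne_zero_iff.2 fun b _ => ?_
  split_ifs with h
  · exact (hf.entry_ne_zero_iff h).2 rfl
  · exact one_ne_zero

theorem entryProd_update (p q : ι → Fin n ⊕ Fin n) (b : ι) (h : pos (q b) < pos (p b)) :
    entryProd f p q = (f (rootOf (p b) (q b) h)).1.1 (p b) (q b) *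
      entryProd f (Function.update p b (q b)) q := by
  rw [entryProd, entryProd, ← Finset.mul_prod_erase _ _ (Finset.mem_univ b), dif_pos h,
    ← Finset.mul_prod_erase (a := b) Finset.univ (fun c =>
      if h : pos (q c) < pos (Function.update p b (q b) c) then
        (f (rootOf (Function.update p b (q b) c) (q c) h)).1.1 (Function.update p b (q b) c) (q c)
        else 1) (Finset.mem_univ b)]
  rw [dif_neg (by simp), one_mul]
  congr 1
  refine Finset.prod_congr rfl fun c hc => ?_
  rw [Function.update_of_ne (Finset.ne_of_mem_erase hc)]

/-- All ways of assigning the letters to the coordinates contribute the same product of entries, and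
`N` counts these ways. Hence there is no cancellation. -/
theorem exists_wordAct_eq (hf : IsRootVectors f) (q : ι → Fin n ⊕ Fin n) (l : List (PosRoot n)) :
    ∀ p : ι → Fin n ⊕ Fin n, (∀ b, p b ≠ q b → pos (q b) < pos (p b)) →
      content l = totalExp p q →
      ∃ N : ℕ, 0 < N ∧ wordAct (l.map f) (deltaFun q) p = N * entryProd f p q := by
  induction l with
  | nil =>
    intro p hp h
    have h1 := sum_totalExp hp
    rw [← h, sum_content, List.length_nil, eq_comm, Finset.card_eq_zero] at h1
    have hpq : p = q := by
      funext b
      by_contra hb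
      have := mem_diffSet.2 hb
      simp [h1] at this
    subst hpq
    refine ⟨1, one_pos, ?_⟩
    rw [List.map_nil, wordAct_nil, deltaFun, if_pos rfl, entryProd, Finset.prod_eq_one]
    · simp
    · intro b _
      simp
  | cons β l ih =>
    intro p hp h
    have h1 := sum_totalExp hp
    rw [← h, sum_content, List.length_cons] at h1
    have hp' : ∀ b, ∀ c, Function.update p b (q b) c ≠ q c →
        pos (q c) < pos (Function.update p b (q b) c) := by
      intro b c hc
      by_cases hcb : c = b
      · subst hcb
        simp at hc
      · rw [Function.update_of_ne hcb] at hc ⊢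
        exact hp c hc
    -- The coordinates that the first letter `β` can correct.
    set B : Finset ι := (diffSet p q).filter fun b => entryExp (p b) (q b) = Pi.single β 1 with hB
    have hstep : ∀ b ∈ B, ∃ N : ℕ, 0 < N ∧
        (f β).1.1 (p b) (q b) * wordAct (l.map f) (deltaFun q) (Function.update p b (q b)) =
          N * entryProd f p q := by
      intro b hb
      rw [hB, Finset.mem_filter, mem_diffSet] at hb
      have hlt := hp b hb.1
      obtain ⟨N, hN, e⟩ := ih (Function.update p b (q b)) (hp' b) (by
        rw [content_cons, totalExp_update p q b, hb.2] at h
        exact add_left_cancel h)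
      refine ⟨N, hN, ?_⟩
      have hβ : β = rootOf (p b) (q b) hlt := by
        have := congrFun hb.2 β
        rw [entryExp, dif_pos hlt, Pi.single_eq_same, Pi.single_apply] at this
        by_contra hc
        rw [if_neg hc] at this
        exact zero_ne_one this
      rw [e, entryProd_update p q b hlt, hβ]
      ring
    have hsum : wordAct ((β :: l).map f) (deltaFun q) p = ∑ b ∈ B,
        (f β).1.1 (p b) (q b) * wordAct (l.map f) (deltaFun q) (Function.update p b (q b)) := by
      rw [List.map_cons, wordAct_cons_deltaFun q _ _ p (by simpa using h1)]
      refine (Finset.sum_subset (Finset.filter_subset _ _) fun b hb hb' => ?_).symm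
      have hlt := hp b (mem_diffSet.1 hb)
      have h0 : (f β).1.1 (p b) (q b) = 0 := by
        by_contra h0
        refine hb' (Finset.mem_filter.2 ⟨hb, ?_⟩)
        rw [entryExp, dif_pos hlt, ← hf.eq_rootOf hlt h0]
      rw [h0, zero_mul]
    have hBne : B.Nonempty := by
      have h2 : totalExp p q β ≠ 0 := by
        rw [← h, content_cons, Pi.add_apply, Pi.single_eq_same]
        omega
      rw [totalExp, Finset.sum_apply] at h2
      obtain ⟨b, -, hb⟩ := Finset.exists_ne_zero_of_sum_ne_zero h2
      refine ⟨b, Finset.mem_filter.2 ⟨mem_diffSet.2 fun hpq => ?_, ?_⟩⟩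
      · rw [hpq, entryExp_self] at hb
        exact hb rfl
      · by_cases hlt : pos (q b) < pos (p b)
        · rw [entryExp, dif_pos hlt, Pi.single_apply] at hb
          rw [entryExp, dif_pos hlt]
          by_cases he : β = rootOf (p b) (q b) hlt
          · rw [← he]
          · rw [if_neg he] at hb
            exact absurd rfl hb
        · rw [entryExp, dif_neg hlt] at hb
          exact absurd rfl hb
    choose! N hN e using hstep
    refine ⟨∑ b ∈ B, N b, Finset.sum_pos hN hBne, ?_⟩
    rw [hsum, Finset.sum_congr rfl e, Nat.cast_sum, Finset.sum_mul]

/-! ### Linear expansion of words -/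

theorem wordAct_sum {L M α : Type*} [LieRing L] [AddCommGroup M] [Module ℂ M] [LieAlgebra ℂ L]
    [LieRingModule L M] [LieModule ℂ L M] (l : List L) (s : Finset α) (c : α → ℂ) (g : α → M) :
    wordAct l (∑ a ∈ s, c a • g a) = ∑ a ∈ s, c a • wordAct l (g a) := by
  induction l with
  | nil => rfl
  | cons y l ih => simp only [wordAct_cons, ih, lie_sum, lie_smul]

/-- Evaluation at a multi-index. -/
def evalAt (p : ι → Fin n ⊕ Fin n) : TensorFun n ι →ₗ[ℂ] ℂ :=
  (LinearMap.proj p : ((ι → Fin n ⊕ Fin n) → ℂ) →ₗ[ℂ] ℂ)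

omit [Fintype ι] [DecidableEq ι] in
theorem evalAt_apply (p : ι → Fin n ⊕ Fin n) (φ : TensorFun n ι) : evalAt p φ = φ p := rfl

theorem eq_sum_deltaFun (φ : TensorFun n ι) : φ = ∑ q, evalAt q φ • deltaFun q := by
  funext p
  change evalAt p φ = evalAt p (∑ q, evalAt q φ • deltaFun q)
  rw [map_sum, Finset.sum_eq_single p]
  · rw [map_smul, evalAt_apply p (deltaFun p), deltaFun, if_pos rfl, smul_eq_mul, mul_one]
  · intro q _ hq
    rw [map_smul, evalAt_apply p (deltaFun q), deltaFun, if_neg hq.symm, smul_zero]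
  · intro h
    exact absurd (Finset.mem_univ _) h

theorem wordAct_apply_eq_sum (l : List (nMinus n)) (φ : TensorFun n ι) (p : ι → Fin n ⊕ Fin n) :
    wordAct l φ p = ∑ q, φ q * wordAct l (deltaFun q) p := by
  have h : wordAct l φ = ∑ q, evalAt q φ • wordAct l (deltaFun q) := by
    rw [← wordAct_sum, ← eq_sum_deltaFun]
  exact (congrArg (evalAt p) h).trans (map_sum (evalAt p) _ _)

end WordEvaluation

/-! ### The multi-index attached to a family of antichains -/

section Point

variable {n : ℕ}

theorem rootOf_tgt_src (β : PosRoot n) : rootOf β.tgt β.src β.pos_src_lt = β :=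
  PosRoot.eq_of_toFunctional_eq fun H => by rw [toFunctional_rootOf, toFunctional_eq]

theorem entryExp_tgt (β : PosRoot n) : entryExp β.tgt (.inl β.row) = Pi.single β 1 :=
  (dif_pos β.pos_src_lt).trans (congrArg (fun γ => Pi.single γ 1) (rootOf_tgt_src β))

open Classical in
/-- The entry in row `k` of the column attached to a set of roots. -/
def hookPoint (B : Finset (PosRoot n)) (k : Fin n) : Fin n ⊕ Fin n :=
  if h : ∃ β ∈ B, β.row = k then h.choose.tgt else .inl k

variable {i : Fin n} {B : Finset (PosRoot n)}

theorem IsAntichainAt.eq_of_row_eq (hB : IsAntichainAt i B) {β γ : PosRoot n} (hβ : β ∈ B)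
    (hγ : γ ∈ B) (h : β.row = γ.row) : β = γ := by
  rcases le_total β.col γ.col with hc | hc
  · exact hB.2 β hβ γ hγ ⟨h ▸ le_rfl, hc⟩
  · exact (hB.2 γ hγ β hβ ⟨h ▸ le_rfl, hc⟩).symm

theorem IsAntichainAt.hookPoint_row (hB : IsAntichainAt i B) {β : PosRoot n} (hβ : β ∈ B) :
    hookPoint B β.row = β.tgt := by
  have h : ∃ γ ∈ B, γ.row = β.row := ⟨β, hβ, rfl⟩
  rw [hookPoint, dif_pos h, hB.eq_of_row_eq h.choose_spec.1 hβ h.choose_spec.2]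

theorem hookPoint_of_notMem {k : Fin n} (h : ¬∃ β ∈ B, β.row = k) : hookPoint B k = .inl k :=
  dif_neg h

theorem IsAntichainAt.lt_pos_tgt (hB : IsAntichainAt i B) {β : PosRoot n} (hβ : β ∈ B) :
    (i : ℕ) < pos β.tgt := by
  rw [β.pos_tgt]
  exact Nat.lt_succ_of_le (hB.1 β hβ).2

theorem IsAntichainAt.sum_entryExp (hB : IsAntichainAt i B) :
    ∑ k : {k : Fin n // k ≤ i}, entryExp (hookPoint B k.1) (.inl k.1) =
      ∑ β ∈ B, Pi.single β 1 := by
  classical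
  symm
  rw [← Finset.sum_subset (Finset.subset_univ
    (Finset.univ.filter fun k : {k : Fin n // k ≤ i} => ∃ β ∈ B, β.row = k.1))]
  · refine Finset.sum_bij (fun β hβ => ⟨β.row, (hB.1 β hβ).1⟩) ?_ ?_ ?_ ?_
    · intro β hβ
      exact Finset.mem_filter.2 ⟨Finset.mem_univ _, β, hβ, rfl⟩
    · intro β hβ γ hγ h
      exact hB.eq_of_row_eq hβ hγ (congrArg Subtype.val h)
    · intro k hk
      obtain ⟨β, hβ, h⟩ := (Finset.mem_filter.1 hk).2
      exact ⟨β, hβ, Subtype.ext h⟩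
    · intro β hβ
      rw [hB.hookPoint_row hβ]
      exact (entryExp_tgt β).symm
  · intro k _ hk
    rw [hookPoint_of_notMem (fun h => hk (Finset.mem_filter.2 ⟨Finset.mem_univ _, h⟩)),
      entryExp_self]

/-- Along an antichain columns decrease as rows increase. Let `r` be the first row that `σ` moves.
The larger row sent to `r` produces a root in row `r` with a smaller column than any root of `B` in
that row, hence one earlier than everything in the unpermuted exponent on the moved rows. -/
theorem IsAntichainAt.lex_lt (hB : IsAntichainAt i B) {σ : Equiv.Perm {k : Fin n // k ≤ i}}
    (hσ : σ ≠ 1) (hfix : ∀ k : {k : Fin n // k ≤ i}, (¬∃ β ∈ B, β.row = k.1) → σ k = k) :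
    toLex (∑ k : {k : Fin n // k ≤ i}, entryExp (hookPoint B k.1) (.inl k.1)) <
      toLex (∑ k : {k : Fin n // k ≤ i}, entryExp (hookPoint B k.1) (.inl (σ k).1)) := by
  classical
  set K : Finset {k : Fin n // k ≤ i} := Finset.univ.filter fun k => σ k ≠ k with hK
  have hKne : K.Nonempty := by
    by_contra h
    rw [Finset.not_nonempty_iff_eq_empty] at h
    refine hσ (Equiv.ext fun k => ?_)
    by_contra hk
    have : k ∈ K := by simpa [hK] using hk
    simp [h] at this
  obtain ⟨r, hr, hmin⟩ := K.exists_min_image id hKne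
  have hrσ : σ r ≠ r := (Finset.mem_filter.1 hr).2
  set k₀ := σ.symm r with hk₀
  have hσk₀ : σ k₀ = r := σ.apply_symm_apply r
  have hk₀r : k₀ ≠ r := fun h => hrσ (by rw [← h, hσk₀, h])
  have hk₀K : k₀ ∈ K := Finset.mem_filter.2 ⟨Finset.mem_univ _, by rw [hσk₀]; exact hk₀r.symm⟩
  have hlt : r < k₀ := lt_of_le_of_ne (hmin k₀ hk₀K) hk₀r.symm
  have hrow : ∀ k ∈ K, ∃ β ∈ B, β.row = k.1 := fun k hk => by
    by_contra h
    exact (Finset.mem_filter.1 hk).2 (hfix k h)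
  obtain ⟨β, hβ, hβk⟩ := hrow k₀ hk₀K
  have hb := β.bounds
  have hlt' : (r.1 : ℕ) < β.row := by
    rw [hβk]
    exact hlt
  -- The new root: its source is `r` and its target is that of the antichain root in row `σ⁻¹ r`.
  set γ : PosRoot n := ⟨(r.1, β.col), by change (r.1 : ℕ) ≤ β.col; omega,
    by change (r.1 : ℕ) + β.col ≤ _; omega⟩ with hγ
  have hsplit : ∀ g : {k : Fin n // k ≤ i} → PosRoot n → ℕ,
      ∑ k, g k = ∑ k ∈ Kᶜ, g k + ∑ k ∈ K, g k := fun g =>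
    (Finset.sum_compl_add_sum K g).symm
  rw [hsplit, hsplit fun k => entryExp (hookPoint B k.1) (.inl (σ k).1)]
  have hfixed : ∑ k ∈ Kᶜ, entryExp (hookPoint B k.1) (.inl (σ k).1) =
      ∑ k ∈ Kᶜ, entryExp (hookPoint B k.1) (.inl k.1) := by
    refine Finset.sum_congr rfl fun k hk => ?_
    have : σ k = k := by simpa [hK] using hk
    rw [this]
  rw [hfixed]
  suffices h : toLex (∑ k ∈ K, entryExp (hookPoint B k.1) (.inl k.1)) <
      toLex (∑ k ∈ K, entryExp (hookPoint B k.1) (.inl (σ k).1)) from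
    add_lt_add_right (α := Lex (PosRoot n → ℕ)) h _
  refine lex_lt_of_vanish γ ?_ ?_
  · intro δ hδ
    rw [Finset.sum_apply]
    refine Finset.sum_eq_zero fun k hk => ?_
    obtain ⟨ε, hε, hεk⟩ := hrow k hk
    rw [← hεk, hB.hookPoint_row hε, entryExp_tgt, Pi.single_apply, if_neg]
    rintro rfl
    have hk' : (r.1 : ℕ) ≤ δ.row := by
      rw [hεk]
      exact hmin k hk
    rw [PosRoot.le_iff] at hδ
    change (δ.row : ℕ) < r.1 ∨ (δ.row : ℕ) = r.1 ∧ (δ.col : ℕ) ≤ β.col at hδ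
    have := hB.2 δ hε β hβ ⟨by omega, by omega⟩
    subst this
    omega
  · rw [Finset.sum_apply]
    refine (Finset.sum_pos' (fun _ _ => Nat.zero_le _) ⟨k₀, hk₀K, ?_⟩).ne'
    rw [hσk₀, ← hβk, hB.hookPoint_row hβ]
    have e1 : β.tgt = γ.tgt := pos_injective (by
      rw [β.pos_tgt, γ.pos_tgt]
      rfl)
    have e2 := congrFun (entryExp_tgt γ) γ
    rw [Pi.single_eq_same] at e2
    rw [e1]
    exact e2.symm ▸ one_pos

variable {m : Fin n → ℕ} {s : PosRoot n → ℕ} {f : PosRoot n → nMinus n}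

theorem exists_perm_of_highestVec_ne_zero {q : YBox m → Fin n ⊕ Fin n} (h : highestVec m q ≠ 0)
    (c : YCol m) :
    ∃ σ : Equiv.Perm {k : Fin n // k ≤ c.1}, ∀ k, q ⟨c, k⟩ = .inl (σ k).1 := by
  have h1 := Finset.prod_ne_zero_iff.1 h c (Finset.mem_univ c)
  rw [Matrix.det_apply] at h1
  obtain ⟨σ, -, hσ⟩ := Finset.exists_ne_zero_of_sum_ne_zero h1
  refine ⟨σ, fun k => ?_⟩
  by_contra hk
  refine hσ ?_
  rw [Finset.prod_eq_zero (Finset.mem_univ k), smul_zero]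
  exact if_neg hk

theorem highestVec_inl : highestVec m (fun b => .inl b.2.1) = 1 := by
  refine Finset.prod_eq_one fun c _ => ?_
  have : colMatrix (fun b : YBox m => .inl b.2.1) c = 1 := by
    ext l k
    simp [colMatrix, Matrix.one_apply, Subtype.ext_iff, eq_comm]
  rw [this, Matrix.det_one]

/-- The multi-index attached to a family of antichains. -/
def boxPoint (m : Fin n → ℕ) (A : Fin n → ℕ → Finset (PosRoot n)) (b : YBox m) : Fin n ⊕ Fin n :=
  hookPoint (A b.1.1 b.1.2) b.2.1

variable {A : Fin n → ℕ → Finset (PosRoot n)}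

theorem IsAntichainSum.totalExp_boxPoint (hA : IsAntichainSum m s A) :
    totalExp (boxPoint m A) (fun b => .inl b.2.1) = s := by
  rw [totalExp, Fintype.sum_sigma]
  have h : ∀ c : YCol m, ∑ k : {k : Fin n // k ≤ c.1},
      entryExp (boxPoint m A ⟨c, k⟩) (.inl k.1) = ∑ β ∈ A c.1 c.2, Pi.single β 1 := fun c =>
    (hA.1 c.1 c.2).sum_entryExp
  rw [Finset.sum_congr rfl fun c _ => h c, Fintype.sum_sigma]
  funext β
  rw [hA.2 β, Finset.sum_apply]
  refine Finset.sum_congr rfl fun i _ => ?_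
  rw [Finset.sum_apply, Finset.sum_range]
  refine Finset.sum_congr rfl fun k _ => ?_
  rw [Finset.sum_apply]
  simp [Pi.single_apply]

/-- The moved coordinates have positions beyond `i`, whereas a multi-index in the support of the
highest weight vector only permutes the letters up to `i` in that column. It therefore differs from
the point there as well. -/
theorem IsAntichainSum.diffSet_subset (hA : IsAntichainSum m s A) {q : YBox m → Fin n ⊕ Fin n}
    (hq : highestVec m q ≠ 0) :
    diffSet (boxPoint m A) (fun b => .inl b.2.1) ⊆ diffSet (boxPoint m A) q := by
  intro b hb
  rw [mem_diffSet] at hb ⊢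
  obtain ⟨c, k⟩ := b
  obtain ⟨σ, hσ⟩ := exists_perm_of_highestVec_ne_zero hq c
  rw [hσ]
  have hk : ∃ β ∈ A c.1 c.2, β.row = k.1 := by
    by_contra h
    exact hb (hookPoint_of_notMem h)
  obtain ⟨β, hβ, hβk⟩ := hk
  intro h
  change hookPoint (A c.1 c.2) k.1 = _ at h
  rw [← hβk, (hA.1 c.1 c.2).hookPoint_row hβ] at h
  have h1 := (hA.1 c.1 c.2).lt_pos_tgt hβ
  rw [h] at h1
  exact absurd (σ k).2 (not_le.2 h1)

theorem IsAntichainSum.pos_lt (hA : IsAntichainSum m s A) (b : YBox m)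
    (hb : boxPoint m A b ≠ .inl b.2.1) :
    pos (.inl b.2.1 : Fin n ⊕ Fin n) < pos (boxPoint m A b) := by
  obtain ⟨c, k⟩ := b
  have hk : ∃ β ∈ A c.1 c.2, β.row = k.1 := by
    by_contra h
    exact hb (hookPoint_of_notMem h)
  obtain ⟨β, hβ, hβk⟩ := hk
  change pos (.inl k.1 : Fin n ⊕ Fin n) < pos (hookPoint (A c.1 c.2) k.1)
  rw [← hβk, (hA.1 c.1 c.2).hookPoint_row hβ]
  exact β.pos_src_lt

theorem IsAntichainSum.card_diffSet (hA : IsAntichainSum m s A) :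
    (diffSet (boxPoint m A) (fun b => .inl b.2.1)).card = ∑ β, s β := by
  rw [← sum_totalExp hA.pos_lt, hA.totalExp_boxPoint]

/-- Among the multi-indices supporting the highest weight vector that are at distance `∑ s` from
the point, the identity has the lexicographically smallest exponent. -/
theorem IsAntichainSum.lex_lt (hA : IsAntichainSum m s A) {q : YBox m → Fin n ⊕ Fin n}
    (hq : highestVec m q ≠ 0) (hne : q ≠ fun b => .inl b.2.1)
    (hcard : (diffSet (boxPoint m A) q).card ≤ ∑ β, s β) :
    toLex s < toLex (totalExp (boxPoint m A) q) := by
  -- Inclusion and cardinality force equality, so `q` agrees with the point outside the antichain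
  -- rows. This is why the permutations fix those rows.
  have hd : diffSet (boxPoint m A) q = diffSet (boxPoint m A) (fun b => .inl b.2.1) :=
    (Finset.eq_of_subset_of_card_le (hA.diffSet_subset hq) (hcard.trans hA.card_diffSet.ge)).symm
  choose σ hσ using exists_perm_of_highestVec_ne_zero hq
  have hfix : ∀ (c : YCol m) (k : {k : Fin n // k ≤ c.1}),
      (¬∃ β ∈ A c.1 c.2, β.row = k.1) → σ c k = k := by
    intro c k hk
    have h1 : (⟨c, k⟩ : YBox m) ∉ diffSet (boxPoint m A) q := by
      rw [hd, mem_diffSet, not_not]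
      exact hookPoint_of_notMem hk
    rw [mem_diffSet, not_not, hσ] at h1
    change hookPoint (A c.1 c.2) k.1 = _ at h1
    rw [hookPoint_of_notMem hk] at h1
    exact Subtype.ext (Sum.inl_injective h1.symm)
  have hex : ∃ c, σ c ≠ 1 := by
    by_contra h
    push Not at h
    refine hne (funext fun b => ?_)
    obtain ⟨c, k⟩ := b
    rw [hσ, h c]
    rfl
  obtain ⟨c₀, hc₀⟩ := hex
  have hlt : ∀ c, σ c ≠ 1 → toLex (∑ k : {k : Fin n // k ≤ c.1},
        entryExp (boxPoint m A ⟨c, k⟩) (.inl k.1)) <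
      toLex (∑ k : {k : Fin n // k ≤ c.1}, entryExp (boxPoint m A ⟨c, k⟩) (q ⟨c, k⟩)) := by
    intro c hc
    simp only [hσ]
    exact (hA.1 c.1 c.2).lex_lt hc (hfix c)
  conv_lhs => rw [← hA.totalExp_boxPoint]
  have e : ∀ q : YBox m → Fin n ⊕ Fin n, totalExp (boxPoint m A) q =
      ∑ c : YCol m, ∑ k : {k : Fin n // k ≤ c.1}, entryExp (boxPoint m A ⟨c, k⟩) (q ⟨c, k⟩) :=
    fun q => Fintype.sum_sigma _
  rw [e, e]
  refine Finset.sum_lt_sum (M := Lex (PosRoot n → ℕ))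
    (f := fun c => toLex (∑ k : {k : Fin n // k ≤ c.1},
      entryExp (boxPoint m A ⟨c, k⟩) (.inl k.1)))
    (g := fun c => toLex (∑ k : {k : Fin n // k ≤ c.1},
      entryExp (boxPoint m A ⟨c, k⟩) (q ⟨c, k⟩)))
    (fun c _ => ?_) ⟨c₀, Finset.mem_univ _, hlt c₀ hc₀⟩
  by_cases hc : σ c = 1
  · simp only [hσ, hc]
    exact le_rfl
  · exact (hlt c hc).le

theorem IsAntichainSum.wordAct_eq_zero (hA : IsAntichainSum m s A) {l : List (nMinus n)}
    (hl : l.length < ∑ β, s β) : wordAct l (highestVec m) (boxPoint m A) = 0 := by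
  rw [wordAct_apply_eq_sum]
  refine Finset.sum_eq_zero fun q _ => ?_
  by_cases hq : highestVec m q = 0
  · rw [hq, zero_mul]
  · rw [wordAct_deltaFun_eq_zero q l, mul_zero]
    refine hl.trans_le (hA.card_diffSet.symm.le.trans ?_)
    exact Finset.card_le_card (hA.diffSet_subset hq)

theorem IsAntichainSum.content_of_ne_zero (hA : IsAntichainSum m s A) (hf : IsRootVectors f)
    {l : List (PosRoot n)} (hl : l.length = ∑ β, s β) {q : YBox m → Fin n ⊕ Fin n}
    (hq : highestVec m q ≠ 0) (h : wordAct (l.map f) (deltaFun q) (boxPoint m A) ≠ 0) :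
    (q = fun b => .inl b.2.1) ∧ content l = s ∨
      (q ≠ fun b => .inl b.2.1) ∧ toLex s < toLex (content l) := by
  have h1 : (diffSet (boxPoint m A) q).card ≤ ∑ β, s β := by
    by_contra hc
    refine h (wordAct_deltaFun_eq_zero q _ _ ?_)
    rw [List.length_map]
    omega
  have h2 : (diffSet (boxPoint m A) q).card = ∑ β, s β :=
    le_antisymm h1 (hA.card_diffSet.symm.le.trans (Finset.card_le_card (hA.diffSet_subset hq)))
  have h3 := content_eq_totalExp hf q l _ (hl.trans h2.symm) h
  by_cases hqe : q = fun b => .inl b.2.1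
  · refine .inl ⟨hqe, ?_⟩
    rw [h3, hqe, hA.totalExp_boxPoint]
  · refine .inr ⟨hqe, ?_⟩
    rw [h3]
    exact hA.lex_lt hq hqe h1

theorem IsAntichainSum.lex_le_of_wordAct_ne_zero (hA : IsAntichainSum m s A)
    (hf : IsRootVectors f) {l : List (PosRoot n)} (hl : l.length = ∑ β, s β)
    (h : wordAct (l.map f) (highestVec m) (boxPoint m A) ≠ 0) :
    toLex s ≤ toLex (content l) := by
  rw [wordAct_apply_eq_sum] at h
  obtain ⟨q, -, hq⟩ := Finset.exists_ne_zero_of_sum_ne_zero h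
  rcases hA.content_of_ne_zero hf hl (left_ne_zero_of_mul hq) (right_ne_zero_of_mul hq) with
    h | h
  · rw [h.2]
  · exact h.2.le

/-- Any other multi-index in the support of `highestVec m` requires a content strictly above `s`, so
only the identity contributes, with a nonzero value. -/
theorem IsAntichainSum.wordAct_ne_zero (hA : IsAntichainSum m s A) (hf : IsRootVectors f)
    {l : List (PosRoot n)} (hl : content l = s) :
    wordAct (l.map f) (highestVec m) (boxPoint m A) ≠ 0 := by
  have hlen : l.length = ∑ β, s β := by rw [← hl, sum_content]
  rw [wordAct_apply_eq_sum, Finset.sum_eq_single fun b => .inl b.2.1]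
  · obtain ⟨N, hN, e⟩ := exists_wordAct_eq hf (fun b : YBox m => .inl b.2.1) l (boxPoint m A)
      hA.pos_lt (by rw [hl, hA.totalExp_boxPoint])
    rw [highestVec_inl, one_mul, e]
    exact mul_ne_zero (Nat.cast_ne_zero.2 hN.ne') (entryProd_ne_zero hf _ _)
  · intro q _ hqe
    by_contra hne
    rcases hA.content_of_ne_zero hf hlen (left_ne_zero_of_mul hne) (right_ne_zero_of_mul hne) with
      h | h
    · exact hqe h.1
    · rw [hl] at h
      exact lt_irrefl _ h.2
  · intro h
    exact absurd (Finset.mem_univ _) h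

end Point

/-! ### Triangularity: functionals detecting the smallest exponent. -/

section LowFunctionals

variable {n : ℕ} {f : PosRoot n → nMinus n}
variable {E : Type*} [AddCommGroup E] [Module ℂ E] [Module (SymMinus n) E]

/-- `Ξ` detects `f^s u` and vanishes on all `f^t u` with `t` lexicographically smaller than `s`. -/
def IsLowFunctional (f : PosRoot n → nMinus n) (u : E) (s : PosRoot n → ℕ) (Ξ : E →ₗ[ℂ] ℂ) : Prop :=
  Ξ (monomial f s • u) ≠ 0 ∧ ∀ t, Ξ (monomial f t • u) ≠ 0 → toLex s ≤ toLex t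

/-- In a linear relation, apply the functional of the lexicographically largest exponent with
nonzero coefficient: it ignores all the others. -/
theorem linearIndependent_of_isLowFunctional {u : E} {S : Set (PosRoot n → ℕ)}
    (h : ∀ s ∈ S, ∃ Ξ, IsLowFunctional f u s Ξ) :
    LinearIndependent ℂ fun s : S => monomial f s • u := by
  classical
  rw [linearIndependent_iff']
  intro F c hc
  by_contra hne
  push Not at hne
  obtain ⟨s₀, hs₀, hcs₀⟩ := hne
  obtain ⟨s, hs, hmax⟩ := (F.filter fun s => c s ≠ 0).exists_max_image (fun s => toLex s.1)
    ⟨s₀, Finset.mem_filter.2 ⟨hs₀, hcs₀⟩⟩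
  rw [Finset.mem_filter] at hs
  obtain ⟨Ξ, h1, h2⟩ := h s.1 s.2
  have h3 := congrArg Ξ hc
  rw [map_sum, map_zero, Finset.sum_eq_single s] at h3
  · rw [map_smul, smul_eq_mul] at h3
    exact (mul_ne_zero hs.2 h1) h3
  · intro t ht hts
    rw [map_smul, smul_eq_mul]
    by_cases hct : c t = 0
    · rw [hct, zero_mul]
    · by_contra hne
      have h4 := h2 t.1 (right_ne_zero_of_mul hne)
      have h5 := hmax t (Finset.mem_filter.2 ⟨ht, hct⟩)
      exact hts (Subtype.ext (toLex.injective (le_antisymm h5 h4)))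
  · intro h'
    exact absurd hs.1 h'

variable [IsScalarTower ℂ (SymMinus n) E]

/-- The monomials that span modulo `I` remain independent after application to `u`, so the
annihilator of `u` has no room beyond `I`. -/
theorem torsionOf_eq_of_linearIndependent {I : Ideal (SymMinus n)} {u : E}
    {S : Set (PosRoot n → ℕ)}
    (hspan : ∀ p : SymMinus n, ∃ q ∈ Submodule.span ℂ (monomial f '' S), p - q ∈ I)
    (hI : I ≤ Ideal.torsionOf (SymMinus n) E u)
    (hli : LinearIndependent ℂ fun s : S => monomial f s • u) :
    Ideal.torsionOf (SymMinus n) E u = I := by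
  refine le_antisymm (fun p hp => ?_) hI
  obtain ⟨q, hq, hpq⟩ := hspan p
  rw [Ideal.mem_torsionOf_iff] at hp
  have h1 : q • u = 0 := by
    have := hI hpq
    rwa [Ideal.mem_torsionOf_iff, sub_smul, hp, zero_sub, neg_eq_zero] at this
  rw [Set.image_eq_range, Finsupp.mem_span_range_iff_exists_finsupp] at hq
  obtain ⟨c, rfl⟩ := hq
  have hc : c = 0 := by
    rw [linearIndependent_iff] at hli
    refine hli c ?_
    rw [← h1, Finsupp.linearCombination_apply, Finsupp.sum, Finsupp.sum, Finset.sum_smul]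
    refine Finset.sum_congr rfl fun s _ => ?_
    rw [smul_assoc]
  rwa [hc, Finsupp.sum_zero_index, sub_zero] at hpq

end LowFunctionals

/-! ### Functionals on the associated graded module -/

section GrFunctional

variable {R L : Type*} [CommRing R] [LieRing L] [LieAlgebra R L]
variable {M : Type*} [AddCommGroup M] [Module R M] [LieRingModule L M] [LieModule R L M]

/-- The functional on `gr M` induced on the piece of degree `d` by a functional on `M` vanishing on
`M_{d-1}`. -/
def grFunctional (v : M) (d : ℕ) (ξ : M →ₗ[R] R) (h : ∀ a ∈ filtrationPred R L v d, ξ a = 0) :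
    Gr R L v →ₗ[R] R :=
  DirectSum.toModule R ℕ R fun k =>
    if hk : k = d then Submodule.liftQ _ (ξ ∘ₗ (filtration R L v k).subtype) (by
      subst hk
      exact fun a ha => h _ ha) else 0

theorem grFunctional_apply (v : M) (d : ℕ) (ξ : M →ₗ[R] R)
    (h : ∀ a ∈ filtrationPred R L v d, ξ a = 0) (k : ℕ) (a : filtration R L v k) :
    grFunctional v d ξ h (grOf R L v k (grClass R L v k a)) = if k = d then ξ a else 0 := by
  erw [DirectSum.toModule_lof]
  split_ifs with hk
  · rfl
  · rfl

end GrFunctional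

section LowOnGr

variable {n : ℕ} {f : PosRoot n → nMinus n} {m : Fin n → ℕ}
variable {V : Type*} [AddCommGroup V] [Module ℂ V] [LieRingModule (sp n) V] [LieModule ℂ (sp n) V]

omit [LieModule ℂ (sp n) V] in
theorem map_wordAct {W : Type*} [AddCommGroup W] [Module ℂ W] [LieRingModule (sp n) W]
    [LieModule ℂ (sp n) W] {θ : V →ₗ[ℂ] W} (hA : ∀ (A : sp n) (a : V), θ ⁅A, a⁆ = ⁅A, θ a⁆)
    (l : List (nMinus n)) (x : V) : θ (wordAct l x) = wordAct l (θ x) := by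
  induction l with
  | nil => rfl
  | cons y l ih =>
    rw [wordAct_cons, wordAct_cons, ← ih]
    exact hA y _

theorem monomial_content_eq (l : List (PosRoot n)) : monomial f (content l) =
    ((l.map f).map (SymmetricAlgebra.ι ℂ (nMinus n))).prod := by
  rw [monomial_content, List.map_map]
  rfl

/-- The functional is evaluation at `boxPoint m A` after the embedding. It vanishes on words with
fewer than `∑ s` letters, so it descends to the graded piece of that degree and is extended by zero
to the others. -/
theorem exists_isLowFunctional [LieModule.IsIrreducible ℂ (sp n) V] (hf : IsRootVectors f) {x : V}
    (hx : IsHighestWeightVector m x) {s : PosRoot n → ℕ} {A : Fin n → ℕ → Finset (PosRoot n)}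
    (hA : IsAntichainSum m s A) : ∃ Ξ, IsLowFunctional f (grVec ℂ (nMinus n) x) s Ξ := by
  obtain ⟨θ, -, hθx, hθ⟩ := exists_embedding hf hx (highestVec_isHighestWeightVector (m := m))
  set ξ : V →ₗ[ℂ] ℂ := evalAt (boxPoint m A) ∘ₗ θ with hξ
  have hword : ∀ l : List (nMinus n), ξ (wordAct l x) =
      wordAct l (highestVec m) (boxPoint m A) := by
    intro l
    rw [hξ, LinearMap.comp_apply, map_wordAct hθ, hθx, evalAt_apply]
  have hpred : ∀ a ∈ filtrationPred ℂ (nMinus n) x (∑ β, s β), ξ a = 0 := by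
    intro a ha
    obtain ⟨d, hd⟩ : ∃ d, d = ∑ β, s β := ⟨_, rfl⟩
    rw [← hd] at ha
    cases d with
    | zero =>
      have : a = 0 := ha
      rw [this, map_zero]
    | succ k =>
      change a ∈ filtration ℂ (nMinus n) x k at ha
      rw [filtration_eq_span] at ha
      induction ha using Submodule.span_induction with
      | mem a h =>
        obtain ⟨l, hl, rfl⟩ := h
        rw [hword, hA.wordAct_eq_zero (by omega)]
      | zero => exact map_zero _
      | add a b _ _ ha hb => rw [map_add, ha, hb, add_zero]
      | smul c a _ ha => rw [map_smul, ha, smul_zero]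
  have hval : ∀ l : List (PosRoot n),
      grFunctional x (∑ β, s β) ξ hpred (monomial f (content l) • grVec ℂ (nMinus n) x) =
        if l.length = ∑ β, s β then wordAct (l.map f) (highestVec m) (boxPoint m A) else 0 := by
    intro l
    rw [monomial_content_eq, prod_ι_smul_grVec, grFunctional_apply, hword, List.length_map]
  refine ⟨grFunctional x _ ξ hpred, ?_, fun t ht => ?_⟩
  · obtain ⟨l, rfl⟩ := exists_content_eq s
    rw [hval, if_pos (sum_content l).symm]
    exact hA.wordAct_ne_zero hf rfl
  · obtain ⟨l, rfl⟩ := exists_content_eq t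
    rw [hval] at ht
    by_cases hl : l.length = ∑ β, s β
    · rw [if_pos hl] at ht
      exact hA.lex_le_of_wordAct_ne_zero hf hl ht
    · rw [if_neg hl] at ht
      exact absurd rfl ht

/-- The consequences of a spanning set of monomials for the associated graded module. -/
theorem basis_and_torsionOf [LieModule.IsIrreducible ℂ (sp n) V] (hf : IsRootVectors f) {x : V}
    (hx : IsHighestWeightVector m x)
    (hspan : ∀ p : SymMinus n, ∃ q ∈ Submodule.span ℂ (monomial f '' latticePoints m),
      p - q ∈ relIdeal f m) :
    (∃ b : Module.Basis (latticePoints m) ℂ (Gr ℂ (nMinus n) x),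
      ∀ s : latticePoints m, b s = monomial f s • grVec ℂ (nMinus n) x) ∧
    Ideal.torsionOf (SymMinus n) (Gr ℂ (nMinus n) x) (grVec ℂ (nMinus n) x) = relIdeal f m := by
  have hle := relIdeal_le_torsionOf_grVec (f := f) hf hx
  have hli : LinearIndependent ℂ
      fun s : latticePoints m => monomial f s • grVec ℂ (nMinus n) x :=
    linearIndependent_of_isLowFunctional fun s hs => by
      obtain ⟨A, hA⟩ := exists_isAntichainSum (chainBound_of_mem_latticePoints hs)
      exact exists_isLowFunctional hf hx hA
  refine ⟨⟨Module.Basis.mk hli ?_, fun s => Module.Basis.mk_apply _ _ _⟩,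
    torsionOf_eq_of_linearIndependent hspan hle hli⟩
  rintro a -
  have ha : a ∈ Submodule.span (SymMinus n) {grVec ℂ (nMinus n) x} := by
    rw [span_grVec]
    trivial
  obtain ⟨p, rfl⟩ := Submodule.mem_span_singleton.1 ha
  obtain ⟨q, hq, hpq⟩ := hspan p
  have h1 : p • grVec ℂ (nMinus n) x = q • grVec ℂ (nMinus n) x := by
    have := hle hpq
    rwa [Ideal.mem_torsionOf_iff, sub_smul, sub_eq_zero] at this
  rw [h1]
  clear h1 hpq
  induction hq using Submodule.span_induction with
  | mem q h =>
    obtain ⟨s, hs, rfl⟩ := h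
    exact Submodule.subset_span ⟨⟨s, hs⟩, rfl⟩
  | zero =>
    rw [zero_smul]
    exact zero_mem _
  | add a b _ _ ha hb =>
    rw [add_smul]
    exact add_mem ha hb
  | smul c a _ ha =>
    rw [smul_assoc]
    exact Submodule.smul_mem _ _ ha

end LowOnGr

/-! ### Tensor products -/

section TensorLow

variable {L : Type*} [LieRing L] [LieAlgebra ℂ L]
variable {V W : Type*} [AddCommGroup V] [Module ℂ V] [LieRingModule L V] [LieModule ℂ L V]
  [AddCommGroup W] [Module ℂ W] [LieRingModule L W] [LieModule ℂ L W]

/-- A pure tensor in `gr V ⊗ gr W`. -/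
def pureTensor {v : V} {w : W} (a : Gr ℂ L v) (b : Gr ℂ L w) : GrTensor ℂ L v w :=
  (a ⊗ₜ[ℂ] b : Gr ℂ L v ⊗[ℂ] Gr ℂ L w)

variable {v : V} {w : W}

theorem ι_smul_pureTensor (y : L) (a : Gr ℂ L v) (b : Gr ℂ L w) :
    SymmetricAlgebra.ι ℂ L y • pureTensor a b =
      pureTensor (SymmetricAlgebra.ι ℂ L y • a) b + pureTensor a (SymmetricAlgebra.ι ℂ L y • b) :=
  ι_smul_tensor ℂ L v w y a b

theorem pureTensor_induction {P : GrTensor ℂ L v w → Prop} (h0 : P 0)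
    (ht : ∀ a b, P (pureTensor a b)) (ha : ∀ x y, P x → P y → P (x + y)) (z : GrTensor ℂ L v w) :
    P z :=
  TensorProduct.induction_on (motive := P) z h0 ht ha

theorem pureTensor_zero_left (b : Gr ℂ L w) : pureTensor (0 : Gr ℂ L v) b = 0 :=
  TensorProduct.zero_tmul _ _

theorem pureTensor_zero_right (a : Gr ℂ L v) : pureTensor a (0 : Gr ℂ L w) = 0 :=
  TensorProduct.tmul_zero _ _

theorem pureTensor_add_left (a a' : Gr ℂ L v) (b : Gr ℂ L w) :
    pureTensor (a + a') b = pureTensor a b + pureTensor a' b :=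
  TensorProduct.add_tmul _ _ _

theorem pureTensor_add_right (a : Gr ℂ L v) (b b' : Gr ℂ L w) :
    pureTensor a (b + b') = pureTensor a b + pureTensor a b' :=
  TensorProduct.tmul_add _ _ _

/-- The tensor product of two functionals. -/
def tensorFunctional (Ξ : Gr ℂ L v →ₗ[ℂ] ℂ) (H : Gr ℂ L w →ₗ[ℂ] ℂ) : GrTensor ℂ L v w →ₗ[ℂ] ℂ :=
  (TensorProduct.lid ℂ ℂ).toLinearMap ∘ₗ TensorProduct.map Ξ H

/-- The operator `S ⊗ 1 + 1 ⊗ T`. -/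
def tensorDerivation (S : Gr ℂ L v →ₗ[ℂ] Gr ℂ L v) (T : Gr ℂ L w →ₗ[ℂ] Gr ℂ L w) :
    GrTensor ℂ L v w →ₗ[ℂ] GrTensor ℂ L v w :=
  (LinearMap.rTensor (Gr ℂ L w) S + LinearMap.lTensor (Gr ℂ L v) T :
    Gr ℂ L v ⊗[ℂ] Gr ℂ L w →ₗ[ℂ] Gr ℂ L v ⊗[ℂ] Gr ℂ L w)

theorem tensorDerivation_apply (S : Gr ℂ L v →ₗ[ℂ] Gr ℂ L v) (T : Gr ℂ L w →ₗ[ℂ] Gr ℂ L w)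
    (a : Gr ℂ L v) (b : Gr ℂ L w) :
    tensorDerivation S T (pureTensor a b) = pureTensor (S a) b + pureTensor a (T b) := rfl

/-- In the binomial expansion of `(y ⊗ 1 + 1 ⊗ y) ^ k` every term has at least `i` factors on the
left or at least `j` on the right. -/
theorem ι_pow_smul_pureTensor_eq_zero (y : L) (k : ℕ) :
    ∀ (i j : ℕ) (a : Gr ℂ L v) (b : Gr ℂ L w), i + j ≤ k + 1 →
      SymmetricAlgebra.ι ℂ L y ^ i • a = 0 → SymmetricAlgebra.ι ℂ L y ^ j • b = 0 →
        SymmetricAlgebra.ι ℂ L y ^ k • pureTensor a b = 0 := by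
  induction k with
  | zero =>
    intro i j a b hij ha hb
    rcases Nat.eq_zero_or_pos i with rfl | hi
    · rw [pow_zero, one_smul] at ha
      rw [ha, pureTensor_zero_left, smul_zero]
    · have hj : j = 0 := by omega
      rw [hj, pow_zero, one_smul] at hb
      rw [hb, pureTensor_zero_right, smul_zero]
  | succ k ih =>
    intro i j a b hij ha hb
    rw [pow_succ, mul_smul, ι_smul_pureTensor, smul_add]
    cases i with
    | zero =>
      rw [pow_zero, one_smul] at ha
      rw [ha, smul_zero, pureTensor_zero_left, pureTensor_zero_left, smul_zero, add_zero]
    | succ i =>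
      cases j with
      | zero =>
        rw [pow_zero, one_smul] at hb
        rw [hb, smul_zero, pureTensor_zero_right, pureTensor_zero_right, smul_zero, add_zero]
      | succ j =>
        rw [ih i (j + 1) _ _ (by omega) (by rwa [← mul_smul, ← pow_succ]) hb,
          ih (i + 1) j _ _ (by omega) ha (by rwa [← mul_smul, ← pow_succ]), add_zero]

end TensorLow

/-! ### Triangularity and relations in tensor products. -/

section TensorSymplectic

variable {n : ℕ} {f : PosRoot n → nMinus n}

/-- All ways to distribute a word over two factors, recorded by their exponents. -/
def splitExponents : List (PosRoot n) → List ((PosRoot n → ℕ) × (PosRoot n → ℕ))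
  | [] => [(0, 0)]
  | β :: l => (splitExponents l).map (fun z => (Pi.single β 1 + z.1, z.2)) ++
      (splitExponents l).map fun z => (z.1, Pi.single β 1 + z.2)

theorem mem_splitExponents (l : List (PosRoot n)) :
    ∀ z, z ∈ splitExponents l ↔ z.1 + z.2 = content l := by
  induction l with
  | nil =>
    rintro ⟨s, t⟩
    have hc : content ([] : List (PosRoot n)) = 0 := rfl
    rw [splitExponents, List.mem_singleton, hc, Prod.mk.injEq, add_eq_zero]
  | cons β l ih =>
    rintro ⟨s, t⟩
    rw [splitExponents, List.mem_append, List.mem_map, List.mem_map, content_cons]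
    constructor
    · rintro (⟨z, hz, h⟩ | ⟨z, hz, h⟩)
      · rw [← h, ← (ih z).1 hz, add_assoc]
      · rw [← h, ← (ih z).1 hz, add_left_comm]
    · intro h
      have hsub : ∀ u : PosRoot n → ℕ, u β ≠ 0 → Pi.single β 1 + (u - Pi.single β 1) = u := by
        intro u hu
        funext γ
        by_cases hγ : γ = β
        · subst hγ
          simp only [Pi.add_apply, Pi.sub_apply, Pi.single_eq_same]
          omega
        · simp [Pi.single_eq_of_ne hγ]
      have hβ := congrFun h β
      simp only [Pi.add_apply, Pi.single_eq_same] at hβ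
      by_cases hs : s β = 0
      · right
        have ht : t β ≠ 0 := by omega
        refine ⟨(s, t - Pi.single β 1), (ih _).2 ?_, by simp only [hsub t ht]⟩
        apply add_left_cancel (a := Pi.single β 1)
        rw [← h, add_left_comm, hsub t ht]
      · left
        refine ⟨(s - Pi.single β 1, t), (ih _).2 ?_, by simp only [hsub s hs]⟩
        apply add_left_cancel (a := Pi.single β 1)
        rw [← h, ← add_assoc, hsub s hs]

/-- The distributions of a word over two factors are listed with multiplicity; since all nonzero
terms agree, they cannot cancel. -/
theorem sum_map_eq_nsmul {α : Type*} (l : List α) (g : α → ℂ) (c : ℂ)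
    (h : ∀ a ∈ l, g a = 0 ∨ g a = c) :
    ∃ k : ℕ, (l.map g).sum = k * c ∧ ((∃ a ∈ l, g a = c) → c ≠ 0 → 0 < k) := by
  induction l with
  | nil => exact ⟨0, by simp⟩
  | cons a l ih =>
    obtain ⟨k, hk, hpos⟩ := ih fun a ha => h a (List.mem_cons_of_mem _ ha)
    rw [List.map_cons, List.sum_cons, hk]
    by_cases hc : g a = c
    · refine ⟨k + 1, ?_, fun _ _ => Nat.succ_pos k⟩
      rw [hc]
      push_cast
      ring
    · have h0 := (h a List.mem_cons_self).resolve_right hc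
      refine ⟨k, by rw [h0, zero_add], ?_⟩
      rintro ⟨b, hb, hbc⟩
      rcases List.mem_cons.1 hb with rfl | hb
      · exact absurd hbc hc
      · exact hpos ⟨b, hb, hbc⟩

variable {V W : Type*} [AddCommGroup V] [Module ℂ V] [LieRingModule (sp n) V]
  [LieModule ℂ (sp n) V] [AddCommGroup W] [Module ℂ W] [LieRingModule (sp n) W]
  [LieModule ℂ (sp n) W]

theorem monomial_content_smul_pureTensor {v : V} {w : W} (a : Gr ℂ (nMinus n) v)
    (b : Gr ℂ (nMinus n) w) (l : List (PosRoot n)) :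
    monomial f (content l) • pureTensor a b =
      ((splitExponents l).map fun z =>
        pureTensor (monomial f z.1 • a) (monomial f z.2 • b)).sum := by
  induction l with
  | nil =>
    have h : monomial f 0 = 1 := by simp [monomial]
    have hc : content ([] : List (PosRoot n)) = 0 := rfl
    simp [splitExponents, hc, h]
  | cons β l ih =>
    have hsum : ∀ M : List ((PosRoot n → ℕ) × (PosRoot n → ℕ)),
        SymmetricAlgebra.ι ℂ (nMinus n) (f β) •
          (M.map fun z => pureTensor (monomial f z.1 • a) (monomial f z.2 • b)).sum =
        (M.map fun z =>
          pureTensor (monomial f (Pi.single β 1 + z.1) • a) (monomial f z.2 • b)).sum +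
        (M.map fun z =>
          pureTensor (monomial f z.1 • a) (monomial f (Pi.single β 1 + z.2) • b)).sum := by
      intro M
      induction M with
      | nil => simp
      | cons z M ihM =>
        simp only [List.map_cons, List.sum_cons, smul_add, ihM, ι_smul_pureTensor, monomial_add,
          monomial_single, mul_smul]
        abel
    rw [content_cons, monomial_add, mul_smul, ih, monomial_single, hsum, splitExponents,
      List.map_append, List.sum_append, List.map_map, List.map_map]
    rfl

/-- The lexicographic order is compatible with addition. Among the splittings of `s + t` only `(s,
t)` itself can be seen by both functionals, and every exponent that is seen is a sum of one above
`s` and one above `t`. -/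
theorem IsLowFunctional.tensor {v : V} {w : W} {s t : PosRoot n → ℕ}
    {a : Gr ℂ (nMinus n) v} {b : Gr ℂ (nMinus n) w} {Ξ : Gr ℂ (nMinus n) v →ₗ[ℂ] ℂ}
    {H : Gr ℂ (nMinus n) w →ₗ[ℂ] ℂ} (hΞ : IsLowFunctional f a s Ξ) (hH : IsLowFunctional f b t H) :
    IsLowFunctional f (pureTensor a b) (s + t) (tensorFunctional Ξ H) := by
  have hval : ∀ l : List (PosRoot n),
      tensorFunctional Ξ H (monomial f (content l) • pureTensor a b) =
      ((splitExponents l).map fun z => Ξ (monomial f z.1 • a) * H (monomial f z.2 • b)).sum := by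
    intro l
    rw [monomial_content_smul_pureTensor, map_list_sum, List.map_map]
    congr 1
  constructor
  · obtain ⟨l, hl⟩ := exists_content_eq (s + t)
    rw [← hl, hval]
    obtain ⟨k, hk, hpos⟩ := sum_map_eq_nsmul (splitExponents l)
      (fun z => Ξ (monomial f z.1 • a) * H (monomial f z.2 • b))
      (Ξ (monomial f s • a) * H (monomial f t • b)) (fun z hz => by
        rw [mem_splitExponents, hl] at hz
        by_contra hne
        push Not at hne
        have h1 := hΞ.2 _ (left_ne_zero_of_mul hne.1)
        have h2 := hH.2 _ (right_ne_zero_of_mul hne.1)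
        -- Strict inequality in the first part, together with `t ≤ z.2`, would make the sum exceed
        -- `s + t`.
        have h3 : toLex s = toLex z.1 := by
          refine le_antisymm h1 ?_
          by_contra h
          exact absurd hz (add_lt_add_of_lt_of_le (α := Lex (PosRoot n → ℕ)) (not_le.1 h) h2).ne'
        have h4 : s = z.1 := toLex.injective h3
        rw [← h4] at hz
        have h5 : z.2 = t := add_left_cancel hz
        exact hne.2 (by rw [← h4, h5]))
    have hne := mul_ne_zero hΞ.1 hH.1
    rw [hk]
    exact mul_ne_zero (Nat.cast_ne_zero.2
      (hpos ⟨(s, t), (mem_splitExponents l _).2 hl.symm, rfl⟩ hne).ne') hne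
  · intro u hu
    obtain ⟨l, rfl⟩ := exists_content_eq u
    rw [hval] at hu
    have : ∃ z ∈ splitExponents l, Ξ (monomial f z.1 • a) * H (monomial f z.2 • b) ≠ 0 := by
      by_contra h
      push Not at h
      refine hu (List.sum_eq_zero fun x hx => ?_)
      obtain ⟨z, hz, rfl⟩ := List.mem_map.1 hx
      exact h z hz
    obtain ⟨z, hz, hne⟩ := this
    rw [← (mem_splitExponents l z).1 hz]
    exact add_le_add (α := Lex (PosRoot n → ℕ)) (hΞ.2 _ (left_ne_zero_of_mul hne))
      (hH.2 _ (right_ne_zero_of_mul hne))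

variable [LieModule.IsIrreducible ℂ (sp n) V] [LieModule.IsIrreducible ℂ (sp n) W]
variable {l m : Fin n → ℕ} {v : V} {w : W}

theorem relIdeal_le_torsionOf_pureTensor (hf : IsRootVectors f) (hv : IsHighestWeightVector l v)
    (hw : IsHighestWeightVector m w) :
    relIdeal f (l + m) ≤ Ideal.torsionOf (SymMinus n) (GrTensor ℂ (nMinus n) v w)
      (pureTensor (grVec ℂ (nMinus n) v) (grVec ℂ (nMinus n) w)) := by
  refine relIdeal_le_torsionOf f (l + m)
    (fun e => tensorDerivation (raise hv.isBorelEigenvector e) (raise hw.isBorelEigenvector e))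
    ?_ _ ?_ ?_
  · intro e y z
    induction z using pureTensor_induction with
    | h0 => simp only [smul_zero, map_zero, add_zero]
    | ht a b =>
      simp only [ι_smul_pureTensor, map_add, tensorDerivation_apply, raise_ι_smul, smul_add,
        pureTensor_add_left, pureTensor_add_right]
      abel
    | ha x y hx hy =>
      simp only [smul_add, map_add, hx, hy]
      abel
  · intro e
    rw [tensorDerivation_apply, raise_grVec _ _ (hv.nPlus_lie e), raise_grVec _ _ (hw.nPlus_lie e),
      pureTensor_zero_left, pureTensor_zero_right, add_zero]
  · intro r hr
    induction hr using Submodule.span_induction with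
    | mem r h =>
      rcases h with ⟨β, hβ, rfl⟩ | ⟨β, hβ, rfl⟩
      · refine ι_pow_smul_pureTensor_eq_zero _ _ (∑ k ∈ Finset.Icc β.row (letter β.col), l k + 1)
          (∑ k ∈ Finset.Icc β.row (letter β.col), m k + 1) _ _ ?_ ?_ ?_
        · simp only [Pi.add_apply, Finset.sum_add_distrib]
          omega
        · exact relSpace_smul_grVec_eq_zero hf hv (Submodule.subset_span (.inl ⟨β, hβ, rfl⟩))
        · exact relSpace_smul_grVec_eq_zero hf hw (Submodule.subset_span (.inl ⟨β, hβ, rfl⟩))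
      · refine ι_pow_smul_pureTensor_eq_zero _ _ (∑ k ∈ Finset.Ici β.row, l k + 1)
          (∑ k ∈ Finset.Ici β.row, m k + 1) _ _ ?_ ?_ ?_
        · simp only [Pi.add_apply, Finset.sum_add_distrib]
          omega
        · exact relSpace_smul_grVec_eq_zero hf hv (Submodule.subset_span (.inr ⟨β, hβ, rfl⟩))
        · exact relSpace_smul_grVec_eq_zero hf hw (Submodule.subset_span (.inr ⟨β, hβ, rfl⟩))
    | zero => exact zero_smul _ _
    | add p q _ _ hp hq => rw [add_smul, hp, hq, add_zero]
    | smul c p _ hp => rw [smul_assoc, hp, smul_zero]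

/-- Both modules are cyclic, and both generators have annihilator `relIdeal f (l + m)`. -/
theorem nonempty_grCartan_equiv {X : Type*} [AddCommGroup X] [Module ℂ X]
    [LieRingModule (sp n) X] [LieModule ℂ (sp n) X] [LieModule.IsIrreducible ℂ (sp n) X] {x : X}
    (hf : IsRootVectors f) (hv : IsHighestWeightVector l v) (hw : IsHighestWeightVector m w)
    (hx : IsHighestWeightVector (l + m) x)
    (hspan : ∀ p : SymMinus n, ∃ q ∈ Submodule.span ℂ (monomial f '' latticePoints (l + m)),
      p - q ∈ relIdeal f (l + m)) :
    Nonempty (grCartan ℂ (nMinus n) v w ≃ₗ[SymMinus n] Gr ℂ (nMinus n) x) := by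
  have h1 := (basis_and_torsionOf hf hx hspan).2
  have h2 : Ideal.torsionOf (SymMinus n) (GrTensor ℂ (nMinus n) v w)
      (pureTensor (grVec ℂ (nMinus n) v) (grVec ℂ (nMinus n) w)) = relIdeal f (l + m) := by
    refine torsionOf_eq_of_linearIndependent hspan (relIdeal_le_torsionOf_pureTensor hf hv hw)
      (linearIndependent_of_isLowFunctional fun s hs => ?_)
    obtain ⟨A, hA⟩ := exists_isAntichainSum (chainBound_of_mem_latticePoints hs)
    obtain ⟨s₁, s₂, A₁, A₂, rfl, h₁, h₂⟩ := hA.split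
    obtain ⟨Ξ, hΞ⟩ := exists_isLowFunctional hf hv h₁
    obtain ⟨H, hH⟩ := exists_isLowFunctional hf hw h₂
    exact ⟨_, hΞ.tensor hH⟩
  exact ⟨(Ideal.quotTorsionOfEquivSpanSingleton (SymMinus n) (GrTensor ℂ (nMinus n) v w)
      (pureTensor (grVec ℂ (nMinus n) v) (grVec ℂ (nMinus n) w))).symm ≪≫ₗ
    Submodule.quotEquivOfEq _ _ (h2.trans h1.symm) ≪≫ₗ
    Ideal.quotTorsionOfEquivSpanSingleton (SymMinus n) (Gr ℂ (nMinus n) x)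
      (grVec ℂ (nMinus n) x) ≪≫ₗ
    LinearEquiv.ofTop _ (span_grVec x)⟩

end TensorSymplectic

/-! ### Exponentials of derivations and stable ideals. -/

section ExponentialStep

variable {S : Type*} [CommRing S] [Algebra ℂ S] {D : Derivation ℂ S S}

open Polynomial in
-- The recursion says that `P` solves $P'=DP$, as $\exp(XD)p$ does; the Leibniz rules for $d/dX$ and
-- for $D$ make it pass to products.
theorem coeff_mul_of_derivative {P Q : S[X]}
    (hP : ∀ k : ℕ, P.coeff (k + 1) * (k + 1) = D (P.coeff k))
    (hQ : ∀ k : ℕ, Q.coeff (k + 1) * (k + 1) = D (Q.coeff k)) (k : ℕ) :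
    (P * Q).coeff (k + 1) * (k + 1) = D ((P * Q).coeff k) := by
  rw [← coeff_derivative, derivative_mul, coeff_add, coeff_mul, coeff_mul, coeff_mul,
    ← Finset.sum_add_distrib, map_sum]
  refine Finset.sum_congr rfl fun z _ => ?_
  rw [coeff_derivative, coeff_derivative, hP, hQ, D.leibniz, smul_eq_mul, smul_eq_mul]
  ring

open Polynomial in
/-- An ideal stable under a derivation `D` that contains `y^N` contains `(exp(D) y)^N`, if
`D³ y = 0`. -/
theorem exp_pow_mem {I : Ideal S} (hI : ∀ p ∈ I, D p ∈ I) {y : S} (h3 : D (D (D y)) = 0) {N : ℕ}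
    (hy : y ^ N ∈ I) : (y + D y + (1 / 2 : ℂ) • D (D y)) ^ N ∈ I := by
  -- This is $\exp(XD)y$, which stops at degree two because `D³ y = 0`.
  set c : S[X] := C y + C (D y) * X + C ((1 / 2 : ℂ) • D (D y)) * X ^ 2 with hc
  have hcoeff : ∀ k : ℕ, c.coeff (k + 1) * (k + 1) = D (c.coeff k) := by
    have h0 : c.coeff 0 = y := by simp [hc]
    have h1 : c.coeff 1 = D y := by simp [hc, coeff_C]
    have h2 : c.coeff 2 = (1 / 2 : ℂ) • D (D y) := by simp [hc]
    have hk : ∀ k, 3 ≤ k → c.coeff k = 0 := by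
      intro k hk
      rw [hc, coeff_add, coeff_add, coeff_C_mul, coeff_C_mul, coeff_X_pow, coeff_C, coeff_X,
        if_neg (by omega), if_neg (by omega), if_neg (by omega)]
      simp
    rintro (_ | _ | _ | k)
    · rw [h0, h1]
      simp
    · have h12 : ((0 + 1 : ℕ) : S) + 1 = algebraMap ℂ S 2 := by
        rw [map_ofNat]
        norm_num
      rw [h1, h2, h12, smul_mul_assoc, mul_comm, ← Algebra.smul_def, smul_smul]
      norm_num
    · rw [h2, hk _ le_rfl, D.map_smul, h3]
      simp
    · rw [hk _ (by omega), hk _ (by omega)]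
      simp
  have hpow : ∀ N : ℕ, ∀ k : ℕ, (c ^ N).coeff (k + 1) * (k + 1) = D ((c ^ N).coeff k) := by
    intro N
    induction N with
    | zero =>
      intro k
      rw [pow_zero, coeff_one, coeff_one, if_neg (by omega)]
      split_ifs <;> simp
    | succ N ih =>
      rw [pow_succ]
      exact coeff_mul_of_derivative ih hcoeff
  have hmem : ∀ k, (c ^ N).coeff k ∈ I := by
    intro k
    induction k with
    | zero =>
      rw [coeff_zero_eq_eval_zero, eval_pow]
      simpa [hc] using hy
    | succ k ih =>
      -- By the recursion, each coefficient is `D` of the previous one up to the scalar `k + 1`,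
      -- which is invertible over `ℂ`; so all of them stay in `I`.
      have h1 : (c ^ N).coeff (k + 1) = ((k : ℂ) + 1)⁻¹ • D ((c ^ N).coeff k) := by
        rw [← hpow, eq_inv_smul_iff₀ (Nat.cast_add_one_ne_zero k), Algebra.smul_def, map_add,
          map_natCast, map_one, mul_comm]
      rw [h1, Algebra.smul_def]
      exact I.mul_mem_left _ (hI _ ih)
  have heval : (c ^ N).eval 1 = (y + D y + (1 / 2 : ℂ) • D (D y)) ^ N := by
    rw [eval_pow]
    congr 1
    simp [hc]
  rw [← heval, eval_eq_sum]
  exact Ideal.sum_mem _ fun k _ => I.mul_mem_right _ (hmem k)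

end ExponentialStep

/-! ### Symmetric bilinear elements of the symplectic Lie algebra -/

section SymElements

attribute [local instance 100] LieRing.ofAssociativeRing

variable {n : ℕ}

/-- The element of `sp_{2n}` corresponding to the symmetric tensor `zw + wz`. -/
def symB (z w : Fin n ⊕ Fin n → ℂ) : sp n :=
  ⟨Matrix.of fun p q => sgn p * (z p.swap * w q + w p.swap * z q), by
    rw [mem_sp_iff_sgn]
    intro p q
    simp only [Matrix.of_apply, sgn_swap, Sum.swap_swap]
    linear_combination (-(sgn p) * (z q * w p.swap + w q * z p.swap)) * sgn_mul_self q⟩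

theorem symB_apply (z w : Fin n ⊕ Fin n → ℂ) (p q : Fin n ⊕ Fin n) :
    (symB z w).1 p q = sgn p * (z p.swap * w q + w p.swap * z q) := rfl

theorem sp_ext {A B : sp n} (h : ∀ p q, A.1 p q = B.1 p q) : A = B :=
  Subtype.ext (Matrix.ext h)

theorem symB_comm (z w : Fin n ⊕ Fin n → ℂ) : symB z w = symB w z :=
  sp_ext fun p q => by
    rw [symB_apply, symB_apply]
    ring

theorem symB_add_right (z w w' : Fin n ⊕ Fin n → ℂ) :
    symB z (w + w') = symB z w + symB z w' :=
  sp_ext fun p q => by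
    change _ = (symB z w).1 p q + (symB z w').1 p q
    rw [symB_apply, symB_apply, symB_apply, Pi.add_apply, Pi.add_apply]
    ring

theorem symB_add_left (z z' w : Fin n ⊕ Fin n → ℂ) : symB (z + z') w = symB z w + symB z' w := by
  rw [symB_comm, symB_add_right, symB_comm w, symB_comm w]

theorem symB_smul_right (c : ℂ) (z w : Fin n ⊕ Fin n → ℂ) : symB z (c • w) = c • symB z w :=
  sp_ext fun p q => by
    change _ = c * (symB z w).1 p q
    rw [symB_apply, symB_apply, Pi.smul_apply, Pi.smul_apply, smul_eq_mul, smul_eq_mul]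
    ring

theorem symB_smul_left (c : ℂ) (z w : Fin n ⊕ Fin n → ℂ) : symB (c • z) w = c • symB z w := by
  rw [symB_comm, symB_smul_right, symB_comm]

theorem symB_zero_right (z : Fin n ⊕ Fin n → ℂ) : symB z 0 = 0 := by
  rw [← zero_smul ℂ (0 : Fin n ⊕ Fin n → ℂ), symB_smul_right, zero_smul]

theorem symB_zero_left (z : Fin n ⊕ Fin n → ℂ) : symB 0 z = 0 := by
  rw [symB_comm, symB_zero_right]

/-- The symplectic form. -/
def omega (a z : Fin n ⊕ Fin n → ℂ) : ℂ := ∑ p, sgn p * a p.swap * z p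

theorem omega_antisymm (a z : Fin n ⊕ Fin n → ℂ) : omega a z = -omega z a := by
  rw [omega, omega, ← Finset.sum_neg_distrib]
  refine Fintype.sum_equiv (Equiv.sumComm _ _) _ _ fun p => ?_
  change _ = -(sgn p.swap * z p.swap.swap * a p.swap)
  rw [sgn_swap, Sum.swap_swap]
  ring

theorem omega_self (a : Fin n ⊕ Fin n → ℂ) : omega a a = 0 := by
  have := omega_antisymm a a
  linear_combination this / 2

theorem omega_add_left (a b z : Fin n ⊕ Fin n → ℂ) : omega (a + b) z = omega a z + omega b z := by
  simp only [omega, Pi.add_apply, mul_add, add_mul, Finset.sum_add_distrib]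

theorem omega_smul_left (c : ℂ) (a z : Fin n ⊕ Fin n → ℂ) : omega (c • a) z = c * omega a z := by
  simp only [omega, Pi.smul_apply, smul_eq_mul, Finset.mul_sum]
  exact Finset.sum_congr rfl fun p _ => by ring

theorem omega_single (r : Fin n ⊕ Fin n) (z : Fin n ⊕ Fin n → ℂ) :
    omega (Pi.single r 1) z = sgn r.swap * z r.swap := by
  rw [omega, Finset.sum_eq_single r.swap]
  · rw [Sum.swap_swap, Pi.single_eq_same, mul_one]
  · intro p _ hp
    rw [Pi.single_eq_of_ne, mul_zero, zero_mul]
    rintro rfl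
    exact hp (Sum.swap_swap p).symm
  · simp

theorem symB_mul_apply (a w x y : Fin n ⊕ Fin n → ℂ) (p q : Fin n ⊕ Fin n) :
    ((symB a w).1 * (symB x y).1) p q = sgn p *
      (a p.swap * (omega x w * y q + omega y w * x q) +
        w p.swap * (omega x a * y q + omega y a * x q)) := by
  rw [Matrix.mul_apply]
  simp only [symB_apply, omega, Finset.sum_mul, Finset.mul_sum, ← Finset.sum_add_distrib]
  exact Finset.sum_congr rfl fun r _ => by ring

/-- The action of `-symB a w` on vectors. -/
def transv (a w z : Fin n ⊕ Fin n → ℂ) : Fin n ⊕ Fin n → ℂ := omega a z • w + omega w z • a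

/-- Equivariance of the identification of `sp_{2n}` with symmetric tensors: the bracket acts on `xy`
as a derivation, through the action on vectors. -/
theorem lie_symB (a w x y : Fin n ⊕ Fin n → ℂ) :
    ⁅-symB a w, symB x y⁆ = symB (transv a w x) y + symB x (transv a w y) := by
  refine sp_ext fun p q => ?_
  rw [neg_lie]
  change -((symB a w).1 * (symB x y).1 - (symB x y).1 * (symB a w).1) p q =
    (symB (transv a w x) y).1 p q + (symB x (transv a w y)).1 p q
  rw [Matrix.sub_apply, symB_mul_apply, symB_mul_apply, symB_apply, symB_apply]
  simp only [transv, Pi.add_apply, Pi.smul_apply, smul_eq_mul]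
  rw [omega_antisymm x w, omega_antisymm y w, omega_antisymm x a, omega_antisymm y a]
  ring

/-- A product of two basis vectors is strictly upper triangular when their positions add up to more
than `2n - 1`. -/
theorem neg_symB_mem_nPlus (r : Fin n ⊕ Fin n) {w : Fin n ⊕ Fin n → ℂ}
    (hw : ∀ p, pos p ≤ pos r.swap → w p = 0) : -symB (Pi.single r 1) w ∈ nPlus n := by
  intro p q h
  change -((symB (Pi.single r 1) w).1 p q) = 0
  rw [symB_apply]
  have h1 : (Pi.single r 1 : Fin n ⊕ Fin n → ℂ) p.swap * w q = 0 := by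
    by_cases hr : p.swap = r
    · rw [hw q, mul_zero]
      rwa [← hr, Sum.swap_swap]
    · rw [Pi.single_eq_of_ne hr, zero_mul]
  have h2 : w p.swap * (Pi.single r 1 : Fin n ⊕ Fin n → ℂ) q = 0 := by
    by_cases hr : q = r
    · rw [hw p.swap, zero_mul]
      rw [← hr, pos_swap, pos_swap]
      omega
    · rw [Pi.single_eq_of_ne hr, mul_zero]
  rw [h1, h2, add_zero, mul_zero, neg_zero]

end SymElements

/-! ### Powers in the defining ideal -/

section PowersInIdeal

attribute [local instance 100] LieRing.ofAssociativeRing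

variable {n : ℕ} {f : PosRoot n → nMinus n} {m : Fin n → ℕ}

/-- The `N`-th power of the lower triangular part of `A` lies in the ideal of relations. -/
def PowMem (f : PosRoot n → nMinus n) (m : Fin n → ℕ) (N : ℕ) (A : sp n) : Prop :=
  SymmetricAlgebra.ι ℂ (nMinus n) (lowerPart n A) ^ N ∈ relIdeal f m

theorem PowMem.smul {N : ℕ} {A : sp n} (h : PowMem f m N A) (c : ℂ) : PowMem f m N (c • A) := by
  rw [PowMem, map_smul, map_smul, smul_pow, Algebra.smul_def]
  exact Ideal.mul_mem_left _ _ h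

/-- The elements `A₁` and `A₂` represent the first two derivatives of `A` modulo the Borel
subalgebra, and the conclusion concerns $\exp(\mathrm{ad}\,e)A$. -/
theorem PowMem.exp {N : ℕ} {A A₁ A₂ e : sp n} (h : PowMem f m N A) (he : e ∈ nPlus n)
    (h₁ : lowerPart n ⁅e, A⁆ = lowerPart n A₁) (h₂ : lowerPart n ⁅e, A₁⁆ = lowerPart n A₂)
    (h₃ : lowerPart n ⁅e, A₂⁆ = 0) : PowMem f m N (A + A₁ + (1 / 2 : ℂ) • A₂) := by
  have hI : ∀ p ∈ relIdeal f m, symDerivation (adLower ⟨e, he⟩) p ∈ relIdeal f m := fun p hp => by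
    rw [← nPlusAction_apply]
    exact nPlusAction_mem_relIdeal f m ⟨e, he⟩ hp
  have hD : ∀ B : sp n, symDerivation (adLower ⟨e, he⟩) (SymmetricAlgebra.ι ℂ (nMinus n)
      (lowerPart n B)) = SymmetricAlgebra.ι ℂ (nMinus n) (lowerPart n ⁅e, B⁆) := fun B =>
    (symDerivation_ι _ _).trans (congrArg _ (lowerPart_lie_lowerPart ⟨e, he⟩ B))
  have d₁ := (hD A).trans (congrArg _ h₁)
  have d₂ := (hD A₁).trans (congrArg _ h₂)
  have d₃ := (hD A₂).trans ((congrArg _ h₃).trans (LinearMap.map_zero _))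
  have l₁ : lowerPart n (A + A₁ + (1 / 2 : ℂ) • A₂) =
      lowerPart n A + lowerPart n A₁ + (1 / 2 : ℂ) • lowerPart n A₂ := by
    rw [map_add, map_add, map_smul]
  have l₂ : ∀ a b c : nMinus n, SymmetricAlgebra.ι ℂ (nMinus n) (a + b + (1 / 2 : ℂ) • c) =
      SymmetricAlgebra.ι ℂ (nMinus n) a + SymmetricAlgebra.ι ℂ (nMinus n) b +
        (1 / 2 : ℂ) • SymmetricAlgebra.ι ℂ (nMinus n) c := fun a b c => by
    rw [LinearMap.map_add, LinearMap.map_add, LinearMap.map_smul]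
  rw [PowMem, l₁, l₂, ← d₂, ← d₁]
  refine exp_pow_mem hI ?_ h
  rw [d₁, d₂, d₃]

/-- After rescaling, `z = δ + u` with `u` supported strictly after `i`. Some element of `n⁺` acts on
vectors with `δ ↦ u ↦ 0`, and its exponential carries `δδ` to `zz`. -/
theorem PowMem.of_single_inl {N : ℕ} {i : Fin n}
    (h : PowMem f m N (symB (Pi.single (.inl i) 1) (Pi.single (.inl i) 1)))
    {z : Fin n ⊕ Fin n → ℂ} (hi : z (.inl i) ≠ 0) (hz : ∀ p, pos p < i → z p = 0) :
    PowMem f m N (symB z z) := by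
  set δ : Fin n ⊕ Fin n → ℂ := Pi.single (.inl i) 1 with hδ
  set a : Fin n ⊕ Fin n → ℂ := Pi.single (.inr i) 1 with ha
  set c := z (.inl i) with hc
  set u : Fin n ⊕ Fin n → ℂ := c⁻¹ • z - δ with hu
  have hzu : z = c • (δ + u) := by
    rw [hu, add_sub_cancel, smul_smul, mul_inv_cancel₀ hi, one_smul]
  have hui : u (.inl i) = 0 := by
    rw [hu, Pi.sub_apply, Pi.smul_apply, smul_eq_mul, ← hc, inv_mul_cancel₀ hi, hδ,
      Pi.single_eq_same, sub_self]
  have hu0 : ∀ p, pos p ≤ i → u p = 0 := by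
    intro p hp
    rcases hp.lt_or_eq with hp | hp
    · rw [hu, Pi.sub_apply, Pi.smul_apply, hz p hp, smul_zero, hδ, Pi.single_eq_of_ne, sub_zero]
      rintro rfl
      exact lt_irrefl _ hp
    · have : p = .inl i := pos_injective hp
      rw [this, hui]
  -- The correction by half the coordinate at `inr i` balances the term `omega w δ • a`, so that `δ`
  -- is sent exactly to `u`.
  set w : Fin n ⊕ Fin n → ℂ := u + (-(u (.inr i) / 2)) • a with hw
  have hs1 : sgn (.inl i : Fin n ⊕ Fin n) = 1 := rfl
  have hs2 : sgn (.inr i : Fin n ⊕ Fin n) = -1 := rfl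
  have haδ : omega a δ = 1 := by
    rw [ha, omega_single, Sum.swap_inr, hδ, Pi.single_eq_same, hs1, one_mul]
  have hau : omega a u = 0 := by
    rw [ha, omega_single, Sum.swap_inr, hui, mul_zero]
  have huδ : omega u δ = u (.inr i) := by
    rw [omega_antisymm, hδ, omega_single, Sum.swap_inl, hs2]
    ring
  have hTδ : transv a w δ = u := by
    rw [transv, haδ, hw, omega_add_left, omega_smul_left, haδ, huδ]
    funext p
    simp only [Pi.add_apply, Pi.smul_apply, smul_eq_mul]
    ring
  have hTu : transv a w u = 0 := by
    rw [transv, hau, hw, omega_add_left, omega_smul_left, hau, omega_self]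
    simp
  have hmem : -symB a w ∈ nPlus n := by
    refine neg_symB_mem_nPlus _ fun p hp => ?_
    change pos p ≤ i at hp
    rw [hw, Pi.add_apply, hu0 p hp, Pi.smul_apply, ha, Pi.single_eq_of_ne, smul_zero, add_zero]
    rintro rfl
    have := i.2
    simp only [pos] at hp
    omega
  have key := h.exp (A₁ := symB u δ + symB δ u) (A₂ := symB u u + symB u u) hmem
    (by rw [lie_symB, hTδ])
    (by rw [lie_add, lie_symB, lie_symB, hTδ, hTu, symB_zero_left, symB_zero_right, zero_add,
      add_zero])
    (by rw [lie_add, lie_symB, hTu, symB_zero_left, symB_zero_right, add_zero, add_zero, map_zero])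
  have e : symB z z = (c * c) • (symB δ δ + (symB u δ + symB δ u) +
      (1 / 2 : ℂ) • (symB u u + symB u u)) := by
    have e' : (1 / 2 : ℂ) • (symB u u + symB u u) = symB u u := by
      rw [← two_smul ℂ (symB u u), smul_smul]
      norm_num
    rw [e', hzu, symB_smul_left, symB_smul_right, symB_add_left, symB_add_right, symB_add_right,
      smul_smul]
    congr 1
    abel
  rw [e]
  exact key.smul _

/-- The same idea with two exponentials, one spreading the first factor and one spreading the
second. -/
theorem PowMem.of_single_inl_inr {N : ℕ} {a b : Fin n} (hab : a < b)
    (h : PowMem f m N (symB (Pi.single (.inl a) 1) (Pi.single (.inr b) 1)))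
    {z₁ z₂ : Fin n ⊕ Fin n → ℂ} (ha : z₁ (.inl a) ≠ 0) (hb : z₂ (.inr b) ≠ 0)
    (hz₁ : ∀ p, z₁ p ≠ 0 → ∃ r, p = .inl r ∧ a ≤ r ∧ r < b)
    (hz₂ : ∀ p, z₂ p ≠ 0 → ∃ r, p = .inr r ∧ a < r ∧ r ≤ b) :
    PowMem f m N (symB z₁ z₂) := by
  set δ₁ : Fin n ⊕ Fin n → ℂ := Pi.single (.inl a) 1 with hδ₁
  set δ₂ : Fin n ⊕ Fin n → ℂ := Pi.single (.inr b) 1 with hδ₂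
  set c₁ := z₁ (.inl a) with hc₁
  set c₂ := z₂ (.inr b) with hc₂
  set u₁ : Fin n ⊕ Fin n → ℂ := c₁⁻¹ • z₁ - δ₁ with hu₁
  set u₂ : Fin n ⊕ Fin n → ℂ := c₂⁻¹ • z₂ - δ₂ with hu₂
  have hzu₁ : z₁ = c₁ • (δ₁ + u₁) := by
    rw [hu₁, add_sub_cancel, smul_smul, mul_inv_cancel₀ ha, one_smul]
  have hzu₂ : z₂ = c₂ • (δ₂ + u₂) := by
    rw [hu₂, add_sub_cancel, smul_smul, mul_inv_cancel₀ hb, one_smul]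
  have hs₁ : ∀ p, u₁ p ≠ 0 → ∃ r, p = .inl r ∧ a < r ∧ r < b := by
    intro p hp
    have hpa : p ≠ .inl a := by
      rintro rfl
      apply hp
      rw [hu₁, Pi.sub_apply, Pi.smul_apply, smul_eq_mul, ← hc₁, inv_mul_cancel₀ ha, hδ₁,
        Pi.single_eq_same, sub_self]
    rw [hu₁, Pi.sub_apply, hδ₁, Pi.single_eq_of_ne hpa, sub_zero, Pi.smul_apply] at hp
    obtain ⟨r, rfl, h1, h2⟩ := hz₁ p (right_ne_zero_of_smul hp)
    exact ⟨r, rfl, lt_of_le_of_ne h1 fun h => hpa (by rw [h]), h2⟩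
  have hs₂ : ∀ p, u₂ p ≠ 0 → ∃ r, p = .inr r ∧ a < r ∧ r < b := by
    intro p hp
    have hpa : p ≠ .inr b := by
      rintro rfl
      apply hp
      rw [hu₂, Pi.sub_apply, Pi.smul_apply, smul_eq_mul, ← hc₂, inv_mul_cancel₀ hb, hδ₂,
        Pi.single_eq_same, sub_self]
    rw [hu₂, Pi.sub_apply, hδ₂, Pi.single_eq_of_ne hpa, sub_zero, Pi.smul_apply] at hp
    obtain ⟨r, rfl, h1, h2⟩ := hz₂ p (right_ne_zero_of_smul hp)
    exact ⟨r, rfl, h1, lt_of_le_of_ne h2 fun h => hpa (by rw [h])⟩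
  have hu₁r : ∀ r, u₁ (.inr r) = 0 := fun r => by
    by_contra hne
    obtain ⟨r', h', -⟩ := hs₁ _ hne
    simp at h'
  have hu₁l : ∀ r, (r = a ∨ r = b) → u₁ (.inl r) = 0 := fun r hr => by
    by_contra hne
    obtain ⟨r', h', h1, h2⟩ := hs₁ _ hne
    have := Sum.inl_injective h'
    subst this
    rcases hr with rfl | rfl
    · exact lt_irrefl _ h1
    · exact lt_irrefl _ h2
  have hu₂l : ∀ r, u₂ (.inl r) = 0 := fun r => by
    by_contra hne
    obtain ⟨r', h', -⟩ := hs₂ _ hne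
    simp at h'
  have hu₂r : u₂ (.inr b) = 0 := by
    by_contra hne
    obtain ⟨r', h', h1, h2⟩ := hs₂ _ hne
    exact h2.ne (Sum.inr_injective h').symm
  have hz₁r : ∀ r, z₁ (.inr r) = 0 := fun r => by
    by_contra hne
    obtain ⟨r', h', -⟩ := hz₁ _ hne
    simp at h'
  have hpow₁ : PowMem f m N (symB (δ₁ + u₁) δ₂) := by
    set e : Fin n ⊕ Fin n → ℂ := Pi.single (.inr a) 1 with he
    have hmem : -symB e u₁ ∈ nPlus n := by
      refine neg_symB_mem_nPlus _ fun p hp => ?_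
      by_contra hne
      obtain ⟨r, rfl, h1, -⟩ := hs₁ p hne
      exact absurd hp (not_le.2 h1)
    have h1 : transv e u₁ δ₁ = u₁ := by
      rw [transv, he, omega_single, omega_antisymm u₁, hδ₁, omega_single, Sum.swap_inl,
        Sum.swap_inr, hu₁r, Pi.single_eq_same]
      simp [sgn]
    have h2 : transv e u₁ δ₂ = 0 := by
      rw [transv, he, omega_single, omega_antisymm u₁, hδ₂, omega_single, Sum.swap_inr,
        Sum.swap_inr, hu₁l b (.inr rfl), Pi.single_eq_of_ne (by simp)]
      simp
    have h3 : transv e u₁ u₁ = 0 := by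
      rw [transv, he, omega_single, omega_self, Sum.swap_inr, hu₁l a (.inl rfl)]
      simp
    have key := h.exp (A₁ := symB u₁ δ₂) (A₂ := 0) hmem
      (by rw [lie_symB, h1, h2, symB_zero_right, add_zero])
      (by rw [lie_symB, h3, h2, symB_zero_right, symB_zero_left, add_zero])
      (by rw [lie_zero, map_zero])
    rwa [smul_zero, add_zero, ← symB_add_left] at key
  have hpow₂ : PowMem f m N (symB z₁ (δ₂ + u₂)) := by
    have h0 : PowMem f m N (symB z₁ δ₂) := by
      rw [hzu₁, symB_smul_left]
      exact hpow₁.smul _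
    set e : Fin n ⊕ Fin n → ℂ := Pi.single (.inl b) 1 with he
    have hmem : -symB e (-u₂) ∈ nPlus n := by
      refine neg_symB_mem_nPlus _ fun p hp => ?_
      by_contra hne
      obtain ⟨r, rfl, h1, h2⟩ := hs₂ p fun h0 => hne (by rw [Pi.neg_apply, h0, neg_zero])
      have := b.2
      simp only [Sum.swap_inl, pos] at hp
      rw [Fin.lt_def] at h2
      omega
    have hneg : -u₂ = (-1 : ℂ) • u₂ := by simp
    have h1 : transv e (-u₂) δ₂ = u₂ := by
      rw [transv, he, omega_single, hneg, omega_smul_left, omega_antisymm u₂, hδ₂, omega_single,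
        Sum.swap_inl, Sum.swap_inr, hu₂l, Pi.single_eq_same]
      simp [sgn]
    have h2 : transv e (-u₂) u₂ = 0 := by
      rw [transv, he, omega_single, hneg, omega_smul_left, omega_self, Sum.swap_inl, hu₂r]
      simp
    obtain ⟨d, h3⟩ : ∃ d : ℂ, transv e (-u₂) z₁ = d • e := by
      refine ⟨omega (-u₂) z₁, ?_⟩
      rw [transv, he, omega_single, Sum.swap_inl, hz₁r]
      simp
    -- Products of `e` with vectors supported on the barred letters up to `b` are upper triangular,
    -- so the disturbance disappears modulo the Borel subalgebra.
    have hlow₁ : lowerPart n (symB e δ₂) = 0 := by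
      rw [lowerPart_eq_zero_iff]
      intro p q hpq
      rw [symB_apply, he, hδ₂]
      rcases p with p | p <;> rcases q with q | q <;> simp only [Sum.swap_inl, Sum.swap_inr] <;>
        rw [Pi.single_apply, Pi.single_apply, Pi.single_apply, Pi.single_apply] <;>
        simp only [Sum.inl.injEq, Sum.inr.injEq, reduceCtorEq, if_false, mul_zero, zero_mul,
          add_zero, zero_add]
      · by_cases hp : p = b
        · by_cases hq : q = b
          · rw [hp, hq] at hpq
            exact absurd hpq (lt_irrefl _)
          · simp [hq]
        · simp [hp]
      · by_cases hp : p = b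
        · by_cases hq : q = b
          · rw [hp, hq] at hpq
            exact absurd hpq (lt_irrefl _)
          · simp [hq]
        · simp [hp]
    have hlow₂ : lowerPart n (symB e u₂) = 0 := by
      rw [lowerPart_eq_zero_iff]
      intro p q hpq
      rw [symB_apply]
      have hb := b.2
      have t1 : e p.swap * u₂ q = 0 := by
        by_contra hne
        have hp : p = .inr b := by
          by_contra hp
          refine left_ne_zero_of_mul hne ?_
          rw [he, Pi.single_eq_of_ne]
          intro h'
          exact hp (by rw [← Sum.swap_swap p, h', Sum.swap_inl])
        obtain ⟨r, rfl, -, h2⟩ := hs₂ q (right_ne_zero_of_mul hne)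
        rw [hp] at hpq
        simp only [pos] at hpq
        rw [Fin.lt_def] at h2
        omega
      have t2 : u₂ p.swap * e q = 0 := by
        by_contra hne
        have hq : q = .inl b := by
          by_contra hq
          exact right_ne_zero_of_mul hne (by rw [he, Pi.single_eq_of_ne hq])
        obtain ⟨r, hr, -, h2⟩ := hs₂ _ (left_ne_zero_of_mul hne)
        have hp : p = .inl r := by rw [← Sum.swap_swap p, hr, Sum.swap_inr]
        rw [hp, hq] at hpq
        simp only [pos] at hpq
        rw [Fin.lt_def] at h2
        omega
      rw [t1, t2, add_zero, mul_zero]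
    have key := h0.exp (A₁ := symB z₁ u₂) (A₂ := 0) hmem
      (by rw [lie_symB, h1, h3, symB_smul_left, map_add, map_smul, hlow₁, smul_zero, zero_add])
      (by rw [lie_symB, h2, h3, symB_smul_left, symB_zero_right, add_zero, map_smul, hlow₂,
        smul_zero, map_zero])
      (by rw [lie_zero, map_zero])
    rwa [smul_zero, add_zero, ← symB_add_right] at key
  rw [hzu₂, symB_smul_right]
  exact hpow₂.smul _

end PowersInIdeal

/-! ### Separating torus weights in a family of powers. -/

section CoefficientExtraction

variable {n : ℕ} {f : PosRoot n → nMinus n}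

/-- The letter content of an exponent, as a finitely supported function. -/
def letterFinsupp (t : PosRoot n → ℕ) : ℕ →₀ ℕ :=
  ∑ β, t β • (Finsupp.single (β.row : ℕ) 1 + Finsupp.single (2 * n - 2 - (β.col : ℕ)) 1)

theorem letterFinsupp_apply (t : PosRoot n → ℕ) (x : ℕ) :
    letterFinsupp t x = letterContent t x := by
  simp [letterFinsupp, letterContent, PosRoot.letters, Finsupp.single_apply, mul_add]

theorem letterFinsupp_eq_iff {s t : PosRoot n → ℕ} :
    letterFinsupp t = letterFinsupp s ↔ ∀ x, letterContent t x = letterContent s x := by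
  rw [Finsupp.ext_iff]
  simp only [letterFinsupp_apply]

theorem eval_letterFinsupp (ζ : ℕ → ℂ) (t : PosRoot n → ℕ) :
    MvPolynomial.eval ζ (MvPolynomial.monomial (letterFinsupp t) 1) =
      ∏ β : PosRoot n, (ζ β.row * ζ (2 * n - 2 - β.col)) ^ t β := by
  rw [letterFinsupp, MvPolynomial.monomial_sum_one, map_prod]
  refine Finset.prod_congr rfl fun β _ => ?_
  have h : (MvPolynomial.monomial (t β • (Finsupp.single (β.row : ℕ) 1 +
      Finsupp.single (2 * n - 2 - (β.col : ℕ)) 1)) 1 : MvPolynomial ℕ ℂ) =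
      (MvPolynomial.X (β.row : ℕ) * MvPolynomial.X (2 * n - 2 - (β.col : ℕ))) ^ t β := by
    rw [MvPolynomial.X, MvPolynomial.X, MvPolynomial.monomial_mul, MvPolynomial.monomial_pow,
      one_mul, one_pow]
  rw [h, map_pow, map_mul, MvPolynomial.eval_X, MvPolynomial.eval_X]

/-- The coefficient of `f^t` in a power of `∑ κ_β f_β`. -/
def powCoeff (κ : PosRoot n → ℂ) (t : PosRoot n → ℕ) : ℂ :=
  Nat.multinomial Finset.univ t * ∏ β, κ β ^ t β

theorem powCoeff_ne_zero {κ : PosRoot n → ℂ} {t : PosRoot n → ℕ} (h : ∀ β, t β ≠ 0 → κ β ≠ 0) :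
    powCoeff κ t ≠ 0 := by
  refine mul_ne_zero (Nat.cast_ne_zero.2 (Nat.multinomial_pos _ _).ne') ?_
  refine Finset.prod_ne_zero_iff.2 fun β _ => ?_
  by_cases ht : t β = 0
  · rw [ht, pow_zero]
    exact one_ne_zero
  · exact pow_ne_zero _ (h β ht)

theorem sum_smul_pow (κ θ : PosRoot n → ℂ) (N : ℕ) :
    (∑ β, (κ β * θ β) • SymmetricAlgebra.ι ℂ (nMinus n) (f β)) ^ N =
      ∑ t ∈ Finset.piAntidiag Finset.univ N,
        (powCoeff κ t * ∏ β, θ β ^ t β) • monomial f t := by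
  classical
  rw [Finset.sum_pow_eq_sum_piAntidiag]
  refine Finset.sum_congr rfl fun t _ => ?_
  have h : ∏ β, ((κ β * θ β) • SymmetricAlgebra.ι ℂ (nMinus n) (f β)) ^ t β =
      (∏ β, (κ β * θ β) ^ t β) • monomial f t := by
    rw [monomial, ← Finset.prod_smul]
    exact Finset.prod_congr rfl fun β _ => smul_pow _ _ _
  rw [h, powCoeff, mul_assoc, ← Finset.prod_mul_distrib, mul_smul, Nat.cast_smul_eq_nsmul,
    nsmul_eq_mul]
  simp only [mul_pow]

/-- If all the powers `(∑ κ_β ζ_row ζ_col f_β)^N` lie in `I`, then `f^s` is congruent modulo `I` to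
a combination of other monomials with the same letter content. -/
theorem exists_sub_mem_of_pow_mem {I : Ideal (SymMinus n)} {κ : PosRoot n → ℂ} {N : ℕ}
    (h : ∀ ζ : ℕ → ℂ, (∀ x, x < 2 * n → ζ x ≠ 0) →
      (∑ β : PosRoot n, (κ β * (ζ β.row * ζ (2 * n - 2 - β.col))) •
        SymmetricAlgebra.ι ℂ (nMinus n) (f β)) ^ N ∈ I)
    {s : PosRoot n → ℕ} (hs : ∑ β, s β = N) (hκ : ∀ β, s β ≠ 0 → κ β ≠ 0) :
    ∃ q ∈ Submodule.span ℂ (monomial f ''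
      {t | t ≠ s ∧ ∀ x, letterContent t x = letterContent s x}), monomial f s - q ∈ I := by
  classical
  set T := Finset.piAntidiag (Finset.univ : Finset (PosRoot n)) N with hT
  have hsT : s ∈ T := by
    rw [hT, Finset.mem_piAntidiag]
    exact ⟨hs, fun _ _ => Finset.mem_univ _⟩
  set T' := T.filter fun t => letterFinsupp t = letterFinsupp s with hT'
  have hsT' : s ∈ T' := Finset.mem_filter.2 ⟨hsT, rfl⟩
  have hmem : ∑ t ∈ T', powCoeff κ t • monomial f t ∈ I.restrictScalars ℂ := by
    -- If the component of this letter content were outside `I`, a functional killing `I` would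
    -- detect it. Its values on the powers form a polynomial in `ζ`, whose coefficient at that
    -- letter content is the detected number.
    by_contra hv
    obtain ⟨φ, hφv, hφI⟩ := Submodule.exists_le_ker_of_notMem hv
    set P : MvPolynomial ℕ ℂ := ∑ t ∈ T,
      MvPolynomial.C (powCoeff κ t * φ (monomial f t)) *
        MvPolynomial.monomial (letterFinsupp t) 1 with hP
    have hcoeff : P.coeff (letterFinsupp s) = φ (∑ t ∈ T', powCoeff κ t • monomial f t) := by
      rw [hP, MvPolynomial.coeff_sum, map_sum, hT', Finset.sum_filter]
      refine Finset.sum_congr rfl fun t _ => ?_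
      rw [MvPolynomial.coeff_C_mul, MvPolynomial.coeff_monomial, map_smul, smul_eq_mul]
      split_ifs <;> simp
    have heval : ∀ ζ : ℕ → ℂ, (∀ x, x < 2 * n → ζ x ≠ 0) → MvPolynomial.eval ζ P = 0 := by
      intro ζ hζ
      have h1 := hφI (show _ ∈ I.restrictScalars ℂ from h ζ hζ)
      rw [LinearMap.mem_ker, sum_smul_pow, map_sum] at h1
      rw [← h1, hP, map_sum]
      refine Finset.sum_congr rfl fun t _ => ?_
      rw [map_mul, MvPolynomial.eval_C, eval_letterFinsupp, map_smul, smul_eq_mul]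
      ring
    -- `P` is known to vanish only where all coordinates are nonzero; multiplying by the coordinates
    -- makes it vanish everywhere.
    have hzero : P * ∏ x ∈ Finset.range (2 * n), MvPolynomial.X x = 0 := by
      refine MvPolynomial.funext fun ζ => ?_
      rw [map_mul, map_prod, map_zero]
      by_cases hζ : ∀ x, x < 2 * n → ζ x ≠ 0
      · rw [heval ζ hζ, zero_mul]
      · push Not at hζ
        obtain ⟨x, hx, hx0⟩ := hζ
        rw [Finset.prod_eq_zero (Finset.mem_range.2 hx), mul_zero]
        rw [MvPolynomial.eval_X, hx0]
    have hP0 : P = 0 := (mul_eq_zero.1 hzero).resolve_right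
      (Finset.prod_ne_zero_iff.2 fun x _ => MvPolynomial.X_ne_zero x)
    rw [hP0, MvPolynomial.coeff_zero] at hcoeff
    exact hφv hcoeff.symm
  have hc := powCoeff_ne_zero hκ
  refine ⟨-((powCoeff κ s)⁻¹ • ∑ t ∈ T'.erase s, powCoeff κ t • monomial f t), ?_, ?_⟩
  · refine neg_mem (Submodule.smul_mem _ _ (Submodule.sum_mem _ fun t ht => ?_))
    refine Submodule.smul_mem _ _ (Submodule.subset_span ⟨t, ?_, rfl⟩)
    rw [Finset.mem_erase, hT', Finset.mem_filter] at ht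
    exact ⟨ht.1, letterFinsupp_eq_iff.1 ht.2.2⟩
  · have h2 : (powCoeff κ s)⁻¹ • ∑ t ∈ T', powCoeff κ t • monomial f t ∈ I.restrictScalars ℂ :=
      Submodule.smul_mem _ _ hmem
    have h3 : (powCoeff κ s)⁻¹ • powCoeff κ s • monomial f s = monomial f s :=
      inv_smul_smul₀ hc _
    rw [← Finset.add_sum_erase _ _ hsT', smul_add, h3] at h2
    rw [sub_neg_eq_add]
    exact h2

end CoefficientExtraction

/-! ### Straightening -/

section Straightening

attribute [local instance 100] LieRing.ofAssociativeRing

variable {n : ℕ} {f : PosRoot n → nMinus n} {m : Fin n → ℕ}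

theorem ι_lowerPart_eq_sum (hf : IsRootVectors f) (A : sp n) :
    SymmetricAlgebra.ι ℂ (nMinus n) (lowerPart n A) =
      ∑ β : PosRoot n, (A.1 β.tgt β.src / (f β).1.1 β.tgt β.src) •
        SymmetricAlgebra.ι ℂ (nMinus n) (f β) := by
  conv_lhs => rw [nMinus_eq_sum hf (lowerPart n A)]
  rw [map_sum]
  refine Finset.sum_congr rfl fun β _ => ?_
  rw [map_smul, lowerPart_apply, if_pos β.pos_src_lt]

theorem PowMem.of_root (hf : IsRootVectors f) {A : sp n} {β : PosRoot n}
    (hA : ∀ γ, γ ≠ β → A.1 γ.tgt γ.src = 0) {M N : ℕ} (hMN : M ≤ N)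
    (h : SymmetricAlgebra.ι ℂ (nMinus n) (f β) ^ M ∈ relIdeal f m) : PowMem f m N A := by
  rw [PowMem, ι_lowerPart_eq_sum hf, Finset.sum_eq_single β, smul_pow, Algebra.smul_def]
  · exact Ideal.mul_mem_left _ _ (Ideal.pow_mem_of_pow_mem _ h hMN)
  · intro γ _ hγ
    rw [hA γ hγ, zero_div, zero_smul]
  · intro h'
    exact absurd (Finset.mem_univ _) h'

/-- Powers of `zz` with `z` supported at positions from `i` on lie in the ideal. The coordinates of
`z` are the free parameters, and the coefficient of `f β` is the product of those at the two letters
of `β`. -/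
theorem exists_sub_mem_of_row_le (hf : IsRootVectors f) {i : Fin n} {s : PosRoot n → ℕ}
    (hs : ∀ β, s β ≠ 0 → i ≤ β.row) (hsum : ∑ k ∈ Finset.Ici i, m k < ∑ β, s β) :
    ∃ q ∈ Submodule.span ℂ (monomial f ''
      {t | t ≠ s ∧ ∀ x, letterContent t x = letterContent s x}),
      monomial f s - q ∈ relIdeal f m := by
  have hi := i.2
  set β₀ : PosRoot n := ⟨(i, ⟨2 * n - 2 - i, by omega⟩), by
    change (i : ℕ) ≤ 2 * n - 2 - i
    omega, by
    change (i : ℕ) + (2 * n - 2 - i) ≤ 2 * n - 2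
    omega⟩ with hβ₀
  have hrow : β₀.row = i := rfl
  have hcol : (β₀.col : ℕ) = 2 * n - 2 - i := rfl
  have hstart : PowMem f m (∑ β, s β) (symB (Pi.single (.inl i) 1) (Pi.single (.inl i) 1)) := by
    refine PowMem.of_root hf (β := β₀) (fun γ hγ => ?_) hsum
      (relSpace_le_relIdeal f m (Submodule.subset_span (.inr ⟨β₀, ?_, rfl⟩)))
    · have h : (Pi.single (.inl i) 1 : Fin n ⊕ Fin n → ℂ) γ.tgt.swap *
          (Pi.single (.inl i) 1 : Fin n ⊕ Fin n → ℂ) γ.src = 0 := by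
        by_cases h1 : γ.src = .inl i
        · rw [Pi.single_eq_of_ne (i' := γ.tgt.swap), zero_mul]
          intro h2
          have e1 := congrArg pos h1
          have e2 := congrArg pos h2
          have hb := γ.bounds
          rw [γ.pos_src] at e1
          rw [pos_swap, γ.pos_tgt] at e2
          simp only [pos] at e1 e2
          refine hγ (PosRoot.ext ?_ ?_)
          · rw [hrow, e1]
          · rw [hcol]
            omega
        · rw [Pi.single_eq_of_ne (i' := γ.src) h1, mul_zero]
      rw [symB_apply, h, add_zero, mul_zero]
    · change (i : ℕ) + (2 * n - 2 - i) = 2 * n - 2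
      omega
  refine exists_sub_mem_of_pow_mem (N := ∑ β, s β)
    -- The factor `2` arises because both terms of `symB z z` contribute equally.
    (κ := fun β => if i ≤ β.row then 2 * sgn β.tgt / (f β).1.1 β.tgt β.src else 0)
    (fun ζ hζ => ?_) rfl (fun β hβ => ?_)
  · set z : Fin n ⊕ Fin n → ℂ := fun p => if pos p < i then 0 else ζ (pos p) with hz
    have hmem := hstart.of_single_inl (z := z) (by
      rw [hz]
      simp only [pos, lt_irrefl, if_false]
      exact hζ i (by omega)) (fun p hp => if_pos hp)
    rw [PowMem, ι_lowerPart_eq_sum hf] at hmem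
    convert hmem using 4 with β
    have hb := β.bounds
    rw [symB_apply]
    by_cases hir : i ≤ β.row
    · have hir' : (i : ℕ) ≤ β.row := hir
      have h1 : z β.src = ζ β.row := by
        change (if pos β.src < i then 0 else ζ (pos β.src)) = _
        rw [β.pos_src, if_neg (not_lt.2 hir')]
      have h2 : z β.tgt.swap = ζ (2 * n - 2 - β.col) := by
        change (if pos β.tgt.swap < i then 0 else ζ (pos β.tgt.swap)) = _
        rw [pos_swap, β.pos_tgt, if_neg (by omega)]
        congr 1
        omega
      rw [if_pos hir, h1, h2]
      ring
    · have hir' : (β.row : ℕ) < i := not_le.1 hir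
      have h1 : z β.src = 0 := if_pos (by rwa [β.pos_src])
      rw [if_neg hir, h1]
      simp
  · rw [if_pos (hs β hβ)]
    exact div_ne_zero (mul_ne_zero two_ne_zero (sgn_ne_zero _)) (hf.entry_ne_zero β)

/-- The counterpart for paths that stay among unbarred letters. The factors `z₁` and `z₂` have
unbarred and barred support respectively, so exactly the roots with `i ≤ row` and `col ≤ j` appear.
-/
theorem exists_sub_mem_of_row_le_of_col_le (hf : IsRootVectors f) {i j : Fin n} (hij : i ≤ j)
    (hj : (j : ℕ) + 1 < n) {s : PosRoot n → ℕ}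
    (hs : ∀ β, s β ≠ 0 → i ≤ β.row ∧ (β.col : ℕ) ≤ j)
    (hsum : ∑ k ∈ Finset.Icc i j, m k < ∑ β, s β) :
    ∃ q ∈ Submodule.span ℂ (monomial f ''
      {t | t ≠ s ∧ ∀ x, letterContent t x = letterContent s x}),
      monomial f s - q ∈ relIdeal f m := by
  have hij' : (i : ℕ) ≤ j := hij
  set b : Fin n := ⟨j + 1, hj⟩ with hb
  have hbv : (b : ℕ) = j + 1 := rfl
  have hib : i < b := by
    rw [Fin.lt_def]
    omega
  set β₀ : PosRoot n := ⟨(i, ⟨j, by omega⟩), hij', by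
    change (i : ℕ) + j ≤ 2 * n - 2
    omega⟩ with hβ₀
  have hrow : β₀.row = i := rfl
  have hcol : (β₀.col : ℕ) = j := rfl
  have hlet : letter β₀.col = j := Fin.ext (by
    change min (j : ℕ) (2 * n - 2 - j) = j
    omega)
  have hstart : PowMem f m (∑ β, s β) (symB (Pi.single (.inl i) 1) (Pi.single (.inr b) 1)) := by
    have hrel := relSpace_le_relIdeal f m (Submodule.subset_span (.inl ⟨β₀, hj, rfl⟩))
    rw [hlet, hrow] at hrel
    refine PowMem.of_root hf (β := β₀) (fun γ hγ => ?_) hsum hrel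
    have h1 : (Pi.single (.inr b) 1 : Fin n ⊕ Fin n → ℂ) γ.src = 0 :=
      Pi.single_eq_of_ne (by simp [PosRoot.src]) _
    have h2 : (Pi.single (.inr b) 1 : Fin n ⊕ Fin n → ℂ) γ.tgt.swap *
        (Pi.single (.inl i) 1 : Fin n ⊕ Fin n → ℂ) γ.src = 0 := by
      by_cases h1 : γ.src = .inl i
      · rw [Pi.single_eq_of_ne (i' := γ.tgt.swap), zero_mul]
        intro h2
        have e1 := congrArg pos h1
        have e2 := congrArg pos h2
        have hb := γ.bounds
        rw [γ.pos_src] at e1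
        rw [pos_swap, γ.pos_tgt] at e2
        simp only [pos] at e1 e2
        refine hγ (PosRoot.ext ?_ ?_)
        · rw [hrow, e1]
        · rw [hcol]
          omega
      · rw [Pi.single_eq_of_ne (i' := γ.src) h1, mul_zero]
    rw [symB_apply, h1, h2, mul_zero, add_zero, mul_zero]
  refine exists_sub_mem_of_pow_mem (N := ∑ β, s β)
    (κ := fun β => if i ≤ β.row ∧ (β.col : ℕ) ≤ j then sgn β.tgt / (f β).1.1 β.tgt β.src else 0)
    (fun ζ hζ => ?_) rfl (fun β hβ => ?_)
  · set z₁ : Fin n ⊕ Fin n → ℂ := Sum.elim (fun r => if i ≤ r ∧ r < b then ζ r else 0) 0 with hz₁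
    set z₂ : Fin n ⊕ Fin n → ℂ :=
      Sum.elim 0 fun r => if i < r ∧ r ≤ b then ζ (2 * n - 1 - r) else 0 with hz₂
    have hmem := hstart.of_single_inl_inr (z₁ := z₁) (z₂ := z₂) hib (by
        change (if i ≤ i ∧ i < b then ζ i else 0) ≠ 0
        rw [if_pos ⟨le_rfl, hib⟩]
        exact hζ i (by omega)) (by
        change (if i < b ∧ b ≤ b then ζ (2 * n - 1 - b) else 0) ≠ 0
        rw [if_pos ⟨hib, le_rfl⟩]
        exact hζ _ (by omega)) (by
        rintro (r | r) hr
        · change (if i ≤ r ∧ r < b then ζ r else 0) ≠ 0 at hr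
          by_cases h : i ≤ r ∧ r < b
          · exact ⟨r, rfl, h⟩
          · rw [if_neg h] at hr
            exact absurd rfl hr
        · exact absurd rfl hr) (by
        rintro (r | r) hr
        · exact absurd rfl hr
        · change (if i < r ∧ r ≤ b then ζ (2 * n - 1 - r) else 0) ≠ 0 at hr
          by_cases h : i < r ∧ r ≤ b
          · exact ⟨r, rfl, h⟩
          · rw [if_neg h] at hr
            exact absurd rfl hr)
    rw [PowMem, ι_lowerPart_eq_sum hf] at hmem
    convert hmem using 4 with β
    have hbd := β.bounds
    have hz₁s : z₁ β.src = if i ≤ β.row ∧ β.row < b then ζ β.row else 0 := rfl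
    have hz₂s : z₂ β.src = 0 := rfl
    rw [symB_apply, hz₁s, hz₂s, mul_zero, zero_add]
    by_cases hir : i ≤ β.row ∧ (β.col : ℕ) ≤ j
    · have hir' : (i : ℕ) ≤ β.row := hir.1
      have htgt : β.tgt = .inl ⟨β.col + 1, by omega⟩ := pos_injective (by
        rw [β.pos_tgt]
        rfl)
      have hz₂t : z₂ β.tgt.swap = ζ (2 * n - 2 - β.col) := by
        rw [htgt]
        change (if i < ⟨β.col + 1, _⟩ ∧ ⟨β.col + 1, _⟩ ≤ b then
          ζ (2 * n - 1 - (β.col + 1)) else 0) = _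
        rw [if_pos]
        · congr 1
          omega
        · rw [Fin.lt_def, Fin.le_def]
          exact ⟨by simp only; omega, by simp only; omega⟩
      have hrb : β.row < b := by
        rw [Fin.lt_def]
        omega
      rw [if_pos hir, if_pos ⟨hir.1, hrb⟩, hz₂t]
      ring
    · rw [if_neg hir, zero_mul]
      have h0 : z₂ β.tgt.swap * (if i ≤ β.row ∧ β.row < b then ζ β.row else 0) = 0 := by
        by_contra hne
        have h1 := right_ne_zero_of_mul hne
        have h2 := left_ne_zero_of_mul hne
        have h1' : i ≤ β.row := by
          by_contra h
          rw [if_neg fun h' => h h'.1] at h1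
          exact h1 rfl
        refine hir ⟨h1', ?_⟩
        rcases ht : β.tgt with r | r
        · rw [ht] at h2
          change (if i < r ∧ r ≤ b then ζ (2 * n - 1 - r) else 0) ≠ 0 at h2
          have h3 : r ≤ b := by
            by_contra h
            rw [if_neg fun h' => h h'.2] at h2
            exact h2 rfl
          have e := β.pos_tgt
          rw [ht] at e
          simp only [pos] at e
          rw [Fin.le_def] at h3
          omega
        · rw [ht] at h2
          exact absurd rfl h2
      rw [h0, mul_zero, zero_div]
  · rw [if_pos (hs β hβ)]
    exact div_ne_zero (sgn_ne_zero _) (hf.entry_ne_zero β)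

theorem DyckPath.first_below (p : DyckPath n) {β : PosRoot n} (h : β ∈ p.roots) :
    p.first.Below β := by
  have hp := p.pairwise
  have hd := List.cons_head_tail p.ne_nil
  rw [← hd] at hp h
  rcases List.mem_cons.1 h with rfl | h
  · exact PosRoot.Below.refl _
  · exact ((List.pairwise_cons.1 hp).1 β h).1

theorem DyckPath.below_last (p : DyckPath n) {β : PosRoot n} (h : β ∈ p.roots) :
    β.Below p.last := by
  have hp := p.pairwise
  have hd := List.dropLast_append_getLast p.ne_nil
  rw [← hd] at hp h
  rcases List.mem_append.1 h with h | h
  · exact ((List.pairwise_append.1 hp).2.2 β h _ (List.mem_singleton_self _)).1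
  · rw [List.mem_singleton.1 h]
    exact PosRoot.Below.refl _

theorem DyckPath.below_or_below (p : DyckPath n) {β γ : PosRoot n} (hβ : β ∈ p.roots)
    (hγ : γ ∈ p.roots) : β.Below γ ∨ γ.Below β := by
  by_cases h : β = γ
  · exact .inl (h ▸ PosRoot.Below.refl _)
  · have hp : p.roots.Pairwise fun β γ => β.Below γ ∨ γ.Below β :=
      p.pairwise.imp fun h => .inl h.1
    have : Std.Symm fun β γ : PosRoot n => β.Below γ ∨ γ.Below β := ⟨fun _ _ => Or.symm⟩
    exact hp.forall hβ hγ h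

theorem DyckPath.nodup (p : DyckPath n) : p.roots.Nodup := p.pairwise.imp fun h => h.2

/-- A point that is not in the polytope violates the inequality of a Dyck path. -/
theorem exists_dyckPath_of_notMem {s : PosRoot n → ℕ} (hs : s ∉ latticePoints m) :
    ∃ p : DyckPath n,
      ((p.last.col : ℕ) + 1 < n ∧ p.last.IsSimple ∧
        ∑ k ∈ Finset.Icc p.first.row p.last.row, m k < (p.roots.map s).sum) ∨
      ∑ k ∈ Finset.Ici p.first.row, m k < (p.roots.map s).sum := by
  by_contra h
  push Not at h
  have hcast : ∀ p : DyckPath n, (p.roots.map fun β => (s β : ℝ)).sum =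
      (((p.roots.map s).sum : ℕ) : ℝ) := fun p => by
    rw [Nat.cast_list_sum, List.map_map]
    rfl
  refine hs ⟨fun β => Nat.cast_nonneg _, fun p => ⟨fun hp => ?_, fun hp => ?_⟩⟩
  · rw [hcast]
    by_cases hc : (p.last.col : ℕ) + 1 < n
    · exact_mod_cast (h p).1 hc hp
    -- The remaining simple end is the last simple root, for which the two kinds of bound coincide.
    · have hp' : (p.last.col : ℕ) = p.last.row := hp
      have := p.last.bounds
      have hIcc : Finset.Icc p.first.row p.last.row = Finset.Ici p.first.row := by
        ext k
        have := k.2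
        simp only [Finset.mem_Icc, Finset.mem_Ici, and_iff_left_iff_imp, Fin.le_def]
        omega
      rw [hIcc]
      exact_mod_cast (h p).2
  · rw [hcast]
    exact_mod_cast (h p).2

theorem monomial_mem_sup (hf : IsRootVectors f) (s : PosRoot n → ℕ) :
    monomial f s ∈ Submodule.span ℂ (monomial f '' latticePoints m) ⊔
      (relIdeal f m).restrictScalars ℂ := by
  classical
  set T := Submodule.span ℂ (monomial f '' latticePoints m) ⊔
    (relIdeal f m).restrictScalars ℂ with hT
  -- Induction on the lexicographic order, which is well founded because there are finitely many
  -- roots.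
  refine (wellFounded_lt (α := Lex (PosRoot n → ℕ))).induction
    (C := fun s => monomial f (ofLex s) ∈ T) (toLex s) fun s ih => ?_
  change PosRoot n → ℕ at s
  change monomial f s ∈ T
  by_cases hs : s ∈ latticePoints m
  · exact Submodule.mem_sup_left (Submodule.subset_span ⟨s, hs, rfl⟩)
  obtain ⟨p, hp⟩ := exists_dyckPath_of_notMem hs
  -- Only the part of `s` on the violated path is straightened; the remaining factor is carried
  -- along.
  set s' : PosRoot n → ℕ := fun β => if β ∈ p.roots then s β else 0 with hs'
  set s'' : PosRoot n → ℕ := fun β => if β ∈ p.roots then 0 else s β with hs''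
  have hadd : s = s' + s'' := by
    funext β
    rw [Pi.add_apply, hs', hs'']
    dsimp only
    split_ifs <;> simp
  have hmem : ∀ β, s' β ≠ 0 → β ∈ p.roots := fun β hβ => by
    by_contra h
    exact hβ (if_neg h)
  have hsum : ∑ β, s' β = (p.roots.map s).sum := by
    rw [hs', ← Finset.sum_filter, ← List.sum_toFinset _ p.nodup]
    congr 1
    ext β
    simp
  have hq : ∃ q ∈ Submodule.span ℂ (monomial f ''
      {t | t ≠ s' ∧ ∀ x, letterContent t x = letterContent s' x}),
      monomial f s' - q ∈ relIdeal f m := by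
    rcases hp with ⟨hc, hsimple, hlt⟩ | hlt
    · have hsimple' : (p.last.col : ℕ) = p.last.row := hsimple
      rw [← hsum] at hlt
      refine exists_sub_mem_of_row_le_of_col_le hf ?_ (by omega) (fun β hβ => ?_) hlt
      · exact (p.first_below (List.getLast_mem p.ne_nil)).1
      · exact ⟨(p.first_below (hmem β hβ)).1, hsimple' ▸ (p.below_last (hmem β hβ)).2⟩
    · rw [← hsum] at hlt
      exact exists_sub_mem_of_row_le hf (fun β hβ => (p.first_below (hmem β hβ)).1) hlt
  obtain ⟨q, hq, hsq⟩ := hq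
  have h1 : monomial f s = monomial f s'' * (monomial f s' - q) + q * monomial f s'' := by
    conv_lhs => rw [hadd, monomial_add]
    ring
  rw [h1]
  refine add_mem (Submodule.mem_sup_right (Ideal.mul_mem_left _ _ hsq)) ?_
  clear h1 hsq
  induction hq using Submodule.span_induction with
  | mem q h =>
    obtain ⟨t, ⟨hne, ht⟩, rfl⟩ := h
    rw [← monomial_add]
    -- The support of `s'` is a chain, so it dominates every other exponent with its letter content.
    have hlt : toLex t < toLex s' := lex_lt_of_letterContent_eq
      (fun β γ hβ hγ => p.below_or_below (hmem β hβ) (hmem γ hγ)) (fun x => (ht x).symm) hne.symm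
    refine ih (toLex (t + s'')) ?_
    rw [hadd]
    exact add_lt_add_left (α := Lex (PosRoot n → ℕ)) hlt _
  | zero =>
    rw [zero_mul]
    exact zero_mem _
  | add a b _ _ ha hb =>
    rw [add_mul]
    exact add_mem ha hb
  | smul c a _ ha =>
    rw [smul_mul_assoc]
    exact Submodule.smul_mem _ _ ha

/-- The monomials `f^s`, `s ∈ S(λ)`, span `S(n⁻)` modulo the ideal of relations. -/
theorem exists_sub_mem_relIdeal (hf : IsRootVectors f) (m : Fin n → ℕ) (p : SymMinus n) :
    ∃ q ∈ Submodule.span ℂ (monomial f '' latticePoints m), p - q ∈ relIdeal f m := by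
  have hp : p ∈ Submodule.span ℂ (monomial f '' latticePoints m) ⊔
      (relIdeal f m).restrictScalars ℂ := by
    have hle : Submodule.span ℂ (Set.range (monomial f)) ≤
        Submodule.span ℂ (monomial f '' latticePoints m) ⊔ (relIdeal f m).restrictScalars ℂ := by
      refine Submodule.span_le.2 ?_
      rintro _ ⟨s, rfl⟩
      exact monomial_mem_sup hf s
    rw [span_monomial hf] at hle
    exact hle trivial
  obtain ⟨q, hq, r, hr, rfl⟩ := Submodule.mem_sup.1 hp
  exact ⟨q, hq, by rwa [add_sub_cancel_left]⟩

end Straightening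

end PBW

end

theorem theorem3p1 (n : ℕ) (hn : 1 ≤ n)
    (f : PBW.PosRoot n → PBW.nMinus n) (hf : PBW.IsRootVectors f) :
    (∀ (m : Fin n → ℕ) (V : Type*) [AddCommGroup V] [Module ℂ V]
      [LieRingModule (PBW.sp n) V] [LieModule ℂ (PBW.sp n) V]
      [LieModule.IsIrreducible ℂ (PBW.sp n) V]
      (v : V), PBW.IsHighestWeightVector m v →
        (∃ b : Module.Basis (PBW.latticePoints m) ℂ (PBW.Gr ℂ (PBW.nMinus n) v),
          ∀ s : PBW.latticePoints m,
            b s = PBW.monomial f s • PBW.grVec ℂ (PBW.nMinus n) v) ∧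
        Ideal.torsionOf (PBW.SymMinus n) (PBW.Gr ℂ (PBW.nMinus n) v)
          (PBW.grVec ℂ (PBW.nMinus n) v) = PBW.relIdeal f m) ∧
    (∀ (l m : Fin n → ℕ) (V : Type*) (W : Type*) (X : Type*)
      [AddCommGroup V] [Module ℂ V] [LieRingModule (PBW.sp n) V] [LieModule ℂ (PBW.sp n) V]
      [LieModule.IsIrreducible ℂ (PBW.sp n) V]
      [AddCommGroup W] [Module ℂ W] [LieRingModule (PBW.sp n) W] [LieModule ℂ (PBW.sp n) W]
      [LieModule.IsIrreducible ℂ (PBW.sp n) W]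
      [AddCommGroup X] [Module ℂ X] [LieRingModule (PBW.sp n) X] [LieModule ℂ (PBW.sp n) X]
      [LieModule.IsIrreducible ℂ (PBW.sp n) X]
      (v : V) (w : W) (x : X),
      PBW.IsHighestWeightVector l v → PBW.IsHighestWeightVector m w →
      PBW.IsHighestWeightVector (l + m) x →
        Nonempty (PBW.grCartan ℂ (PBW.nMinus n) v w ≃ₗ[PBW.SymMinus n]
          PBW.Gr ℂ (PBW.nMinus n) x)) := by
  refine ⟨fun m V => ?_, fun l m V W X => ?_⟩
  · intro _ _ _ _ _ v hv
    exact PBW.basis_and_torsionOf hf hv (PBW.exists_sub_mem_relIdeal hf m)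
  · intro _ _ _ _ _ _ _ _ _ _ _ _ _ _ _ v w x hv hw hx
    exact PBW.nonempty_grCartan_equiv hf hv hw hx (PBW.exists_sub_mem_relIdeal hf (l + m))
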